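/- Conventions. $\mathcal{A}ssoc$ is the nonsymmetric operad with exactly one operation $a_n$ in each arity $n\ge 0$. A weak bimodule over it is a sequence of spaces $M(n)$, $n\ge 0$, with maps $a_n\circ_i(-)\colon M(k)\to M(n+k-1)$ ($1\le i\le n$) and $(-)\circ_i a_n\colon M(k)\to M(k+n-1)$ ($1\le i\le k$), subject to the usual unit, associativity and commutativity axioms (equivalently, $M$ is a cosimplicial space); an $N$-truncated weak bimodule consists of $M(0),\dots,M(N)$ with those operations and axioms that involve only degrees $\le N$, and $(-)|_N$ denotes truncation ($|_\infty$ is the identity). $B$ is obtained from $A$ by a free attachment of cells if it is a pushout $A\cup_{X(\partial D)}X(D)$ of (truncated) weak bimodules, where $D$ is a disjoint union of discs placed in various degrees and $X(-)$ is the free weak bimodule functor. A weak bimodule is cofibrant if it is obtained from the free weak bimodule $X(\emptyset)$ (which is empty) by a transfinite sequence of free attachments of cells. A cofibrant model of $A$ is a cofibrant $M$ together with a morphism $M\to A$ that is a weak homotopy equivalence in each degree. A point of $\widetilde\triangle(n)$ is a hairy configuration: points $0\le t_1\le\dots\le t_n\le 1$ (labelled points), and finitely many hairs of length in $(0,1]$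 growing from distinct points of $(0,1)$ different from the $t_j$. The topology is the quotient topology from the disjoint union over $m\ge0$ of the spaces of $n$ labelled points together with $m$ hairs of arbitrary positions and lengths in $[0,1]$, where a hair of length $0$, at a labelled point or at an end point of $[0,1]$ disappears, and among several hairs at one point only the longest survives. The operation $a_n\circ_i(-)$ adds $i-1$ labelled points at $0$ and $n-i$ at $1$; for $n\ge1$, $(-)\circ_i a_n$ replaces the $i$-th labelled point by $n$ copies of it; and $(-)\circ_i a_0$ replaces the $i$-th labelled point by a hair of length $1$ if it is in $(0,1)$ and distinct from the other labelled points, and forgets it otherwise. Let $\widetilde\triangle_n\subset\widetilde\triangle$ consist of the configurations with at most $n$ geometrically distinct points (labelled points and feet of hairs) in $(0,1)$, with $\widetilde\triangle_{-1}=\emptyset$. For $n\ge0$ and $0\le i\le n$ let $\widetilde\triangle_{n-1,i}\subset\widetilde\triangle_n$ consist of $\widetilde\triangle_{n-1}$ and of the configurations with exactly $n$ such points and at most $i$ hairs of length $<1$; put $\widetilde\triangle_{n-1,-1}=\widetilde\triangle_{n-1}$. Proposition. (1) $\widetilde\triangle$ is a cofibrant model of $\mathcal{A}ssoc$ as a weak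 bimodule over $\mathcal{A}ssoc$. (2) For every $n\ge0$, $\widetilde\triangle_n|_n$ is a cofibrant model of $\mathcal{A}ssoc|_n$ as an $n$-truncated weak bimodule over $\mathcal{A}ssoc$. (3) For every $n\ge 0$ one has $\widetilde\triangle_{n-1,n}=\widetilde\triangle_n$, and for all $0\le i\le n$ the weak bimodule $\widetilde\triangle_{n-1,i}$ is obtained from $\widetilde\triangle_{n-1,i-1}$, along the inclusion, by a free attachment of $\binom ni$ cells of dimension $n+i$ in degree $n-i$; the same holds for the $N$-truncations whenever $n-i\le N\le\infty$. Moreover $\widetilde\triangle$ is the union of the $\widetilde\triangle_n$, in each degree with the colimit topology. -/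

import Mathlib

open CategoryTheory HomotopicalAlgebra

/-! ### Discrete nonsymmetric operads -/

/-- A nonsymmetric operad in sets (equivalently, a nonsymmetric topological operad all of whose
components are discrete), given by partial compositions.  Inputs are numbered from `0`, and
`comp h i hi a b` is the insertion of `b` into the input number `i` of `a`; the arity of the result
is the number `p` with `p + 1 = n + m`. -/
structure NSOperad where
  /-- the operations of arity `n` -/
  Op : ℕ → Type
  /-- the unit -/
  one : Op 1
  /-- partial composition -/
  comp {n m p : ℕ} (h : p + 1 = n + m) (i : ℕ) (hi : i < n) (a : Op n) (b : Op m) : Op p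
  one_comp {n : ℕ} (h : n + 1 = 1 + n) (h0 : 0 < 1) (a : Op n) : comp h 0 h0 one a = a
  comp_one {n : ℕ} (h : n + 1 = n + 1) (i : ℕ) (hi : i < n) (a : Op n) : comp h i hi a one = a
  assoc_seq {n m l p r s : ℕ} (h₁ : p + 1 = n + m) (h₂ : r + 1 = p + l) (h₃ : s + 1 = m + l)
    (h₄ : r + 1 = n + s) (i j : ℕ) (hi : i < n) (hj : j < m) (hij : i + j < p)
    (a : Op n) (b : Op m) (c : Op l) :
    comp h₂ (i + j) hij (comp h₁ i hi a b) c = comp h₄ i hi a (comp h₃ j hj b c)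
  assoc_par {n m l p r s : ℕ} (h₁ : p + 1 = n + m) (h₂ : r + 1 = p + l) (h₃ : s + 1 = n + l)
    (h₄ : r + 1 = s + m) (i j j' : ℕ) (hij : i < j) (hj : j < n) (hi : i < n) (hi' : i < s)
    (hjj' : j' + 1 = j + m) (hj' : j' < p)
    (a : Op n) (b : Op m) (c : Op l) :
    comp h₂ j' hj' (comp h₁ i hi a b) c = comp h₄ i hi' (comp h₃ j hj a c) b

/-- The associative operad `Assoc`, with exactly one operation in every arity `n ≥ 0`. -/
def assocOperad : NSOperad where
  Op _ := Unit
  one := ()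
  comp _ _ _ _ _ := ()
  one_comp _ _ _ := rfl
  comp_one _ _ _ _ := rfl
  assoc_seq _ _ _ _ _ _ _ _ _ _ _ _ := rfl
  assoc_par _ _ _ _ _ _ _ _ _ _ _ _ _ _ _ _ := rfl

/-! ### (Truncated) weak bimodules -/

/-- The degrees of an `N`-truncated weak bimodule: `0, 1, …, N`, and all natural numbers for
`N = ⊤`. -/
def Deg (N : ℕ∞) : Type := {n : ℕ // (n : ℕ∞) ≤ N}

/-- An `N`-truncated weak bimodule (in topological spaces) over a discrete nonsymmetric operad.
For `N = ⊤` this is a weak bimodule.  `lact _ i _ o m` is `o ∘_{i+1} m` and `ract _ i _ o m` is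
`m ∘_{i+1} o`.  As the operad is discrete, continuity of an action means continuity in `m`. -/
structure WBimod (O : NSOperad) (N : ℕ∞) where
  /-- the components -/
  obj : Deg N → TopCat.{0}
  /-- the weak left action -/
  lact {n : ℕ} {k p : Deg N} (h : p.1 + 1 = n + k.1) (i : ℕ) (hi : i < n) (o : O.Op n) :
    obj k ⟶ obj p
  /-- the weak right action -/
  ract {n : ℕ} {k p : Deg N} (h : p.1 + 1 = k.1 + n) (i : ℕ) (hi : i < k.1) (o : O.Op n) :
    obj k ⟶ obj p
  one_lact {k : Deg N} (h : k.1 + 1 = 1 + k.1) (h0 : 0 < 1) (m : obj k) :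
    lact h 0 h0 O.one m = m
  ract_one {k : Deg N} (h : k.1 + 1 = k.1 + 1) (i : ℕ) (hi : i < k.1) (m : obj k) :
    ract h i hi O.one m = m
  /-- `(o₁ ∘_i o₂) ∘_{i+j} m = o₁ ∘_i (o₂ ∘_j m)` -/
  lact_lact {n n' r : ℕ} {k p s : Deg N} (h₁ : r + 1 = n + n') (h₂ : p.1 + 1 = r + k.1)
    (h₃ : s.1 + 1 = n' + k.1) (h₄ : p.1 + 1 = n + s.1) (i j : ℕ) (hi : i < n) (hj : j < n')
    (hij : i + j < r) (o₁ : O.Op n) (o₂ : O.Op n') (m : obj k) :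
    lact h₂ (i + j) hij (O.comp h₁ i hi o₁ o₂) m = lact h₄ i hi o₁ (lact h₃ j hj o₂ m)
  /-- `(m ∘_i o₁) ∘_{i+j} o₂ = m ∘_i (o₁ ∘_j o₂)` -/
  ract_ract {n n' r : ℕ} {k p s : Deg N} (h₁ : r + 1 = n + n') (h₂ : p.1 + 1 = k.1 + r)
    (h₃ : s.1 + 1 = k.1 + n) (h₄ : p.1 + 1 = s.1 + n') (i j : ℕ) (hi : i < k.1) (hj : j < n)
    (hij : i + j < s.1) (o₁ : O.Op n) (o₂ : O.Op n') (m : obj k) :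
    ract h₄ (i + j) hij o₂ (ract h₃ i hi o₁ m) = ract h₂ i hi (O.comp h₁ j hj o₁ o₂) m
  /-- `(m ∘_i o₁) ∘_{j + n - 1} o₂ = (m ∘_j o₂) ∘_i o₁` for `i < j` -/
  ract_comm {n n' : ℕ} {k p s t : Deg N} (h₁ : s.1 + 1 = k.1 + n) (h₂ : p.1 + 1 = s.1 + n')
    (h₃ : t.1 + 1 = k.1 + n') (h₄ : p.1 + 1 = t.1 + n) (i j j' : ℕ) (hij : i < j)
    (hi : i < k.1) (hj : j < k.1) (hi' : i < t.1) (hjj' : j' + 1 = j + n) (hj' : j' < s.1)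
    (o₁ : O.Op n) (o₂ : O.Op n') (m : obj k) :
    ract h₂ j' hj' o₂ (ract h₁ i hi o₁ m) = ract h₄ i hi' o₁ (ract h₃ j hj o₂ m)
  /-- `(o₁ ∘_i m) ∘_{i+j} o₂ = o₁ ∘_i (m ∘_j o₂)` -/
  lact_ract {n n' : ℕ} {k p s t : Deg N} (h₁ : s.1 + 1 = n + k.1) (h₂ : p.1 + 1 = s.1 + n')
    (h₃ : t.1 + 1 = k.1 + n') (h₄ : p.1 + 1 = n + t.1) (i j : ℕ) (hi : i < n) (hj : j < k.1)
    (hij : i + j < s.1) (o₁ : O.Op n) (o₂ : O.Op n') (m : obj k) :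
    ract h₂ (i + j) hij o₂ (lact h₁ i hi o₁ m) = lact h₄ i hi o₁ (ract h₃ j hj o₂ m)
  /-- `(o₁ ∘_i m) ∘_j o₂ = (o₁ ∘_j o₂) ∘_{i + n' - 1} m` for `j < i` -/
  lact_comp_left {n n' r : ℕ} {k p s : Deg N} (h₁ : s.1 + 1 = n + k.1)
    (h₂ : p.1 + 1 = s.1 + n') (h₃ : r + 1 = n + n') (h₄ : p.1 + 1 = r + k.1) (i j i' : ℕ)
    (hij : j < i) (hi : i < n) (hj : j < n) (hj' : j < s.1) (hii' : i' + 1 = i + n')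
    (hi' : i' < r) (o₁ : O.Op n) (o₂ : O.Op n') (m : obj k) :
    ract h₂ j hj' o₂ (lact h₁ i hi o₁ m) = lact h₄ i' hi' (O.comp h₃ j hj o₁ o₂) m
  /-- `(o₁ ∘_i m) ∘_{j + k - 1} o₂ = (o₁ ∘_j o₂) ∘_i m` for `i < j` -/
  lact_comp_right {n n' r : ℕ} {k p s : Deg N} (h₁ : s.1 + 1 = n + k.1)
    (h₂ : p.1 + 1 = s.1 + n') (h₃ : r + 1 = n + n') (h₄ : p.1 + 1 = r + k.1) (i j j' : ℕ)
    (hij : i < j) (hi : i < n) (hj : j < n) (hjj' : j' + 1 = j + k.1) (hj' : j' < s.1)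
    (hi' : i < r) (o₁ : O.Op n) (o₂ : O.Op n') (m : obj k) :
    ract h₂ j' hj' o₂ (lact h₁ i hi o₁ m) = lact h₄ i hi' (O.comp h₃ j hj o₁ o₂) m

namespace WBimod

variable {O : NSOperad} {N : ℕ∞}

/-- Morphisms of weak bimodules. -/
@[ext]
structure Hom (M M' : WBimod O N) where
  /-- the components of the morphism -/
  app (k : Deg N) : M.obj k ⟶ M'.obj k
  map_lact {n : ℕ} {k p : Deg N} (h : p.1 + 1 = n + k.1) (i : ℕ) (hi : i < n) (o : O.Op n)
    (m : M.obj k) : app p (M.lact h i hi o m) = M'.lact h i hi o (app k m)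
  map_ract {n : ℕ} {k p : Deg N} (h : p.1 + 1 = k.1 + n) (i : ℕ) (hi : i < k.1) (o : O.Op n)
    (m : M.obj k) : app p (M.ract h i hi o m) = M'.ract h i hi o (app k m)

instance : Category (WBimod O N) where
  Hom := Hom
  id M := { app := fun _ => 𝟙 _, map_lact := by intros; rfl, map_ract := by intros; rfl }
  comp f g :=
    { app := fun k => f.app k ≫ g.app k
      map_lact := by intros; simp [f.map_lact, g.map_lact]
      map_ract := by intros; simp [f.map_ract, g.map_ract] }

@[ext]
theorem hom_ext {M M' : WBimod O N} {f g : M ⟶ M'} (h : ∀ k, f.app k = g.app k) : f = g :=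
  Hom.ext (funext h)

/-- The `N`-truncation of a weak bimodule. -/
def truncate (N : ℕ∞) : WBimod O ⊤ ⥤ WBimod O N where
  obj M :=
    { obj := fun k => M.obj ⟨k.1, le_top⟩
      lact := fun {_} {k} {p} h i hi o => M.lact (k := ⟨k.1, le_top⟩) (p := ⟨p.1, le_top⟩) h i hi o
      ract := fun {_} {k} {p} h i hi o => M.ract (k := ⟨k.1, le_top⟩) (p := ⟨p.1, le_top⟩) h i hi o
      one_lact := fun h h0 m => M.one_lact (k := ⟨_, le_top⟩) h h0 m
      ract_one := fun h i hi m => M.ract_one (k := ⟨_, le_top⟩) h i hi m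
      lact_lact := fun {_} {_} {_} {k} {p} {s} => M.lact_lact
        (k := ⟨k.1, le_top⟩) (p := ⟨p.1, le_top⟩) (s := ⟨s.1, le_top⟩)
      ract_ract := fun {_} {_} {_} {k} {p} {s} => M.ract_ract
        (k := ⟨k.1, le_top⟩) (p := ⟨p.1, le_top⟩) (s := ⟨s.1, le_top⟩)
      ract_comm := fun {_} {_} {k} {p} {s} {t} => M.ract_comm
        (k := ⟨k.1, le_top⟩) (p := ⟨p.1, le_top⟩) (s := ⟨s.1, le_top⟩) (t := ⟨t.1, le_top⟩)
      lact_ract := fun {_} {_} {k} {p} {s} {t} => M.lact_ract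
        (k := ⟨k.1, le_top⟩) (p := ⟨p.1, le_top⟩) (s := ⟨s.1, le_top⟩) (t := ⟨t.1, le_top⟩)
      lact_comp_left := fun {_} {_} {_} {k} {p} {s} => M.lact_comp_left
        (k := ⟨k.1, le_top⟩) (p := ⟨p.1, le_top⟩) (s := ⟨s.1, le_top⟩)
      lact_comp_right := fun {_} {_} {_} {k} {p} {s} => M.lact_comp_right
        (k := ⟨k.1, le_top⟩) (p := ⟨p.1, le_top⟩) (s := ⟨s.1, le_top⟩) }
  map f :=
    { app := fun k => f.app ⟨k.1, le_top⟩
      map_lact := fun {_} {k} {p} => f.map_lact (k := ⟨k.1, le_top⟩) (p := ⟨p.1, le_top⟩)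
      map_ract := fun {_} {k} {p} => f.map_ract (k := ⟨k.1, le_top⟩) (p := ⟨p.1, le_top⟩) }

/-- The operad `O` (truncated at `N`) as a weak bimodule over itself. -/
def regular (O : NSOperad) (N : ℕ∞) : WBimod O N where
  obj k := TopCat.discrete.obj (O.Op k.1)
  lact h i hi o := TopCat.discrete.map (TypeCat.ofHom fun m => O.comp h i hi o m)
  ract h i hi o := TopCat.discrete.map (TypeCat.ofHom fun m => O.comp h i hi m o)
  one_lact h h0 m := O.one_comp h h0 m
  ract_one h i hi m := O.comp_one h i hi m
  lact_lact h₁ h₂ h₃ h₄ i j hi hj hij o₁ o₂ m := O.assoc_seq h₁ h₂ h₃ h₄ i j hi hj hij o₁ o₂ m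
  ract_ract h₁ h₂ h₃ h₄ i j hi hj hij o₁ o₂ m := O.assoc_seq h₃ h₄ h₁ h₂ i j hi hj hij m o₁ o₂
  ract_comm h₁ h₂ h₃ h₄ i j j' hij hi hj hi' hjj' hj' o₁ o₂ m :=
    O.assoc_par h₁ h₂ h₃ h₄ i j j' hij hj hi hi' hjj' hj' m o₁ o₂
  lact_ract h₁ h₂ h₃ h₄ i j hi hj hij o₁ o₂ m := O.assoc_seq h₁ h₂ h₃ h₄ i j hi hj hij o₁ m o₂
  lact_comp_left h₁ h₂ h₃ h₄ i j i' hij hi hj hj' hii' hi' o₁ o₂ m :=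
    (O.assoc_par h₃ h₄ h₁ h₂ j i i' hij hi hj hj' hii' hi' o₁ o₂ m).symm
  lact_comp_right h₁ h₂ h₃ h₄ i j j' hij hi hj hjj' hj' hi' o₁ o₂ m :=
    O.assoc_par h₁ h₂ h₃ h₄ i j j' hij hj hi hi' hjj' hj' o₁ m o₂

/-- The empty weak bimodule.  It is the free weak bimodule generated by empty sets, since all the
operations are unary; see `isInitialEmpty`. -/
def empty (O : NSOperad) (N : ℕ∞) : WBimod O N where
  obj _ := TopCat.of PEmpty
  lact _ _ _ _ := 𝟙 _
  ract _ _ _ _ := 𝟙 _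
  one_lact _ _ m := m.elim
  ract_one _ _ _ m := m.elim
  lact_lact _ _ _ _ _ _ _ _ _ _ _ m := m.elim
  ract_ract _ _ _ _ _ _ _ _ _ _ _ m := m.elim
  ract_comm _ _ _ _ _ _ _ _ _ _ _ _ _ _ _ m := m.elim
  lact_ract _ _ _ _ _ _ _ _ _ _ _ m := m.elim
  lact_comp_left _ _ _ _ _ _ _ _ _ _ _ _ _ _ _ m := m.elim
  lact_comp_right _ _ _ _ _ _ _ _ _ _ _ _ _ _ _ m := m.elim

/-- The map from the empty weak bimodule. -/
def fromEmpty (M : WBimod O N) : empty O N ⟶ M where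
  app _ := TopCat.ofHom ⟨PEmpty.elim, continuous_of_const fun x => x.elim⟩
  map_lact _ _ _ _ m := m.elim
  map_ract _ _ _ _ m := m.elim

/-- The empty weak bimodule is initial. -/
def isInitialEmpty : Limits.IsInitial (empty O N) :=
  Limits.IsInitial.ofUniqueHom fromEmpty fun M f => by
    ext k x
    exact (x : PEmpty).elim

/-! ### Sub-bimodules -/

/-- A sub-bimodule of a weak bimodule. -/
@[ext]
structure Sub (M : WBimod O N) where
  /-- the components -/
  carrier (k : Deg N) : Set (M.obj k)
  lact_mem {n : ℕ} {k p : Deg N} (h : p.1 + 1 = n + k.1) (i : ℕ) (hi : i < n) (o : O.Op n)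
    {m : M.obj k} (hm : m ∈ carrier k) : M.lact h i hi o m ∈ carrier p
  ract_mem {n : ℕ} {k p : Deg N} (h : p.1 + 1 = k.1 + n) (i : ℕ) (hi : i < k.1) (o : O.Op n)
    {m : M.obj k} (hm : m ∈ carrier k) : M.ract h i hi o m ∈ carrier p

instance (M : WBimod O N) : LE M.Sub where
  le S T := ∀ k, S.carrier k ⊆ T.carrier k

/-- A sub-bimodule as a weak bimodule, with the subspace topologies. -/
def Sub.toWBimod {M : WBimod O N} (S : M.Sub) : WBimod O N where
  obj k := TopCat.of (S.carrier k)
  lact h i hi o := TopCat.ofHom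
    ⟨fun m => ⟨M.lact h i hi o m.1, S.lact_mem h i hi o m.2⟩, by fun_prop⟩
  ract h i hi o := TopCat.ofHom
    ⟨fun m => ⟨M.ract h i hi o m.1, S.ract_mem h i hi o m.2⟩, by fun_prop⟩
  one_lact h h0 m := Subtype.ext (M.one_lact h h0 m.1)
  ract_one h i hi m := Subtype.ext (M.ract_one h i hi m.1)
  lact_lact h₁ h₂ h₃ h₄ i j hi hj hij o₁ o₂ m :=
    Subtype.ext (M.lact_lact h₁ h₂ h₃ h₄ i j hi hj hij o₁ o₂ m.1)
  ract_ract h₁ h₂ h₃ h₄ i j hi hj hij o₁ o₂ m :=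
    Subtype.ext (M.ract_ract h₁ h₂ h₃ h₄ i j hi hj hij o₁ o₂ m.1)
  ract_comm h₁ h₂ h₃ h₄ i j j' hij hi hj hi' hjj' hj' o₁ o₂ m :=
    Subtype.ext (M.ract_comm h₁ h₂ h₃ h₄ i j j' hij hi hj hi' hjj' hj' o₁ o₂ m.1)
  lact_ract h₁ h₂ h₃ h₄ i j hi hj hij o₁ o₂ m :=
    Subtype.ext (M.lact_ract h₁ h₂ h₃ h₄ i j hi hj hij o₁ o₂ m.1)
  lact_comp_left h₁ h₂ h₃ h₄ i j i' hij hi hj hj' hii' hi' o₁ o₂ m :=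
    Subtype.ext (M.lact_comp_left h₁ h₂ h₃ h₄ i j i' hij hi hj hj' hii' hi' o₁ o₂ m.1)
  lact_comp_right h₁ h₂ h₃ h₄ i j j' hij hi hj hjj' hj' hi' o₁ o₂ m :=
    Subtype.ext (M.lact_comp_right h₁ h₂ h₃ h₄ i j j' hij hi hj hjj' hj' hi' o₁ o₂ m.1)

/-- The inclusion of a smaller sub-bimodule into a larger one. -/
def Sub.incl {M : WBimod O N} {S T : M.Sub} (h : S ≤ T) : S.toWBimod ⟶ T.toWBimod where
  app k := TopCat.ofHom ⟨fun m => ⟨m.1, h k m.2⟩, by fun_prop⟩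
  map_lact _ _ _ _ _ := rfl
  map_ract _ _ _ _ _ := rfl

/-! ### Free weak bimodules and attachments of cells -/

/-- Formal composites of the operations of an `N`-truncated weak bimodule, from degree `q`. -/
inductive Word (O : NSOperad) (N : ℕ∞) (q : Deg N) : Deg N → Type
  | nil : Word O N q q
  | left {n : ℕ} {k p : Deg N} (h : p.1 + 1 = n + k.1) (i : ℕ) (hi : i < n) (o : O.Op n)
      (w : Word O N q k) : Word O N q p
  | right {n : ℕ} {k p : Deg N} (h : p.1 + 1 = k.1 + n) (i : ℕ) (hi : i < k.1) (o : O.Op n)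
      (w : Word O N q k) : Word O N q p

open Word in
/-- The identifications of formal composites that the axioms of a weak bimodule impose. -/
inductive WordRel (O : NSOperad) (N : ℕ∞) (q : Deg N) :
    (k : Deg N) → Word O N q k → Word O N q k → Prop
  | congr_left {n : ℕ} {k p : Deg N} (h : p.1 + 1 = n + k.1) (i : ℕ) (hi : i < n) (o : O.Op n)
      (w w' : Word O N q k) : WordRel O N q k w w' →
      WordRel O N q p (left h i hi o w) (left h i hi o w')
  | congr_right {n : ℕ} {k p : Deg N} (h : p.1 + 1 = k.1 + n) (i : ℕ) (hi : i < k.1) (o : O.Op n)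
      (w w' : Word O N q k) : WordRel O N q k w w' →
      WordRel O N q p (right h i hi o w) (right h i hi o w')
  | one_lact {k : Deg N} (h : k.1 + 1 = 1 + k.1) (h0 : 0 < 1) (m : Word O N q k) :
      WordRel O N q k (left h 0 h0 O.one m) m
  | ract_one {k : Deg N} (h : k.1 + 1 = k.1 + 1) (i : ℕ) (hi : i < k.1) (m : Word O N q k) :
      WordRel O N q k (right h i hi O.one m) m
  | lact_lact {n n' r : ℕ} {k p s : Deg N} (h₁ : r + 1 = n + n') (h₂ : p.1 + 1 = r + k.1)
      (h₃ : s.1 + 1 = n' + k.1) (h₄ : p.1 + 1 = n + s.1) (i j : ℕ) (hi : i < n) (hj : j < n')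
      (hij : i + j < r) (o₁ : O.Op n) (o₂ : O.Op n') (m : Word O N q k) :
      WordRel O N q p (left h₂ (i + j) hij (O.comp h₁ i hi o₁ o₂) m)
        (left h₄ i hi o₁ (left h₃ j hj o₂ m))
  | ract_ract {n n' r : ℕ} {k p s : Deg N} (h₁ : r + 1 = n + n') (h₂ : p.1 + 1 = k.1 + r)
      (h₃ : s.1 + 1 = k.1 + n) (h₄ : p.1 + 1 = s.1 + n') (i j : ℕ) (hi : i < k.1) (hj : j < n)
      (hij : i + j < s.1) (o₁ : O.Op n) (o₂ : O.Op n') (m : Word O N q k) :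
      WordRel O N q p (right h₄ (i + j) hij o₂ (right h₃ i hi o₁ m))
        (right h₂ i hi (O.comp h₁ j hj o₁ o₂) m)
  | ract_comm {n n' : ℕ} {k p s t : Deg N} (h₁ : s.1 + 1 = k.1 + n) (h₂ : p.1 + 1 = s.1 + n')
      (h₃ : t.1 + 1 = k.1 + n') (h₄ : p.1 + 1 = t.1 + n) (i j j' : ℕ) (hij : i < j)
      (hi : i < k.1) (hj : j < k.1) (hi' : i < t.1) (hjj' : j' + 1 = j + n) (hj' : j' < s.1)
      (o₁ : O.Op n) (o₂ : O.Op n') (m : Word O N q k) :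
      WordRel O N q p (right h₂ j' hj' o₂ (right h₁ i hi o₁ m))
        (right h₄ i hi' o₁ (right h₃ j hj o₂ m))
  | lact_ract {n n' : ℕ} {k p s t : Deg N} (h₁ : s.1 + 1 = n + k.1) (h₂ : p.1 + 1 = s.1 + n')
      (h₃ : t.1 + 1 = k.1 + n') (h₄ : p.1 + 1 = n + t.1) (i j : ℕ) (hi : i < n) (hj : j < k.1)
      (hij : i + j < s.1) (o₁ : O.Op n) (o₂ : O.Op n') (m : Word O N q k) :
      WordRel O N q p (right h₂ (i + j) hij o₂ (left h₁ i hi o₁ m))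
        (left h₄ i hi o₁ (right h₃ j hj o₂ m))
  | lact_comp_left {n n' r : ℕ} {k p s : Deg N} (h₁ : s.1 + 1 = n + k.1)
      (h₂ : p.1 + 1 = s.1 + n') (h₃ : r + 1 = n + n') (h₄ : p.1 + 1 = r + k.1) (i j i' : ℕ)
      (hij : j < i) (hi : i < n) (hj : j < n) (hj' : j < s.1) (hii' : i' + 1 = i + n')
      (hi' : i' < r) (o₁ : O.Op n) (o₂ : O.Op n') (m : Word O N q k) :
      WordRel O N q p (right h₂ j hj' o₂ (left h₁ i hi o₁ m))
        (left h₄ i' hi' (O.comp h₃ j hj o₁ o₂) m)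
  | lact_comp_right {n n' r : ℕ} {k p s : Deg N} (h₁ : s.1 + 1 = n + k.1)
      (h₂ : p.1 + 1 = s.1 + n') (h₃ : r + 1 = n + n') (h₄ : p.1 + 1 = r + k.1) (i j j' : ℕ)
      (hij : i < j) (hi : i < n) (hj : j < n) (hjj' : j' + 1 = j + k.1) (hj' : j' < s.1)
      (hi' : i < r) (o₁ : O.Op n) (o₂ : O.Op n') (m : Word O N q k) :
      WordRel O N q p (right h₂ j' hj' o₂ (left h₁ i hi o₁ m))
        (left h₄ i hi' (O.comp h₃ j hj o₁ o₂) m)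

/-- The set of operations from degree `q` to degree `k` of an `N`-truncated weak bimodule. -/
def Words (O : NSOperad) (N : ℕ∞) (q k : Deg N) : Type := Quot (WordRel O N q k)

instance (q k : Deg N) : TopologicalSpace (Words O N q k) := ⊥

instance (q k : Deg N) : DiscreteTopology (Words O N q k) := ⟨rfl⟩

/-- Composition of an operation with a weak left action. -/
def Words.left {q k p : Deg N} {n : ℕ} (h : p.1 + 1 = n + k.1) (i : ℕ) (hi : i < n) (o : O.Op n) :
    Words O N q k → Words O N q p :=
  Quot.map (Word.left h i hi o) fun _ _ r => .congr_left h i hi o _ _ r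

/-- Composition of an operation with a weak right action. -/
def Words.right {q k p : Deg N} {n : ℕ} (h : p.1 + 1 = k.1 + n) (i : ℕ) (hi : i < k.1)
    (o : O.Op n) : Words O N q k → Words O N q p :=
  Quot.map (Word.right h i hi o) fun _ _ r => .congr_right h i hi o _ _ r

/-- The free weak bimodule generated by the space `T` placed in degree `q` (and by empty spaces in
the other degrees). -/
def freeObj (O : NSOperad) (N : ℕ∞) (q : Deg N) (T : TopCat.{0}) : WBimod O N where
  obj k := TopCat.of (Words O N q k × T)
  lact h i hi o := TopCat.ofHom
    ⟨Prod.map (Words.left h i hi o) id, continuous_of_discreteTopology.prodMap continuous_id⟩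
  ract h i hi o := TopCat.ofHom
    ⟨Prod.map (Words.right h i hi o) id, continuous_of_discreteTopology.prodMap continuous_id⟩
  one_lact := by
    rintro k h h0 ⟨⟨w⟩, x⟩
    exact Prod.ext (Quot.sound (.one_lact ..)) rfl
  ract_one := by
    rintro k h i hi ⟨⟨w⟩, x⟩
    exact Prod.ext (Quot.sound (.ract_one ..)) rfl
  lact_lact := by
    rintro n n' r k p s h₁ h₂ h₃ h₄ i j hi hj hij o₁ o₂ ⟨⟨w⟩, x⟩
    exact Prod.ext (Quot.sound (.lact_lact h₁ h₂ h₃ h₄ i j hi hj hij o₁ o₂ w)) rfl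
  ract_ract := by
    rintro n n' r k p s h₁ h₂ h₃ h₄ i j hi hj hij o₁ o₂ ⟨⟨w⟩, x⟩
    exact Prod.ext (Quot.sound (.ract_ract h₁ h₂ h₃ h₄ i j hi hj hij o₁ o₂ w)) rfl
  ract_comm := by
    rintro n n' k p s t h₁ h₂ h₃ h₄ i j j' hij hi hj hi' hjj' hj' o₁ o₂ ⟨⟨w⟩, x⟩
    exact Prod.ext
      (Quot.sound (.ract_comm h₁ h₂ h₃ h₄ i j j' hij hi hj hi' hjj' hj' o₁ o₂ w)) rfl
  lact_ract := by
    rintro n n' k p s t h₁ h₂ h₃ h₄ i j hi hj hij o₁ o₂ ⟨⟨w⟩, x⟩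
    exact Prod.ext (Quot.sound (.lact_ract h₁ h₂ h₃ h₄ i j hi hj hij o₁ o₂ w)) rfl
  lact_comp_left := by
    rintro n n' r k p s h₁ h₂ h₃ h₄ i j i' hij hi hj hj' hii' hi' o₁ o₂ ⟨⟨w⟩, x⟩
    exact Prod.ext
      (Quot.sound (.lact_comp_left h₁ h₂ h₃ h₄ i j i' hij hi hj hj' hii' hi' o₁ o₂ w)) rfl
  lact_comp_right := by
    rintro n n' r k p s h₁ h₂ h₃ h₄ i j j' hij hi hj hjj' hj' hi' o₁ o₂ ⟨⟨w⟩, x⟩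
    exact Prod.ext
      (Quot.sound (.lact_comp_right h₁ h₂ h₃ h₄ i j j' hij hi hj hjj' hj' hi' o₁ o₂ w)) rfl

/-- The free weak bimodule on a space in degree `q`, as a functor of the space. -/
def free (O : NSOperad) (N : ℕ∞) (q : Deg N) : TopCat.{0} ⥤ WBimod O N where
  obj T := freeObj O N q T
  map f :=
    { app := fun k => TopCat.ofHom ⟨Prod.map id f, by fun_prop⟩
      map_lact := fun _ _ _ _ _ => rfl
      map_ract := fun _ _ _ _ _ => rfl }

/-- The component in degree `q`, as a functor. -/
def eval (O : NSOperad) (N : ℕ∞) (q : Deg N) : WBimod O N ⥤ TopCat.{0} where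
  obj M := M.obj q
  map f := f.app q

/-- The operation of a weak bimodule given by a formal composite. -/
def Word.act {q : Deg N} (M : WBimod O N) : {k : Deg N} → Word O N q k → (M.obj q ⟶ M.obj k)
  | _, .nil => 𝟙 _
  | _, .left h i hi o w => Word.act M w ≫ M.lact h i hi o
  | _, .right h i hi o w => Word.act M w ≫ M.ract h i hi o

theorem Word.act_eq {q : Deg N} (M : WBimod O N) {k : Deg N} {w w' : Word O N q k}
    (r : WordRel O N q k w w') : Word.act M w = Word.act M w' := by
  induction r with
  | congr_left h i hi o w w' _ ih => simp [Word.act, ih]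
  | congr_right h i hi o w w' _ ih => simp [Word.act, ih]
  | one_lact => ext x; exact M.one_lact ..
  | ract_one => ext x; exact M.ract_one ..
  | lact_lact => ext x; exact M.lact_lact ..
  | ract_ract => ext x; exact M.ract_ract ..
  | ract_comm h₁ h₂ h₃ h₄ i j j' hij hi hj hi' hjj' hj' =>
      ext x; exact M.ract_comm h₁ h₂ h₃ h₄ i j j' hij hi hj hi' hjj' hj' ..
  | lact_ract => ext x; exact M.lact_ract ..
  | lact_comp_left h₁ h₂ h₃ h₄ i j i' hij hi hj hj' hii' hi' =>
      ext x; exact M.lact_comp_left h₁ h₂ h₃ h₄ i j i' hij hi hj hj' hii' hi' ..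
  | lact_comp_right h₁ h₂ h₃ h₄ i j j' hij hi hj hjj' hj' hi' =>
      ext x; exact M.lact_comp_right h₁ h₂ h₃ h₄ i j j' hij hi hj hjj' hj' hi' ..

/-- The operation of a weak bimodule given by an element of `Words`. -/
def Words.act {q k : Deg N} (M : WBimod O N) : Words O N q k → (M.obj q ⟶ M.obj k) :=
  Quot.lift (Word.act M) fun _ _ r => Word.act_eq M r

theorem Word.map_act {q k : Deg N} {M M' : WBimod O N} (f : M ⟶ M') (w : Word O N q k)
    (x : M.obj q) : f.app k (Word.act M w x) = Word.act M' w (f.app q x) := by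
  induction w with
  | nil => rfl
  | left h i hi o w ih => simp [Word.act, ← ih, f.map_lact]
  | right h i hi o w ih => simp [Word.act, ← ih, f.map_ract]

theorem Word.act_free {q k : Deg N} (T : TopCat.{0}) (w : Word O N q k) (x : T) :
    Word.act (freeObj O N q T) w (Quot.mk _ .nil, x) = (Quot.mk _ w, x) := by
  induction w with
  | nil => rfl
  | left h i hi o w ih => exact congrArg ((freeObj O N q T).lact h i hi o) ih
  | right h i hi o w ih => exact congrArg ((freeObj O N q T).ract h i hi o) ih

/-- `free O N q` is left adjoint to the functor taking the component in degree `q`. -/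
def freeAdj (O : NSOperad) (N : ℕ∞) (q : Deg N) : free O N q ⊣ eval O N q :=
  Adjunction.mkOfHomEquiv
    { homEquiv := fun T M =>
        { toFun := fun f => TopCat.ofHom
            ⟨fun x => f.app q (Quot.mk _ .nil, x),
              (f.app q).hom.continuous.comp (Continuous.prodMk continuous_const continuous_id)⟩
          invFun := fun g =>
            { app := fun k => TopCat.ofHom
                ⟨fun x => Words.act M x.1 (g x.2), by
                  refine continuous_prod_of_discrete_left.2 fun w => ?_
                  exact (Words.act M w).hom.continuous.comp g.hom.continuous⟩
              map_lact := by rintro n k p h i hi o ⟨⟨w⟩, x⟩; rfl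
              map_ract := by rintro n k p h i hi o ⟨⟨w⟩, x⟩; rfl }
          left_inv := by
            intro f
            ext k x
            obtain ⟨⟨w⟩, x⟩ := x
            exact (Word.map_act f w _).symm.trans (congrArg (f.app k) (Word.act_free T w x))
          right_inv := by
            intro g
            ext x
            rfl }
      homEquiv_naturality_left_symm := by
        intros
        ext k x
        rfl
      homEquiv_naturality_right := by
        intros
        ext x
        rfl }

/-- The basic cells: the maps of free weak bimodules `X(∂D) ⟶ X(D)` induced by the inclusion
of the boundary of a disc `D` of dimension `c.2` placed in degree `c.1`. -/
noncomputable def basicCell (O : NSOperad) (N : ℕ∞) (c : Deg N × ℕ) :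
    (free O N c.1).obj (TopCat.diskBoundary c.2) ⟶ (free O N c.1).obj (TopCat.disk c.2) :=
  (free O N c.1).map (TopCat.diskBoundaryInclusion c.2)

/-- The map `f : A ⟶ B` exhibits `B` as obtained from `A` by a free attachment of `r` cells of
dimension `d` in degree `q`, i.e. as a pushout of `A` along a coproduct of `r` copies of the
corresponding basic cell. -/
def IsAttachment {A B : WBimod O N} (f : A ⟶ B) (q : Deg N) (d r : ℕ) : Prop :=
  ∃ a : AttachCells.{0} (fun _ : Unit => basicCell O N (q, d)) f,
    Finite a.ι ∧ Nat.card a.ι = r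

/-- A weak bimodule is (cellular) cofibrant if it is obtained from the free weak bimodule on
empty sets by a transfinite sequence of attachments of cells. -/
def IsCofibrant (M : WBimod O N) : Prop :=
  ∃ (J : Type) (_ : LinearOrder J) (_ : OrderBot J) (_ : SuccOrder J) (_ : WellFoundedLT J),
    Nonempty (RelativeCellComplex.{0} (fun _ : J => basicCell O N) (fromEmpty M))

end WBimod

/-! ### Weak equivalences -/

/-- The map induced on path components. -/
def zerothHomotopyMap {X Y : Type} [TopologicalSpace X] [TopologicalSpace Y] (f : C(X, Y)) :
    ZerothHomotopy X → ZerothHomotopy Y :=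
  Quotient.map f fun _ _ h => h.map f.continuous

/-- The map induced on homotopy groups. -/
def homotopyGroupMap {X Y : Type} [TopologicalSpace X] [TopologicalSpace Y] (f : C(X, Y))
    (n : ℕ) (x : X) : HomotopyGroup (Fin n) X x → HomotopyGroup (Fin n) Y (f x) :=
  Quotient.map (fun g => ⟨f.comp g.1, fun y hy => congrArg f (g.2 y hy)⟩)
    fun _ _ h => h.map fun H => H.compContinuousMap f

/-- A weak homotopy equivalence: a continuous map that is bijective on path components and on
all homotopy groups at all base points. -/
def IsWeakEquiv {X Y : Type} [TopologicalSpace X] [TopologicalSpace Y] (f : C(X, Y)) : Prop :=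
  Function.Bijective (zerothHomotopyMap f) ∧
    ∀ (n : ℕ) (x : X), Function.Bijective (homotopyGroupMap f (n + 1) x)

/-- `M` is a cofibrant model of `A`: it is cofibrant and has a map to `A` which is a weak
equivalence in every degree. -/
def WBimod.IsCofibrantModel {O : NSOperad} {N : ℕ∞} (M A : WBimod O N) : Prop :=
  M.IsCofibrant ∧ ∃ f : M ⟶ A, ∀ k, IsWeakEquiv (f.app k).hom

/-! ### Hairy configurations -/

/-- A hairy configuration with `n` labelled points: points `pt 0 ≤ pt 1 ≤ …` of `[0,1]`, and
finitely many hairs of length in `(0,1]` growing from points of `(0,1)` that are not labelled.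
`hair x` is the length of the hair at `x`, and `hair x = 0` means that no hair grows at `x`. -/
@[ext]
structure HairyConf (n : ℕ) where
  /-- the labelled points -/
  pt : Fin n → unitInterval
  monotone_pt : Monotone pt
  /-- the lengths of the hairs -/
  hair : unitInterval → unitInterval
  finite_hair : {x | hair x ≠ 0}.Finite
  hair_zero : hair 0 = 0
  hair_one : hair 1 = 0
  hair_pt (j : Fin n) : hair (pt j) = 0

/-- The end points of the interval together with the given points. -/
def withEnds {n : ℕ} (t : Fin n → unitInterval) : Set unitInterval := {0, 1} ∪ Set.range t

namespace HairyConf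

open Classical in
/-- The hairy configuration with labelled points `t` and with hairs of lengths `(hs j).2` growing
at `(hs j).1`, where hairs of length `0`, hairs at a labelled point or at an end point of the
interval disappear, and of several hairs at one point only the longest survives. -/
noncomputable def place {n m : ℕ} (t : {t : Fin n → unitInterval // Monotone t})
    (hs : Fin m → unitInterval × unitInterval) : HairyConf n where
  pt := t.1
  monotone_pt := t.2
  hair x := if x ∈ withEnds t.1 then 0 else
    Finset.univ.sup fun j => if (hs j).1 = x then (hs j).2 else ⊥
  finite_hair := by
    refine (Set.finite_range fun j => (hs j).1).subset fun x hx => ?_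
    by_contra hx'
    refine hx ?_
    have : ∀ j, (hs j).1 ≠ x := fun j hj => hx' ⟨j, hj⟩
    simp only [this, if_false, Finset.sup_bot]
    exact ite_self _
  hair_zero := by simp [withEnds]
  hair_one := by simp [withEnds]
  hair_pt j := by simp [withEnds]

/-- The space of hairy configurations is the quotient of the space of labelled points together
with finite families of hairs at arbitrary positions and of arbitrary lengths in `[0,1]`. -/
noncomputable instance (n : ℕ) : TopologicalSpace (HairyConf n) :=
  TopologicalSpace.coinduced
    (fun c : Σ m : ℕ, {t : Fin n → unitInterval // Monotone t} ×
      (Fin m → unitInterval × unitInterval) => place c.2.1 c.2.2) inferInstance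

open Classical in
/-- Change the labelled points into `t`.  A formerly labelled point which is not labelled any more
becomes a hair of length `1`, unless it is an end point of the interval. -/
noncomputable def relabel {k p : ℕ} (c : HairyConf k)
    (t : {t : Fin p → unitInterval // Monotone t}) : HairyConf p where
  pt := t.1
  monotone_pt := t.2
  hair x := if x ∈ withEnds t.1 then 0 else if x ∈ Set.range c.pt then 1 else c.hair x
  finite_hair := by
    refine ((Set.finite_range c.pt).union c.finite_hair).subset fun x hx => ?_
    by_contra hx'
    simp only [Set.mem_union, not_or] at hx'
    have h2 : c.hair x = 0 := by simpa using hx'.2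
    exact hx (by simp only [hx'.1, h2, if_false, ite_self])
  hair_zero := by simp [withEnds]
  hair_one := by simp [withEnds]
  hair_pt j := by simp [withEnds]

/-- The labelled points of `a_n ∘_{i+1} c`: `i` points are added at `0`, the others at `1`. -/
def addEnds {k p : ℕ} (i : ℕ) (t : {t : Fin k → unitInterval // Monotone t}) :
    {t : Fin p → unitInterval // Monotone t} :=
  ⟨fun j => if j.1 < i then 0 else if h : j.1 - i < k then t.1 ⟨j.1 - i, h⟩ else 1, by
    intro a b hab
    have hab' : a.1 ≤ b.1 := hab
    dsimp only
    split_ifs with h1 h2 h3 h4 h5 h6 h7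
    all_goals first
      | exact le_rfl
      | exact unitInterval.nonneg'
      | exact unitInterval.le_one'
      | exact t.2 (Fin.mk_le_mk.2 (by omega))
      | omega⟩

/-- The labelled points of `c ∘_{i+1} a_n`: the point number `i` is repeated `n` times. -/
def multiply {n k p : ℕ} (h : p + 1 = k + n) (i : ℕ) (hi : i < k)
    (t : {t : Fin k → unitInterval // Monotone t}) :
    {t : Fin p → unitInterval // Monotone t} :=
  ⟨fun j => t.1 ⟨if j.1 < i then j.1 else if j.1 < i + n then i else j.1 + 1 - n, by
      have := j.2
      split_ifs <;> omega⟩, by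
    intro a b hab
    have hab' : a.1 ≤ b.1 := hab
    refine t.2 (Fin.mk_le_mk.2 ?_)
    split_ifs <;> omega⟩

/-- The labelled points, together with the fact that they are in increasing order. -/
def pts {k : ℕ} (c : HairyConf k) : {t : Fin k → unitInterval // Monotone t} :=
  ⟨c.pt, c.monotone_pt⟩

/-- The geometrically distinct points (labelled points and feet of hairs) strictly inside
the interval. -/
def innerPoints {k : ℕ} (c : HairyConf k) : Set unitInterval :=
  (Set.range c.pt ∪ {x | c.hair x ≠ 0}) \ {0, 1}

/-- The feet of the hairs of length less than `1`. -/
def shortHairs {k : ℕ} (c : HairyConf k) : Set unitInterval :=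
  {x | c.hair x ≠ 0 ∧ c.hair x ≠ 1}

theorem finite_innerPoints {k : ℕ} (c : HairyConf k) : c.innerPoints.Finite :=
  ((Set.finite_range c.pt).union c.finite_hair).subset Set.sdiff_subset

theorem finite_shortHairs {k : ℕ} (c : HairyConf k) : c.shortHairs.Finite :=
  c.finite_hair.subset fun _ h => h.1

theorem withEnds_addEnds {k p : ℕ} (i : ℕ) (t : {t : Fin k → unitInterval // Monotone t}) :
    withEnds (addEnds (p := p) i t).1 ⊆ withEnds t.1 := by
  rintro x (hx | ⟨j, rfl⟩)
  · exact Or.inl hx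
  · simp only [addEnds]
    split_ifs
    · exact Or.inl (Or.inl rfl)
    · exact Or.inr ⟨_, rfl⟩
    · exact Or.inl (Or.inr rfl)

theorem withEnds_multiply {n k p : ℕ} (h : p + 1 = k + n) (i : ℕ) (hi : i < k)
    (t : {t : Fin k → unitInterval // Monotone t}) :
    withEnds (multiply h i hi t).1 ⊆ withEnds t.1 := by
  rintro x (hx | ⟨j, rfl⟩)
  · exact Or.inl hx
  · exact Or.inr ⟨_, rfl⟩

theorem relabel_hair_of_mem_withEnds {k p : ℕ} (c : HairyConf k)
    (t : {t : Fin p → unitInterval // Monotone t}) {x : unitInterval} (h : x ∈ withEnds t.1) :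
    (c.relabel t).hair x = 0 := if_pos h

theorem relabel_hair_of_mem_range {k p : ℕ} (c : HairyConf k)
    (t : {t : Fin p → unitInterval // Monotone t}) {x : unitInterval} (h : x ∉ withEnds t.1)
    (h' : x ∈ Set.range c.pt) : (c.relabel t).hair x = 1 := (if_neg h).trans (if_pos h')

theorem relabel_hair_of_notMem {k p : ℕ} (c : HairyConf k)
    (t : {t : Fin p → unitInterval // Monotone t}) {x : unitInterval} (h : x ∉ withEnds t.1)
    (h' : x ∉ Set.range c.pt) : (c.relabel t).hair x = c.hair x := (if_neg h).trans (if_neg h')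

theorem relabel_relabel {k p r : ℕ} (c : HairyConf k)
    (t : {t : Fin p → unitInterval // Monotone t}) (u : {t : Fin r → unitInterval // Monotone t})
    (ht : withEnds t.1 ⊆ withEnds c.pt) :
    (c.relabel t).relabel u = c.relabel u := by
  refine HairyConf.ext rfl (funext fun x => ?_)
  by_cases h1 : x ∈ withEnds u.1
  · rw [relabel_hair_of_mem_withEnds _ _ h1, relabel_hair_of_mem_withEnds _ _ h1]
  have h2 : x ∉ ({0, 1} : Set unitInterval) := fun h => h1 (Or.inl h)
  by_cases h3 : x ∈ Set.range t.1
  · have h4 : x ∈ Set.range c.pt := (ht (Or.inr h3)).resolve_left h2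
    rw [relabel_hair_of_mem_range _ _ h1 h3, relabel_hair_of_mem_range _ _ h1 h4]
  · have h5 : x ∉ withEnds t.1 := fun h => h.elim h2 h3
    rw [relabel_hair_of_notMem _ _ h1 h3]
    by_cases h4 : x ∈ Set.range c.pt
    · rw [relabel_hair_of_mem_range _ _ h5 h4, relabel_hair_of_mem_range _ _ h1 h4]
    · rw [relabel_hair_of_notMem _ _ h5 h4, relabel_hair_of_notMem _ _ h1 h4]

theorem relabel_self {k : ℕ} (c : HairyConf k) (t : {t : Fin k → unitInterval // Monotone t})
    (ht : t.1 = c.pt) : c.relabel t = c := by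
  refine HairyConf.ext ht (funext fun x => ?_)
  by_cases h1 : x ∈ withEnds t.1
  · rw [relabel_hair_of_mem_withEnds _ _ h1]
    rw [ht] at h1
    rcases h1 with (rfl | rfl) | ⟨j, rfl⟩
    · exact c.hair_zero.symm
    · exact c.hair_one.symm
    · exact (c.hair_pt j).symm
  · exact relabel_hair_of_notMem _ _ h1 fun h => h1 (Or.inr (ht ▸ h))

theorem innerPoints_relabel {k p : ℕ} (c : HairyConf k)
    (t : {t : Fin p → unitInterval // Monotone t}) (ht : withEnds t.1 ⊆ withEnds c.pt) :
    (c.relabel t).innerPoints ⊆ c.innerPoints := by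
  rintro x ⟨hx | hx, hx'⟩
  · exact ⟨Or.inl ((ht (Or.inr hx)).resolve_left hx'), hx'⟩
  · refine ⟨?_, hx'⟩
    by_contra h
    simp only [Set.mem_union, Set.mem_ofPred_eq, not_or, not_not] at h
    refine hx ?_
    by_cases h1 : x ∈ withEnds t.1
    · exact relabel_hair_of_mem_withEnds _ _ h1
    · exact (relabel_hair_of_notMem _ _ h1 h.1).trans h.2

theorem shortHairs_relabel {k p : ℕ} (c : HairyConf k)
    (t : {t : Fin p → unitInterval // Monotone t}) :
    (c.relabel t).shortHairs ⊆ c.shortHairs := by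
  rintro x ⟨hx, hx'⟩
  by_cases h1 : x ∈ withEnds t.1
  · exact absurd (relabel_hair_of_mem_withEnds _ _ h1) hx
  by_cases h2 : x ∈ Set.range c.pt
  · exact absurd (relabel_hair_of_mem_range _ _ h1 h2) hx'
  · rw [relabel_hair_of_notMem _ _ h1 h2] at hx hx'
    exact ⟨hx, hx'⟩

theorem relabel_place {k m p : ℕ} (t : {t : Fin k → unitInterval // Monotone t})
    (hs : Fin m → unitInterval × unitInterval) (u : {t : Fin p → unitInterval // Monotone t}) :
    (place t hs).relabel u = place u (Fin.append hs fun i => (t.1 i, 1)) := by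
  classical
  refine HairyConf.ext rfl (funext fun x => ?_)
  by_cases h1 : x ∈ withEnds u.1
  · rw [relabel_hair_of_mem_withEnds _ _ h1]
    exact (if_pos h1).symm
  refine Eq.trans ?_ (if_neg h1).symm
  have key : (Finset.univ.sup fun j : Fin (m + k) =>
      if (Fin.append hs (fun i => (t.1 i, (1 : unitInterval))) j).1 = x then
        (Fin.append hs (fun i => (t.1 i, (1 : unitInterval))) j).2 else ⊥) =
      (Finset.univ.sup fun j => if (hs j).1 = x then (hs j).2 else ⊥) ⊔
      (Finset.univ.sup fun j => if t.1 j = x then (1 : unitInterval) else ⊥) := by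
    apply le_antisymm
    · refine Finset.sup_le fun j _ => ?_
      refine Fin.addCases (fun j => ?_) (fun j => ?_) j
      · rw [Fin.append_left]
        exact le_sup_of_le_left
          (Finset.le_sup (f := fun j => if (hs j).1 = x then (hs j).2 else ⊥) (Finset.mem_univ j))
      · rw [Fin.append_right]
        exact le_sup_of_le_right
          (Finset.le_sup (f := fun j => if t.1 j = x then (1 : unitInterval) else ⊥)
            (Finset.mem_univ j))
    · refine sup_le (Finset.sup_le fun j _ => ?_) (Finset.sup_le fun j _ => ?_)
      · refine le_trans ?_ (Finset.le_sup (Finset.mem_univ (Fin.castAdd k j)))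
        rw [Fin.append_left]
      · refine le_trans ?_ (Finset.le_sup (Finset.mem_univ (Fin.natAdd m j)))
        rw [Fin.append_right]
  rw [key]
  have h2 : x ∉ ({0, 1} : Set unitInterval) := fun h => h1 (Or.inl h)
  by_cases h3 : x ∈ Set.range t.1
  · obtain ⟨j, hj⟩ := h3
    have h5 : (1 : unitInterval) ≤
        Finset.univ.sup fun j => if t.1 j = x then (1 : unitInterval) else ⊥ := by
      refine le_trans ?_ (Finset.le_sup (Finset.mem_univ j))
      simp [hj]
    have h4 : x ∈ Set.range t.1 := ⟨j, hj⟩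
    rw [relabel_hair_of_mem_range _ _ h1 h4]
    exact le_antisymm (le_sup_of_le_right h5) unitInterval.le_one'
  · have h4 : x ∉ withEnds t.1 := fun h => h.elim h2 h3
    have h5 : ∀ j, t.1 j ≠ x := fun j hj => h3 ⟨j, hj⟩
    rw [relabel_hair_of_notMem _ _ h1 h3]
    refine (if_neg h4).trans ?_
    simp only [h5, if_false, Finset.sup_bot, sup_bot_eq]

theorem continuous_relabel {k p : ℕ} (F : {t : Fin k → unitInterval // Monotone t} →
    {t : Fin p → unitInterval // Monotone t}) (hF : Continuous F) :
    Continuous fun c : HairyConf k => c.relabel (F c.pts) := by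
  refine continuous_coinduced_dom.2 (continuous_sigma fun m => ?_)
  have h : ∀ a : {t : Fin k → unitInterval // Monotone t} × (Fin m → unitInterval × unitInterval),
      (place a.1 a.2).relabel (F (place a.1 a.2).pts) =
        place (F a.1) (Fin.append a.2 fun i => (a.1.1 i, 1)) := fun a => relabel_place a.1 a.2 _
  have hG : Continuous fun a : {t : Fin k → unitInterval // Monotone t} ×
      (Fin m → unitInterval × unitInterval) =>
      (⟨m + k, F a.1, Fin.append a.2 fun i => (a.1.1 i, 1)⟩ :
        Σ m : ℕ, {t : Fin p → unitInterval // Monotone t} ×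
          (Fin m → unitInterval × unitInterval)) := by
    refine continuous_sigmaMk.comp (Continuous.prodMk (hF.comp continuous_fst) ?_)
    refine continuous_pi fun j => ?_
    refine Fin.addCases (fun j => ?_) (fun j => ?_) j
    · simp only [Fin.append_left]
      exact (continuous_apply j).comp continuous_snd
    · simp only [Fin.append_right]
      exact Continuous.prodMk
        ((continuous_apply j).comp (continuous_subtype_val.comp continuous_fst)) continuous_const
  refine Continuous.congr (continuous_coinduced_rng.comp hG) fun a => (h a).symm

theorem continuous_addEnds {k p : ℕ} (i : ℕ) :
    Continuous fun t : {t : Fin k → unitInterval // Monotone t} => addEnds (p := p) i t := by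
  refine Continuous.subtype_mk (continuous_pi fun j => ?_) _
  split_ifs
  · exact continuous_const
  · exact (continuous_apply _).comp continuous_subtype_val
  · exact continuous_const

theorem continuous_multiply {n k p : ℕ} (h : p + 1 = k + n) (i : ℕ) (hi : i < k) :
    Continuous fun t : {t : Fin k → unitInterval // Monotone t} => multiply h i hi t := by
  refine Continuous.subtype_mk (continuous_pi fun j => ?_) _
  exact (continuous_apply _).comp continuous_subtype_val

section

variable {k p s q r n n' : ℕ} (t : {t : Fin k → unitInterval // Monotone t})

theorem addEnds_addEnds (h₃ : s + 1 = n' + k) (i j : ℕ) (hj : j < n') :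
    addEnds (p := p) (i + j) t = addEnds i (addEnds (p := s) j t) := by
  refine Subtype.ext (funext fun x => ?_)
  have := x.2
  simp only [addEnds]
  split_ifs
  all_goals first
    | rfl
    | omega
    | (refine congrArg t.1 (Fin.ext ?_); lia)

theorem multiply_multiply (h₁ : r + 1 = n + n') (h₂ : p + 1 = k + r) (h₃ : s + 1 = k + n)
    (h₄ : p + 1 = s + n') (i j : ℕ) (hi : i < k) (hj : j < n) (hij : i + j < s) :
    multiply h₄ (i + j) hij (multiply h₃ i hi t) = multiply h₂ i hi t := by
  refine Subtype.ext (funext fun x => congrArg t.1 (Fin.ext ?_))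
  have := x.2
  dsimp only
  split_ifs <;> omega

theorem multiply_comm (h₁ : s + 1 = k + n) (h₂ : p + 1 = s + n') (h₃ : q + 1 = k + n')
    (h₄ : p + 1 = q + n) (i j j' : ℕ) (hij : i < j) (hi : i < k) (hj : j < k) (hi' : i < q)
    (hjj' : j' + 1 = j + n) (hj' : j' < s) :
    multiply h₂ j' hj' (multiply h₁ i hi t) = multiply h₄ i hi' (multiply h₃ j hj t) := by
  refine Subtype.ext (funext fun x => congrArg t.1 (Fin.ext ?_))
  have := x.2
  dsimp only
  split_ifs <;> omega

theorem multiply_addEnds (h₂ : p + 1 = s + n') (h₃ : q + 1 = k + n')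
    (i j : ℕ) (hj : j < k) (hij : i + j < s) :
    multiply h₂ (i + j) hij (addEnds i t) = addEnds i (multiply h₃ j hj t) := by
  refine Subtype.ext (funext fun x => ?_)
  have := x.2
  simp only [multiply, addEnds]
  split_ifs
  all_goals first
    | rfl
    | omega
    | (refine Eq.trans ?_ (dif_pos (by omega)).symm; refine congrArg t.1 (Fin.ext ?_); lia)
    | (refine Eq.trans ?_ ((if_neg (by omega)).trans (dif_pos (by omega))).symm
       refine congrArg t.1 (Fin.ext ?_); lia)

theorem multiply_addEnds_left (h₂ : p + 1 = s + n') (i j i' : ℕ)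
    (hij : j < i) (hj' : j < s) (hii' : i' + 1 = i + n') :
    multiply h₂ j hj' (addEnds i t) = addEnds i' t := by
  refine Subtype.ext (funext fun x => ?_)
  have := x.2
  simp only [multiply, addEnds]
  split_ifs
  all_goals first
    | rfl
    | omega
    | (refine Eq.trans ?_ ((if_neg (by omega)).trans (dif_pos (by omega))).symm
       refine congrArg t.1 (Fin.ext ?_); lia)

theorem multiply_addEnds_right (h₂ : p + 1 = s + n') (i j j' : ℕ)
    (hij : i < j) (hjj' : j' + 1 = j + k) (hj' : j' < s) :
    multiply h₂ j' hj' (addEnds i t) = addEnds i t := by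
  refine Subtype.ext (funext fun x => ?_)
  have := x.2
  simp only [multiply, addEnds]
  split_ifs
  all_goals first
    | rfl
    | omega

end

end HairyConf

open HairyConf in
/-- The weak bimodule of hairy configurations over `Assoc`.  The left action adds labelled points
at the ends of the interval.  The right action of the operation of arity `n ≥ 1` repeats a labelled
point `n` times, and that of the operation of arity `0` replaces a labelled point by a hair of
length `1` if it is inside the interval and distinct from the other labelled points, and forgets
it otherwise. -/
noncomputable def hairy : WBimod assocOperad ⊤ where
  obj k := TopCat.of (HairyConf k.1)
  lact {_ _ p} h i hi _ := TopCat.ofHom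
    ⟨fun c => c.relabel (addEnds (p := p.1) i c.pts), continuous_relabel _ (continuous_addEnds i)⟩
  ract h i hi _ := TopCat.ofHom
    ⟨fun c => c.relabel (multiply h i hi c.pts), continuous_relabel _ (continuous_multiply h i hi)⟩
  one_lact h h0 c := by
    refine relabel_self c _ (funext fun j => ?_)
    simp [addEnds, pts]
  ract_one h i hi c := by
    refine relabel_self c _ (funext fun j => ?_)
    simp only [multiply, pts]
    congr 1
    apply Fin.ext
    dsimp only
    split_ifs <;> omega
  lact_lact h₁ h₂ h₃ h₄ i j hi hj hij o₁ o₂ c := by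
    refine Eq.trans ?_ (relabel_relabel c _ _ (withEnds_addEnds _ _)).symm
    exact congrArg c.relabel (addEnds_addEnds c.pts h₃ i j hj)
  ract_ract h₁ h₂ h₃ h₄ i j hi hj hij o₁ o₂ c := by
    refine Eq.trans (relabel_relabel c _ _ (withEnds_multiply _ _ _ _)) ?_
    exact congrArg c.relabel (multiply_multiply c.pts h₁ h₂ h₃ h₄ i j hi hj hij)
  ract_comm h₁ h₂ h₃ h₄ i j j' hij hi hj hi' hjj' hj' o₁ o₂ c := by
    refine Eq.trans (relabel_relabel c _ _ (withEnds_multiply _ _ _ _)) ?_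
    refine Eq.trans ?_ (relabel_relabel c _ _ (withEnds_multiply _ _ _ _)).symm
    exact congrArg c.relabel (multiply_comm c.pts h₁ h₂ h₃ h₄ i j j' hij hi hj hi' hjj' hj')
  lact_ract h₁ h₂ h₃ h₄ i j hi hj hij o₁ o₂ c := by
    refine Eq.trans (relabel_relabel c _ _ (withEnds_addEnds _ _)) ?_
    refine Eq.trans ?_ (relabel_relabel c _ _ (withEnds_multiply _ _ _ _)).symm
    exact congrArg c.relabel (multiply_addEnds c.pts h₂ h₃ i j hj hij)
  lact_comp_left h₁ h₂ h₃ h₄ i j i' hij hi hj hj' hii' hi' o₁ o₂ c := by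
    refine Eq.trans (relabel_relabel c _ _ (withEnds_addEnds _ _)) ?_
    exact congrArg c.relabel (multiply_addEnds_left c.pts h₂ i j i' hij hj' hii')
  lact_comp_right h₁ h₂ h₃ h₄ i j j' hij hi hj hjj' hj' hi' o₁ o₂ c := by
    refine Eq.trans (relabel_relabel c _ _ (withEnds_addEnds _ _)) ?_
    exact congrArg c.relabel (multiply_addEnds_right c.pts h₂ i j j' hij hjj' hj')

open HairyConf in
/-- The filtration term: hairy configurations with at most `n` geometrically distinct points
strictly inside the interval. -/
noncomputable def hairyFil (n : ℕ) : hairy.Sub where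
  carrier k := {c : HairyConf k.1 | c.innerPoints.ncard ≤ n}
  lact_mem {_ _ _} _ _ _ _ {c} hc := (Set.ncard_le_ncard
    (innerPoints_relabel c _ (withEnds_addEnds _ _)) (finite_innerPoints c)).trans hc
  ract_mem {_ _ _} _ _ _ _ {c} hc := (Set.ncard_le_ncard
    (innerPoints_relabel c _ (withEnds_multiply _ _ _ _)) (finite_innerPoints c)).trans hc

open HairyConf in
/-- The intermediate filtration terms: hairy configurations with fewer than `n` geometrically
distinct points strictly inside the interval, or with `n` such points and with fewer than `i` hairs
of length less than `1`. -/
noncomputable def hairyStage (n i : ℕ) : hairy.Sub where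
  carrier k := {c : HairyConf k.1 | c.innerPoints.ncard < n ∨
    c.innerPoints.ncard = n ∧ c.shortHairs.ncard < i}
  lact_mem {_ _ p} _ i _ _ {c} hc := by
    have h1 := Set.ncard_le_ncard
      (innerPoints_relabel c (addEnds (p := p.1) i c.pts) (withEnds_addEnds _ _)) (finite_innerPoints c)
    have h2 := Set.ncard_le_ncard (shortHairs_relabel c (addEnds (p := p.1) i c.pts)) (finite_shortHairs c)
    rcases hc with hc | hc
    · exact Or.inl (h1.trans_lt hc)
    · exact (h1.trans_eq hc.1).lt_or_eq.imp id fun h => ⟨h, h2.trans_lt hc.2⟩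
  ract_mem {_ _ p} h i hi _ {c} hc := by
    have h1 := Set.ncard_le_ncard
      (innerPoints_relabel c (multiply h i hi c.pts) (withEnds_multiply _ _ _ _)) (finite_innerPoints c)
    have h2 := Set.ncard_le_ncard (shortHairs_relabel c (multiply h i hi c.pts)) (finite_shortHairs c)
    rcases hc with hc | hc
    · exact Or.inl (h1.trans_lt hc)
    · exact (h1.trans_eq hc.1).lt_or_eq.imp id fun h => ⟨h, h2.trans_lt hc.2⟩

theorem hairyStage_le (n i : ℕ) : hairyStage n i ≤ hairyStage n (i + 1) :=
  fun _ _ hc => hc.imp id fun h => ⟨h.1, h.2.trans (Nat.lt_succ_self i)⟩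

/-! ### Cofaces and codegeneracies of a weak bimodule over `Assoc` -/

namespace WBimod

section Cosimplicial

variable {N : ℕ∞} (Z : WBimod assocOperad N)

/-! Every configuration has a unique normal form. Let `c` have `n` distinct points inside the
interval, `i` of them feet of hairs shorter than `1`. Keep these short hairs and make each of the
other `n - i` points a simple labelled point. The result is generic: its labelled points are
distinct and lie inside the interval. A single operation of the weak bimodule recovers `c` from it,
by repeating some labelled points, deleting others (they become hairs of length `1`) and adding
points at the ends. The `n` positions and `i` lengths in `(0,1)` form an open cell of dimension `n +
i`, there are `n.choose i` choices of feet, and the generator has degree `n - i`. On the boundary of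
the closed cell a point inside the interval or a short hair is lost, so the boundary goes to the
preceding stage.

The attachment is free because operations can be read off from their effect on a generic
configuration. An operation from degree `q` to degree `k` is encoded by an order preserving map `L`
from `{0, …, k+1}` to `{0, …, q+1}` that preserves the end points: the new point number `j` is the
old point number `L j`, where `0` and `q+1` stand for the ends of the interval. In any weak bimodule
over `Assoc`, truncated or not, operations with the same `L` agree (`Reach.unique`); this follows
from the cosimplicial identities, and the rewriting never climbs above the degrees already visited,
so truncation does no harm. Conversely every `L` occurs (`Words.exists_label_eq`), and a generic
configuration distinguishes different `L` (`IsLabel.eq_of_pull_eq`). In particular there are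
finitely many operations between two degrees.

Topologically, each stage is compact, being built from finitely many compact cells in each degree,
and `HairyConf k` is Hausdorff because the length of a hair is detected by continuous functions
(`supCone`). So the preceding stage together with the closed cells maps onto the next stage by a
closed map, and a pushout of sets is a pushout of spaces (`isAttachment_of_cells`). A closed cell is
a simplex times a cube, a convex body, hence a disc. Running through the pairs `(n, i)`
lexicographically gives a sequence of attachments, hence cofibrancy; the union has the colimit
topology since `k` labelled points and `m` hairs occupy at most `k + m` points.

The spaces are contractible: shrink all hairs, then push the labelled points to `0`. The first
motion creates no new points, and a configuration without hairs in degree `k ≤ n` has at most `n`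
points inside. Hence the map to `Assoc` is a weak equivalence, also for the truncated filtration
terms. -/

theorem lact_congr {n n' i i' : ℕ} {k p : Deg N} {h : p.1 + 1 = n + k.1} {hi : i < n}
    {h' : p.1 + 1 = n' + k.1} {hi' : i' < n'} (hn : n = n') (hii : i = i') (z : Z.obj k) :
    Z.lact h i hi () z = Z.lact h' i' hi' () z := by
  subst hn hii; rfl

theorem ract_congr {n n' i i' : ℕ} {k p : Deg N} {h : p.1 + 1 = k.1 + n} {hi : i < k.1}
    {h' : p.1 + 1 = k.1 + n'} {hi' : i' < k.1} (hn : n = n') (hii : i = i') (z : Z.obj k) :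
    Z.ract h i hi () z = Z.ract h' i' hi' () z := by
  subst hn hii; rfl

/-- The cofaces: a point is added at the left end, the point number `i` is doubled, or a point is
added at the right end. -/
def coface {k p : Deg N} (h : p.1 = k.1 + 1) (i : ℕ) : Z.obj k ⟶ Z.obj p :=
  if i = 0 then Z.lact (n := 2) (by omega) 1 (by omega) ()
  else if hi : i - 1 < k.1 then Z.ract (n := 2) (by omega) (i - 1) hi ()
  else Z.lact (n := 2) (by omega) 0 (by omega) ()

/-- The codegeneracies: a point is deleted. -/
def codegen {k p : Deg N} (h : k.1 = p.1 + 1) (i : ℕ) (hi : i < k.1) : Z.obj k ⟶ Z.obj p :=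
  Z.ract (n := 0) (by omega) i hi ()

variable {Z}

theorem coface_zero {k p : Deg N} (h : p.1 = k.1 + 1) :
    Z.coface h 0 = Z.lact (n := 2) (by omega) 1 (by omega) () := if_pos rfl

theorem coface_succ {k p : Deg N} (h : p.1 = k.1 + 1) {i : ℕ} (hi : i < k.1) :
    Z.coface h (i + 1) = Z.ract (n := 2) (by omega) i hi () := by
  rw [coface, if_neg (by omega), dif_pos (by simpa using hi)]
  rfl

theorem coface_last {k p : Deg N} (h : p.1 = k.1 + 1) {i : ℕ} (hi : i = k.1 + 1) :
    Z.coface h i = Z.lact (n := 2) (by omega) 0 (by omega) () := by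
  rw [coface, if_neg (by omega), dif_neg (by omega)]

/-- The coface `i` doubles entry `i` of the sequence left end, labelled points, right end. Each
case, according to which entries are ends, is a bimodule axiom; the operation of arity `3` mediates
when one entry is doubled twice or when both ends are doubled. -/
theorem coface_coface {k s p : Deg N} (h : s.1 = k.1 + 1) (h' : p.1 = s.1 + 1) {i j : ℕ}
    (hij : i ≤ j) (hj : j ≤ k.1 + 1) (z : Z.obj k) :
    Z.coface h' (j + 1) (Z.coface h i z) = Z.coface h' i (Z.coface h j z) := by
  rcases i with - | i
  · rcases j with - | j
    · rw [coface_zero, coface_zero, coface_succ _ (by omega)]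
      refine (Z.lact_comp_left (r := 3) (i' := 2) _ _ (by omega) (by omega) 1 0 (by omega)
        (by omega) (by omega) (by omega) (by omega) (by omega) () () z).trans ?_
      exact Z.lact_lact (by omega) _ _ _ 1 1 _ _ _ () () z
    · obtain hj | hj := Nat.lt_or_eq_of_le hj
      · rw [coface_zero, coface_zero, coface_succ _ (by omega), coface_succ _ (by omega)]
        refine Eq.trans ?_ (Z.lact_ract (s := s) (t := s) (by omega) (by omega) _ _ 1 j _ (by omega)
          (by omega) () () z)
        exact Z.ract_congr rfl (by omega) _
      · rw [coface_zero, coface_zero, coface_last _ (by omega), coface_last _ (by omega)]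
        refine (Z.lact_lact (r := 3) (by omega) (by omega) _ _ 0 1 _ _ (by omega)
          () () z).symm.trans ?_
        exact Z.lact_lact (by omega) _ _ _ 1 0 _ _ _ () () z
  · obtain ⟨j, rfl⟩ : ∃ j', j = j' + 1 := ⟨j - 1, by omega⟩
    obtain hi | hi : i < k.1 ∨ i = k.1 := by omega
    · obtain hj | hj : j < k.1 ∨ j = k.1 := by omega
      · rw [coface_succ _ hi, coface_succ _ hj, coface_succ _ (by omega), coface_succ _ (by omega)]
        obtain rfl | hij : i = j ∨ i < j := by omega
        · refine (Z.ract_ract (r := 3) (by omega) (by omega) _ _ i 1 _ (by omega) _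
            () () z).trans ?_
          exact (Z.ract_ract (r := 3) (by omega) (by omega) _ _ i 0 _ (by omega) (by omega)
            () () z).symm
        · exact Z.ract_comm _ _ _ _ i j (j + 1) hij _ _ _ (by omega) _ () () z
      · rw [coface_succ _ hi, coface_last h (by omega), coface_last h' (by omega),
          coface_succ h' (by omega)]
        refine (Z.lact_ract (s := s) (by omega) (by omega) (by omega) _ 0 i _ _ (by omega)
          () () z).symm.trans ?_
        exact Z.ract_congr rfl (by omega) _
    · rw [coface_last (Z := Z) h (by omega), coface_last (Z := Z) h (by omega),
        coface_last _ (by omega), coface_succ _ (by omega)]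
      refine (Z.lact_lact (r := 3) (by omega) (by omega) _ _ 0 0 _ _ (by omega)
          () () z).symm.trans ?_
      exact (Z.lact_comp_right _ _ (by omega) (by omega) 0 1 i (by omega) (by omega) (by omega)
        (by omega) _ _ () () z).symm

theorem codegen_codegen {k s p : Deg N} (h : k.1 = s.1 + 1) (h' : s.1 = p.1 + 1) {i j : ℕ}
    (hij : i ≤ j) (hj : j < s.1) (hi : i < k.1) (hj' : j + 1 < k.1) (hi' : i < s.1) (z : Z.obj k) :
    Z.codegen h' j hj (Z.codegen h i hi z) = Z.codegen h' i hi' (Z.codegen h (j + 1) hj' z) :=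
  Z.ract_comm _ _ _ _ i (j + 1) j (by omega) _ _ _ (by omega) _ () () z

/-- Deleting either copy of a doubled entry composes the operation of arity `2` with that of arity
`0`, which gives the unit. -/
theorem codegen_coface_self {k s : Deg N} (h : s.1 = k.1 + 1) {i j : ℕ} (hj : j < s.1)
    (hij : i = j ∨ i = j + 1) (z : Z.obj k) : Z.codegen h j hj (Z.coface h i z) = z := by
  have key₁ : ∀ h h₁ h₂, Z.lact (n := 1) (k := k) h h₁ h₂ () z = z := by
    intro h h₁ h₂
    obtain rfl : h₁ = 0 := by omega
    exact Z.one_lact _ _ z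
  obtain rfl | rfl := hij
  · rcases i with - | i
    · rw [coface_zero]
      refine (Z.lact_comp_left (r := 1) (i' := 0) _ _ (by omega) (by omega) 1 0 (by omega)
        (by omega) (by omega) (by omega) (by omega) (by omega) () () z).trans ?_
      exact key₁ _ _ _
    · rw [coface_succ _ (by omega)]
      refine (Z.ract_ract (r := 1) (by omega) (by omega) _ _ i 1 _ (by omega) _ () () z).trans ?_
      exact Z.ract_one _ _ _ z
  · obtain hj' | hj' : j < k.1 ∨ j = k.1 := by omega
    · rw [coface_succ _ (by omega)]
      refine (Z.ract_ract (r := 1) (by omega) (by omega) _ _ j 0 _ (by omega) (by omega)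
        () () z).trans ?_
      exact Z.ract_one _ _ _ z
    · rw [coface_last _ (by omega)]
      refine (Z.lact_comp_right (r := 1) _ _ (by omega) (by omega) 0 1 j (by omega) (by omega)
        (by omega) (by omega) _ (by omega) () () z).trans ?_
      exact key₁ _ _ _

theorem codegen_coface_lt {k s t : Deg N} (h : s.1 = k.1 + 1) (h' : k.1 = t.1 + 1) {i j : ℕ}
    (hij : i ≤ j) (hj : j + 1 < s.1) (hj' : j < k.1) (z : Z.obj k) :
    Z.codegen h (j + 1) hj (Z.coface h i z) = Z.coface h' i (Z.codegen h' j hj' z) := by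
  rcases i with - | i
  · rw [coface_zero, coface_zero]
    refine Eq.trans ?_ (Z.lact_ract (s := s) (t := t) (by omega) (by omega) _ _ 1 j _ (by omega)
          (by omega) () () z)
    exact Z.ract_congr rfl (by omega) _
  · rw [coface_succ _ (by omega), coface_succ _ (by omega)]
    exact Z.ract_comm _ _ _ _ i j (j + 1) (by omega) _ _ _ (by omega) _ () () z

theorem codegen_coface_gt {k s t : Deg N} (h : s.1 = k.1 + 1) (h' : k.1 = t.1 + 1) {i j : ℕ}
    (hij : j + 1 ≤ i) (hi : i ≤ k.1) (hj : j < s.1) (hj' : j < k.1) (z : Z.obj k) :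
    Z.codegen h j hj (Z.coface h (i + 1) z) = Z.coface h' i (Z.codegen h' j hj' z) := by
  obtain ⟨i, rfl⟩ : ∃ i', i = i' + 1 := ⟨i - 1, by omega⟩
  obtain hi | hi : i + 1 < k.1 ∨ i + 1 = k.1 := by omega
  · rw [coface_succ _ (by omega), coface_succ _ (by omega)]
    exact (Z.ract_comm _ _ _ _ j (i + 1) i (by omega) _ _ _ (by omega) _ () () z).symm
  · rw [coface_last _ (by omega), coface_last _ (by omega)]
    refine Eq.trans ?_ (Z.lact_ract (s := s) (t := t) (by omega) (by omega) _ _ 0 j _ (by omega)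
          (by omega) () () z)
    exact Z.ract_congr rfl (by omega) _

end Cosimplicial

/-! ### Composites of cofaces and codegeneracies -/

/-- The order preserving surjection which takes the value `i` twice. -/
def dupl (i n : ℕ) : ℕ := if n ≤ i then n else n - 1

/-- The order preserving injection which omits the value `i`. -/
def skip (i n : ℕ) : ℕ := if n < i then n else n + 1

theorem skip_injective (i : ℕ) : Function.Injective (skip i) := by
  intro a b h
  simp only [skip] at h
  split_ifs at h <;> omega

theorem skip_ne (i n : ℕ) : skip i n ≠ i := by
  simp only [skip]; split_ifs <;> omega

theorem exists_skip_of_ne {i n : ℕ} (h : n ≠ i) : ∃ m, skip i m = n := by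
  obtain h | h := lt_or_gt_of_ne h
  · exact ⟨n, if_pos h⟩
  · exact ⟨n - 1, (if_neg (by omega)).trans (by omega)⟩

theorem monotone_skip (i : ℕ) : Monotone (skip i) := by
  intro a b h
  simp only [skip]; split_ifs <;> omega

theorem monotone_dupl (i : ℕ) : Monotone (dupl i) := by
  intro a b h
  simp only [dupl]; split_ifs <;> omega

theorem dupl_surjective (i : ℕ) : Function.Surjective (dupl i) := fun n => by
  obtain h | h := le_or_gt n i
  · exact ⟨n, if_pos h⟩
  · exact ⟨n + 1, (if_neg (by omega)).trans (by omega)⟩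

theorem dupl_comp_skip {i j : ℕ} (h : j = i ∨ j = i + 1) : dupl i ∘ skip j = id := by
  funext n
  simp only [dupl, skip, Function.comp, id]; split_ifs <;> omega

theorem comp_skip_comp_dupl {L : ℕ → ℕ} {i : ℕ} (h : L i = L (i + 1)) :
    (L ∘ skip (i + 1)) ∘ dupl i = L := by
  funext n
  obtain h1 | h1 | h1 : n ≤ i ∨ n = i + 1 ∨ i + 1 < n := by omega
  · simp [Function.comp, dupl, skip, h1]
  · subst h1; simp [Function.comp, dupl, skip, h]
  · have h2 : ¬ n ≤ i := by omega
    have h3 : ¬ n - 1 < i + 1 := by omega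
    simp [Function.comp, dupl, skip, h2, h3, Nat.sub_add_cancel (show 1 ≤ n by omega)]

theorem exists_eq_succ {L : ℕ → ℕ} (hL : Monotone L) (h : ¬ Function.Injective L) :
    ∃ i, L i = L (i + 1) := by
  by_contra! h'
  exact h (strictMono_nat_of_lt_succ fun i => lt_of_le_of_ne (hL i.le_succ) (h' i)).injective

theorem exists_deg {N : ℕ∞} (k : Deg N) {n : ℕ} (h : n ≤ k.1) : ∃ p : Deg N, p.1 = n :=
  ⟨⟨n, le_trans (by exact_mod_cast h) k.2⟩, rfl⟩

/-! ### Normal forms of composites of cofaces and codegeneracies -/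

section Reach

variable {N : ℕ∞} {Z : WBimod assocOperad N} {q : Deg N}

/-- `Reach x l k L z` says that `z` is obtained from `x` by `l` cofaces and codegeneracies, and that
`L` is the corresponding order preserving map. -/
inductive Reach (x : Z.obj q) : ℕ → (k : Deg N) → (ℕ → ℕ) → Z.obj k → Prop
  | nil : Reach x 0 q id x
  | face {l : ℕ} {k p : Deg N} {L : ℕ → ℕ} {z : Z.obj k} (h : p.1 = k.1 + 1) (i : ℕ)
      (hi : i ≤ k.1 + 1) : Reach x l k L z → Reach x (l + 1) p (L ∘ dupl i) (Z.coface h i z)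
  | degen {l : ℕ} {k p : Deg N} {L : ℕ → ℕ} {z : Z.obj k} (h : k.1 = p.1 + 1) (i : ℕ)
      (hi : i < k.1) : Reach x l k L z → Reach x (l + 1) p (L ∘ skip (i + 1)) (Z.codegen h i hi z)

/-- The maps that occur in `Reach`. -/
structure IsLabel (q k : ℕ) (L : ℕ → ℕ) : Prop where
  mono : Monotone L
  zero : L 0 = 0
  tail (a : ℕ) : L (k + 1 + a) = q + 1 + a

theorem IsLabel.last {q k : ℕ} {L : ℕ → ℕ} (h : IsLabel q k L) : L (k + 1) = q + 1 := h.tail 0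

/-- Past `k + 1` the map is a translation, so no value repeats there. For `k = 0` the first two
values are `0` and `q + 1`, which differ. -/
theorem IsLabel.dup_le {q k : ℕ} {L : ℕ → ℕ} (h : IsLabel q k L) {i : ℕ} (hi : L i = L (i + 1)) :
    i ≤ k ∧ 1 ≤ k := by
  have h1 : i ≤ k := by
    by_contra! h'
    have h1 := h.tail (i - (k + 1))
    have h2 := h.tail (i + 1 - (k + 1))
    rw [show k + 1 + (i - (k + 1)) = i by omega] at h1
    rw [show k + 1 + (i + 1 - (k + 1)) = i + 1 by omega] at h2
    omega
  refine ⟨h1, ?_⟩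
  by_contra! h'
  obtain rfl : k = 0 := by omega
  obtain rfl : i = 0 := by omega
  have := h.last
  have := h.zero
  simp_all

theorem IsLabel.comp_dupl {q k p : ℕ} {L : ℕ → ℕ} (h : IsLabel q k L) (hp : p = k + 1) {i : ℕ}
    (hi : i ≤ k + 1) : IsLabel q p (L ∘ dupl i) where
  mono := h.mono.comp (monotone_dupl i)
  zero := by simp [dupl, h.zero]
  tail a := by
    refine Eq.trans (congrArg L ?_) (h.tail a)
    rw [dupl, if_neg] <;> omega

theorem IsLabel.comp_skip {q k p : ℕ} {L : ℕ → ℕ} (h : IsLabel q k L) (hp : k = p + 1) {i : ℕ}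
    (hi : i < k) : IsLabel q p (L ∘ skip (i + 1)) where
  mono := h.mono.comp (monotone_skip _)
  zero := by simp [skip, h.zero]
  tail a := by
    refine Eq.trans (congrArg L ?_) (h.tail a)
    rw [skip, if_neg] <;> omega

theorem Reach.isLabel {x : Z.obj q} {l : ℕ} {k : Deg N} {L : ℕ → ℕ} {z : Z.obj k}
    (h : Reach x l k L z) : IsLabel q.1 k.1 L := by
  induction h with
  | nil => exact ⟨monotone_id, rfl, fun _ => rfl⟩
  | face h i hi _ ih => exact ih.comp_dupl h hi
  | degen h i hi _ ih => exact ih.comp_skip h hi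

/-- The key to uniqueness: a repeated value of `L` can be split off as a last coface, and the rest
of the path is strictly shorter. The coface is moved past the last step by the cosimplicial
identities; the bound on the length drives the induction in `Reach.reachDegen`. -/
theorem Reach.eq_coface {x : Z.obj q} {l : ℕ} {k : Deg N} {L : ℕ → ℕ} {z : Z.obj k}
    (h : Reach x l k L z) {i : ℕ} (hi : L i = L (i + 1)) :
    ∃ (p : Deg N) (e : k.1 = p.1 + 1) (l' : ℕ) (L' : ℕ → ℕ) (z' : Z.obj p), l' < l ∧
      Reach x l' p L' z' ∧ z = Z.coface e i z' ∧ L = L' ∘ dupl i := by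
  induction h generalizing i with
  | nil => simp at hi
  | @face l k p L z h j hj hz ih =>
    obtain hij | rfl | hij := lt_trichotomy i j
    · obtain ⟨r, e, l', L', z', hl, hz', rfl, rfl⟩ := @ih i (by
        simpa [dupl, hij.le, Nat.succ_le_of_lt hij] using hi)
      obtain ⟨j, rfl⟩ : ∃ j', j = j' + 1 := ⟨j - 1, by omega⟩
      refine ⟨k, h, l' + 1, L' ∘ dupl j, Z.coface e j z', by omega, .face e j (by omega) hz',
        coface_coface _ _ (by omega) (by omega) z', ?_⟩
      simp only [Function.comp_assoc]
      congr 1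
      funext n
      simp only [dupl, Function.comp]; split_ifs <;> omega
    · exact ⟨k, h, l, L, z, by omega, hz, rfl, rfl⟩
    · obtain ⟨i, rfl⟩ : ∃ i', i = i' + 1 := ⟨i - 1, by omega⟩
      have hi' : L i = L (i + 1) := by
        have h1 : ¬ i + 1 ≤ j := by omega
        have h2 : ¬ i + 1 + 1 ≤ j := by omega
        simpa [dupl, h1, h2] using hi
      have hk := hz.isLabel.dup_le hi'
      obtain ⟨r, e, l', L', z', hl, hz', rfl, rfl⟩ := ih hi'
      refine ⟨k, h, l' + 1, L' ∘ dupl j, Z.coface e j z', by omega, .face e j (by omega) hz',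
        (coface_coface _ _ (by omega) (by omega) z').symm, ?_⟩
      simp only [Function.comp_assoc]
      congr 1
      funext n
      simp only [dupl, Function.comp]; split_ifs <;> omega
  | @degen l k p L z h j hj hz ih =>
    obtain hij | rfl | hij := lt_trichotomy i j
    · have hi' : L i = L (i + 1) := by
        simpa [skip, show i < j + 1 by omega, hij] using hi
      obtain ⟨r, e, l', L', z', hl, hz', rfl, rfl⟩ := ih hi'
      obtain ⟨j, rfl⟩ : ∃ j', j = j' + 1 := ⟨j - 1, by omega⟩
      obtain rfl : p = r := Subtype.ext (by omega)
      obtain ⟨t, ht⟩ := exists_deg p (Nat.sub_le p.1 1)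
      replace ht : p.1 = t.1 + 1 := by omega
      refine ⟨t, ht, l' + 1, L' ∘ skip (j + 1),
        Z.codegen _ j (by omega) z', by omega, .degen _ j (by omega) hz',
        codegen_coface_lt _ _ (by omega) _ _ z', ?_⟩
      simp only [Function.comp_assoc]
      congr 1
      funext n
      simp only [dupl, skip, Function.comp]; split_ifs <;> omega
    -- The hard case: the middle one of three equal entries is deleted. Then `z` is a coface in two
    -- ways, with index `i` and with index `i + 1`, and the deletion cancels both.
    · have hi₂ : L i = L (i + 2) := by simpa [skip] using hi
      have hi₁ : L i = L (i + 1) :=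
        le_antisymm (hz.isLabel.mono (by omega)) (hi₂ ▸ hz.isLabel.mono (by omega))
      have hk : i + 1 ≤ k.1 := hj
      -- Otherwise the three equal entries would include both ends.
      have hp : i ≠ p.1 ∨ i ≠ 0 := by
        by_contra! h'
        have h1 := hz.isLabel.zero
        have h2 := hz.isLabel.last
        rw [h, ← h'.1, ← hi₂, h'.2, h1] at h2
        omega
      obtain ⟨r₁, e₁, l₁, L₁, z₁, hl₁, hz₁, hzz₁, hL₁⟩ := ih hi₁
      obtain ⟨r₂, e₂, l₂, L₂, z₂, hl₂, hz₂, hzz₂, hL₂⟩ := ih (hi₁.symm.trans hi₂)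
      obtain rfl : p = r₁ := Subtype.ext (by omega)
      obtain rfl : p = r₂ := Subtype.ext (by omega)
      have hs₁ : Z.codegen h i hj z = z₁ := by
        rw [hzz₁]; exact codegen_coface_self _ _ (Or.inl rfl) z₁
      have hs₂ : Z.codegen h i hj z = z₂ := by
        rw [hzz₂]; exact codegen_coface_self _ _ (Or.inr rfl) z₂
      obtain rfl : z₁ = z₂ := hs₁.symm.trans hs₂
      have hLs : L ∘ skip (i + 1) = L₁ := by
        rw [hL₁, Function.comp_assoc, dupl_comp_skip (Or.inr rfl), Function.comp_id]
      -- Two different cofaces of `z₁` coincide. Applying a codegeneracy that cancels one of them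
      -- and commutes with the other exhibits `z₁` itself as a coface.
      have hdd : Z.coface e₁ i z₁ = Z.coface e₁ (i + 1) z₁ := hzz₁.symm.trans hzz₂
      have hp0 : 1 ≤ p.1 := by omega
      obtain ⟨t, ht⟩ := exists_deg p (Nat.sub_le p.1 1)
      replace ht : p.1 = t.1 + 1 := by omega
      obtain ⟨c, hc, hcz, hcc⟩ : ∃ c, ∃ hc : c < p.1, Z.coface ht i (Z.codegen ht c hc z₁) = z₁ ∧
          (i = c ∨ i = c + 1) := by
        -- Of the two remaining copies, the labelled point with index `i` is deleted; if `i = p` the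
        -- upper copy is the right end, so the lower one is deleted instead.
        obtain hi' | hi' : i < p.1 ∨ i = p.1 := by omega
        · refine ⟨i, hi', ?_, Or.inl rfl⟩
          rw [← codegen_coface_lt e₁ ht le_rfl (by omega), hdd]
          exact codegen_coface_self _ _ (Or.inl rfl) z₁
        · obtain ⟨i, rfl⟩ : ∃ i', i = i' + 1 := ⟨i - 1, by omega⟩
          refine ⟨i, by omega, ?_, Or.inr rfl⟩
          rw [← codegen_coface_gt e₁ ht le_rfl (by omega) (by omega), ← hdd]
          exact codegen_coface_self _ _ (Or.inr rfl) z₁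
      refine ⟨t, ht, l₁ + 1, L₁ ∘ skip (c + 1), Z.codegen ht c hc z₁, by omega,
        .degen ht c hc hz₁, hs₁.trans hcz.symm, ?_⟩
      rw [hLs]
      have hd : L₁ i = L₁ (i + 1) := by
        rw [← hLs]; exact hi
      obtain rfl | rfl := hcc
      · exact (comp_skip_comp_dupl hd).symm
      · rw [← comp_skip_comp_dupl hd]
        simp only [Function.comp_assoc]
        congr 1
        funext n
        simp only [dupl, skip, Function.comp]; split_ifs <;> omega
    · have hi' : L (i + 1) = L (i + 1 + 1) := by
        simpa [skip, show ¬ i < j + 1 by omega, show ¬ i < j by omega] using hi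
      have hk := hz.isLabel.dup_le hi'
      obtain ⟨r, e, l', L', z', hl, hz', rfl, rfl⟩ := ih hi'
      obtain rfl : p = r := Subtype.ext (by omega)
      obtain ⟨t, ht⟩ := exists_deg p (Nat.sub_le p.1 1)
      replace ht : p.1 = t.1 + 1 := by omega
      refine ⟨t, ht, l' + 1, L' ∘ skip (j + 1),
        Z.codegen _ j (by omega) z', by omega, .degen _ j (by omega) hz',
        codegen_coface_gt _ _ (by omega) (by omega) _ _ z', ?_⟩
      simp only [Function.comp_assoc]
      congr 1
      funext n
      simp only [dupl, skip, Function.comp]; split_ifs <;> omega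

/-- `z` is obtained from `x` by codegeneracies, with corresponding order preserving map `L`. -/
inductive ReachDegen (x : Z.obj q) : (k : Deg N) → (ℕ → ℕ) → Z.obj k → Prop
  | nil : ReachDegen x q id x
  | degen {k p : Deg N} {L : ℕ → ℕ} {z : Z.obj k} (h : k.1 = p.1 + 1) (i : ℕ)
      (hi : i < k.1) : ReachDegen x k L z → ReachDegen x p (L ∘ skip (i + 1)) (Z.codegen h i hi z)

theorem ReachDegen.isLabel {x : Z.obj q} {k : Deg N} {L : ℕ → ℕ} {z : Z.obj k}
    (h : ReachDegen x k L z) : IsLabel q.1 k.1 L := by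
  induction h with
  | nil => exact ⟨monotone_id, rfl, fun _ => rfl⟩
  | degen h i hi _ ih => exact ih.comp_skip h hi

theorem ReachDegen.injective {x : Z.obj q} {k : Deg N} {L : ℕ → ℕ} {z : Z.obj k}
    (h : ReachDegen x k L z) : Function.Injective L := by
  induction h with
  | nil => exact Function.injective_id
  | degen h i hi _ ih => exact ih.comp (skip_injective _)

/-- If the map before a final deletion is not injective, the deletion must remove one of two equal
entries. By `Reach.eq_coface` it then cancels a coface, and a shorter path remains. -/
theorem Reach.reachDegen {x : Z.obj q} {l : ℕ} {k : Deg N} {L : ℕ → ℕ} {z : Z.obj k}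
    (h : Reach x l k L z) (hL : Function.Injective L) : ReachDegen x k L z := by
  induction l using Nat.strong_induction_on generalizing k L z with
  | _ l ih =>
  cases h with
  | nil => exact .nil
  | face h i hi hz =>
    have := @hL i (i + 1) (by simp [dupl])
    omega
  | @degen l k' p L z h i hi hz =>
    by_cases hL' : Function.Injective L
    · exact .degen h i hi (ih l (by omega) hz hL')
    · obtain ⟨p, hp⟩ := exists_eq_succ hz.isLabel.mono hL'
      have hpi : p = i ∨ p = i + 1 := by
        by_contra! h'
        obtain ⟨a, ha⟩ := exists_skip_of_ne (i := i + 1) (n := p) (by omega)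
        obtain ⟨b, hb⟩ := exists_skip_of_ne (i := i + 1) (n := p + 1) (by omega)
        have := @hL a b (by simp [ha, hb, hp])
        subst this
        omega
      obtain ⟨r, e, l', L', z', hl, hz', rfl, rfl⟩ := hz.eq_coface hp
      obtain rfl : k = r := Subtype.ext (by omega)
      have h1 : Z.codegen h i hi (Z.coface e p z') = z' := codegen_coface_self _ _ hpi z'
      have h2 : (L' ∘ dupl p) ∘ skip (i + 1) = L' := by
        rw [Function.comp_assoc, dupl_comp_skip (by omega), Function.comp_id]
      rw [h2] at hL
      rw [h1, h2]
      exact ih l' (by omega) hz' hL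

/-- Deletions commute, so the deletion of the entry that came from the point `j` of `x` can be
performed first. -/
theorem ReachDegen.codegen_of_apply_eq {x : Z.obj q} {k : Deg N} {L : ℕ → ℕ} {z : Z.obj k}
    (h : ReachDegen x k L z) {q' p : Deg N} (hq : q.1 = q'.1 + 1) (hp : k.1 = p.1 + 1) {i j : ℕ}
    (hi : i < k.1) (hj : j < q.1) (hij : L (i + 1) = j + 1) :
    ∃ L', ReachDegen (Z.codegen hq j hj x) p L' (Z.codegen hp i hi z) ∧
      L ∘ skip (i + 1) = skip (j + 1) ∘ L' := by
  induction h generalizing i p with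
  | nil =>
    obtain rfl : i = j := by simpa using hij
    obtain rfl : p = q' := Subtype.ext (by omega)
    exact ⟨id, .nil, rfl⟩
  | @degen k r L z h a ha hz ih =>
    obtain hia | hia := lt_or_ge i a
    · obtain ⟨a, rfl⟩ : ∃ a', a = a' + 1 := ⟨a - 1, by omega⟩
      obtain ⟨L', hz', hL'⟩ := ih (p := r) h (i := i) (by omega)
        (by simpa [skip, show i ≤ a by omega] using hij)
      refine ⟨L' ∘ skip (a + 1), ?_, ?_⟩
      · rw [← codegen_codegen h hp (show i ≤ a by omega) (by omega) (by omega) ha hi]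
        exact .degen _ _ _ hz'
      · rw [← Function.comp_assoc, ← hL']
        simp only [Function.comp_assoc]
        congr 1
        funext n
        simp only [skip, Function.comp]; split_ifs <;> omega
    · obtain ⟨L', hz', hL'⟩ := ih (p := r) h (i := i + 1) (by omega)
        (by simpa [skip, show ¬ i < a by omega] using hij)
      refine ⟨L' ∘ skip (a + 1), ?_, ?_⟩
      · rw [codegen_codegen h hp hia hi ha (by omega) (by omega)]
        exact .degen _ _ _ hz'
      · rw [← Function.comp_assoc, ← hL']
        simp only [Function.comp_assoc]
        congr 1
        funext n
        simp only [skip, Function.comp]; split_ifs <;> omega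

/-- A point of `x` missing from the range was deleted at some step of the path; that step can be
moved to the beginning. -/
theorem ReachDegen.of_notMem_range {x : Z.obj q} {k : Deg N} {L : ℕ → ℕ} {z : Z.obj k}
    (h : ReachDegen x k L z) {q' : Deg N} (hq : q.1 = q'.1 + 1) {j : ℕ}
    (hj : j < q.1) (hij : j + 1 ∉ Set.range L) :
    ∃ L', ReachDegen (Z.codegen hq j hj x) k L' z ∧ L = skip (j + 1) ∘ L' := by
  induction h with
  | nil => exact absurd ⟨j + 1, rfl⟩ hij
  | @degen k r L z h a ha hz ih =>
    by_cases hm : j + 1 ∈ Set.range L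
    · obtain ⟨b, hb⟩ := hm
      obtain rfl : b = a + 1 := by
        by_contra hba
        obtain ⟨m, rfl⟩ := exists_skip_of_ne hba
        exact hij ⟨m, hb⟩
      exact hz.codegen_of_apply_eq hq h ha hj hb
    · obtain ⟨L', hz', rfl⟩ := ih hm
      exact ⟨L' ∘ skip (a + 1), .degen h a ha hz', rfl⟩

theorem ReachDegen.of_surjective {x : Z.obj q} {k : Deg N} {L : ℕ → ℕ} {z : Z.obj k}
    (h : ReachDegen x k L z) (hL : Function.Surjective L) : k = q ∧ z ≍ x := by
  cases h with
  | nil => exact ⟨rfl, HEq.rfl⟩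
  | @degen k _ L z h a ha hz =>
    obtain ⟨m, hm⟩ := hL (L (a + 1))
    exact absurd (hz.injective hm) (skip_ne _ _)

/-- If `L` is onto, nothing was deleted. Otherwise both paths may start by deleting the same missing
point, and the induction is on the degree of `x`. -/
theorem ReachDegen.unique {x : Z.obj q} {k : Deg N} {L : ℕ → ℕ} {z z' : Z.obj k}
    (h : ReachDegen x k L z) (h' : ReachDegen x k L z') : z = z' := by
  obtain ⟨n, hn⟩ : ∃ n, n = q.1 := ⟨_, rfl⟩
  induction n generalizing q L with
  | zero =>
    by_cases hL : Function.Surjective L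
    · exact eq_of_heq ((h.of_surjective hL).2.trans (h'.of_surjective hL).2.symm)
    · obtain ⟨j, hj⟩ := not_forall.1 hL
      refine absurd ?_ hj
      have := h.isLabel
      rw [← hn] at this
      obtain rfl | ⟨b, rfl⟩ : j = 0 ∨ ∃ b, j = 0 + 1 + b := by
        by_cases hj0 : j = 0
        · exact Or.inl hj0
        · exact Or.inr ⟨j - 1, by omega⟩
      · exact ⟨0, this.zero⟩
      · exact ⟨_, this.tail b⟩
  | succ n ih =>
    by_cases hL : Function.Surjective L
    · exact eq_of_heq ((h.of_surjective hL).2.trans (h'.of_surjective hL).2.symm)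
    · obtain ⟨j, hj⟩ := not_forall.1 hL
      have hlab := h.isLabel
      obtain ⟨j, rfl⟩ : ∃ j', j = j' + 1 := by
        refine ⟨j - 1, ?_⟩
        have : j ≠ 0 := by
          rintro rfl
          exact hj ⟨0, hlab.zero⟩
        omega
      have hjq : j < q.1 := by
        by_contra! h'
        refine hj ⟨k.1 + 1 + (j - q.1), ?_⟩
        rw [hlab.tail]
        omega
      obtain ⟨q', hq'⟩ := exists_deg q (n := n) (by omega)
      have hq : q.1 = q'.1 + 1 := by omega
      obtain ⟨L₁, hz₁, e₁⟩ := h.of_notMem_range hq hjq hj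
      obtain ⟨L₂, hz₂, e₂⟩ := h'.of_notMem_range hq hjq hj
      obtain rfl : L₁ = L₂ := (skip_injective (j + 1)).comp_left (e₁.symm.trans e₂)
      exact ih hz₁ hz₂ hq'.symm

/-- Cofaces at repeated values are peeled off both paths simultaneously, lowering `k`, until `L` is
injective and only deletions are left. -/
theorem Reach.unique {x : Z.obj q} {k : Deg N} {L : ℕ → ℕ} {z z' : Z.obj k} {l l' : ℕ}
    (h : Reach x l k L z) (h' : Reach x l' k L z') : z = z' := by
  obtain ⟨n, hn⟩ : ∃ n, n = k.1 := ⟨_, rfl⟩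
  induction n generalizing k L l l' with
  | zero =>
    by_cases hL : Function.Injective L
    · exact (h.reachDegen hL).unique (h'.reachDegen hL)
    · obtain ⟨i, hi⟩ := exists_eq_succ h.isLabel.mono hL
      have := h.isLabel.dup_le hi
      omega
  | succ n ih =>
    by_cases hL : Function.Injective L
    · exact (h.reachDegen hL).unique (h'.reachDegen hL)
    · obtain ⟨i, hi⟩ := exists_eq_succ h.isLabel.mono hL
      obtain ⟨p, e, l₁, L₁, z₁, -, hz₁, rfl, rfl⟩ := h.eq_coface hi
      obtain ⟨p', e', l₂, L₂, z₂, -, hz₂, rfl, e₂⟩ := h'.eq_coface hi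
      obtain rfl : p = p' := Subtype.ext (by omega)
      obtain rfl : L₁ = L₂ := (dupl_surjective i).injective_comp_right e₂
      rw [ih hz₁ hz₂ (by omega)]

/-- By induction on the number `q - k` of points to be deleted. -/
theorem exists_reach_of_injective (x : Z.obj q) {k : Deg N} {L : ℕ → ℕ} (hL : IsLabel q.1 k.1 L)
    (hL' : Function.Injective L) : ∃ l z, Reach x l k L z := by
  have hs : StrictMono L := hL.mono.strictMono_of_injective hL'
  have hle : k.1 ≤ q.1 := by
    have := hs.le_apply (x := k.1 + 1)
    rw [hL.last] at this
    omega
  obtain ⟨n, hn⟩ : ∃ n, n = q.1 - k.1 := ⟨_, rfl⟩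
  induction n generalizing k L with
  | zero =>
    obtain rfl : k = q := Subtype.ext (by omega)
    obtain rfl : L = id := by
      funext n
      refine le_antisymm ?_ hs.le_apply
      have h1 := hL.tail n
      have h2 := hs.add_le_nat (k.1 + 1) n
      rw [h1] at h2
      simp only [id]
      omega
    exact ⟨0, x, .nil⟩
  | succ n ih =>
    classical
    have hex : ∃ p, L p ≠ p := ⟨k.1 + 1, by rw [hL.last]; omega⟩
    let p := Nat.find hex
    have hp : L p ≠ p := Nat.find_spec hex
    have hp' : ∀ m < p, L m = m := fun m hm => not_not.1 (Nat.find_min hex hm)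
    have hpk : p ≤ k.1 + 1 := Nat.find_min' hex (by rw [hL.last]; omega)
    have hp0 : p ≠ 0 := fun h => hp (by rw [h, hL.zero])
    have hlt : p < L p := lt_of_le_of_ne hs.le_apply (Ne.symm hp)
    obtain ⟨k', hk'⟩ := exists_deg q (n := k.1 + 1) (by omega)
    -- The first omitted value is `p`, and `L'` restores it: `L` is `L'` followed by the deletion of
    -- the entry `p`, which is the labelled point with index `p - 1`.
    let L' : ℕ → ℕ := fun n => if n ≤ p then n else L (n - 1)
    have hs' : StrictMono L' := by
      refine strictMono_nat_of_lt_succ fun n => ?_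
      simp only [L']
      split_ifs with h1 h2 h3
      · omega
      · obtain rfl : n = p := by omega
        simpa using hlt
      · omega
      · exact hs (by omega)
    have hL'' : IsLabel q.1 k'.1 L' := by
      refine ⟨hs'.monotone, by simp [L'], fun a => ?_⟩
      simp only [L']
      rw [if_neg (by omega), ← hL.tail]
      congr 1
      omega
    obtain ⟨l, z, hz⟩ := ih hL'' hs'.injective hs' (by omega)
      (by omega)
    refine ⟨l + 1, Z.codegen hk' (p - 1) (by omega) z, ?_⟩
    have : L = L' ∘ skip (p - 1 + 1) := by
      funext n
      simp only [Function.comp, skip, L', Nat.sub_add_cancel (Nat.one_le_iff_ne_zero.2 hp0)]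
      split_ifs with h1 h2 h3
      · exact hp' n h1
      · omega
      · omega
      · rfl
    have hz' := Reach.degen hk' (p - 1) (by omega) hz
    rw [← this] at hz'
    exact hz'

theorem exists_reach (x : Z.obj q) {k : Deg N} {L : ℕ → ℕ} (hL : IsLabel q.1 k.1 L) :
    ∃ l z, Reach x l k L z := by
  obtain ⟨n, hn⟩ : ∃ n, n = k.1 := ⟨_, rfl⟩
  induction n generalizing k L with
  | zero =>
    by_cases hL' : Function.Injective L
    · exact exists_reach_of_injective x hL hL'
    · obtain ⟨i, hi⟩ := exists_eq_succ hL.mono hL'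
      have := hL.dup_le hi
      omega
  | succ n ih =>
    by_cases hL' : Function.Injective L
    · exact exists_reach_of_injective x hL hL'
    · obtain ⟨i, hi⟩ := exists_eq_succ hL.mono hL'
      have hik := hL.dup_le hi
      obtain ⟨p, hp⟩ := exists_deg k (n := n) (by omega)
      have hlab : IsLabel q.1 p.1 (L ∘ skip (i + 1)) := by
        obtain hik' | rfl : i < k.1 ∨ i = k.1 := by omega
        · exact hL.comp_skip (by omega) hik'
        -- The repeated entry is the right end, which no codegeneracy deletes. Omitting it still
        -- gives a label, because the equal value `L k` takes its place.
        · refine ⟨hL.mono.comp (monotone_skip _), by simp [skip, hL.zero], fun a => ?_⟩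
          rw [← hL.tail]
          obtain rfl | ha := Nat.eq_zero_or_pos a
          · simpa [skip, hp, ← hn] using hi
          · simp only [Function.comp, skip]
            rw [if_neg (by omega)]
            congr 1
            omega
      obtain ⟨l, z, hz⟩ := ih hlab hp.symm
      refine ⟨l + 1, Z.coface (show k.1 = p.1 + 1 by omega) i z, ?_⟩
      rw [← comp_skip_comp_dupl hi]
      exact .face _ _ (by omega) hz

/-- The operation of arity `n` is an iterate of the one of arity `2`, so end points are added one at
a time. The intermediate degrees lie between those of `z` and of the result, hence are allowed in a
truncation. -/
theorem Reach.exists_lact {x : Z.obj q} {k : Deg N} {z : Z.obj k} {l : ℕ} {L : ℕ → ℕ}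
    (hz : Reach x l k L z) {n : ℕ} {p : Deg N} (h : p.1 + 1 = n + k.1) (i : ℕ) (hi : i < n) :
    ∃ l' L', Reach x l' p L' (Z.lact h i hi () z) := by
  induction n generalizing p i with
  | zero => omega
  | succ n ih =>
    obtain rfl | hn := Nat.eq_zero_or_pos n
    · obtain rfl : i = 0 := by omega
      obtain rfl : p = k := Subtype.ext (by omega)
      rw [show Z.lact h 0 hi () z = z from Z.one_lact h _ z]
      exact ⟨_, _, hz⟩
    · let s : Deg N := ⟨p.1 - 1, le_trans (by exact_mod_cast Nat.sub_le _ _) p.2⟩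
      have hs : p.1 = s.1 + 1 := by simp only [s]; omega
      rcases i with - | i
      · obtain ⟨l', L', h'⟩ := ih (p := s) (by omega) 0 hn
        refine ⟨l' + 1, L' ∘ dupl (s.1 + 1), ?_⟩
        · have := Reach.face hs (s.1 + 1) le_rfl h'
          rw [coface_last _ rfl] at this
          convert! this using 1
          exact Z.lact_lact (by omega) _ _ _ 0 0 _ _ _ () () z
      · obtain ⟨l', L', h'⟩ := ih (p := s) (by omega) i (by omega)
        refine ⟨l' + 1, L' ∘ dupl 0, ?_⟩
        · have := Reach.face hs 0 (by omega) h'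
          rw [coface_zero] at this
          convert! this using 1
          refine Eq.trans ?_ (Z.lact_lact (r := n + 1) (by omega) (by omega) _ _ 1 i _ _ (by omega)
            () () z)
          exact Z.lact_congr rfl (by omega) _

theorem Reach.exists_ract {x : Z.obj q} {k : Deg N} {z : Z.obj k} {l : ℕ} {L : ℕ → ℕ}
    (hz : Reach x l k L z) {n : ℕ} {p : Deg N} (h : p.1 + 1 = k.1 + n) (i : ℕ) (hi : i < k.1) :
    ∃ l' L', Reach x l' p L' (Z.ract h i hi () z) := by
  rcases n with - | n
  · exact ⟨_, _, .degen (by omega) i hi hz⟩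
  induction n generalizing p with
  | zero =>
    obtain rfl : p = k := Subtype.ext (by omega)
    rw [show Z.ract h i hi () z = z from Z.ract_one h _ _ z]
    exact ⟨_, _, hz⟩
  | succ n ih =>
    obtain ⟨s, hs⟩ := exists_deg p (Nat.sub_le p.1 1)
    replace hs : p.1 = s.1 + 1 := by omega
    obtain ⟨l', L', h'⟩ := ih (p := s) (by omega)
    refine ⟨l' + 1, L' ∘ dupl (i + 1), ?_⟩
    · have := Reach.face hs (i + 1) (by omega) h'
      rw [coface_succ _ (by omega)] at this
      convert! this using 1
      exact (Z.ract_ract (by omega) _ (by omega) (by omega) i 0 _ (by omega) (by omega)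
        () () z).symm

end Reach

end WBimod

/-! ### Operations of weak bimodules over `Assoc` as order preserving maps -/

/-- The labelled points as a sequence, preceded by `0` and followed by `1`. -/
noncomputable def extend {q : ℕ} (t : Fin q → unitInterval) (n : ℕ) : unitInterval :=
  if n = 0 then 0 else if h : n - 1 < q then t ⟨n - 1, h⟩ else 1

theorem extend_zero {q : ℕ} (t : Fin q → unitInterval) : extend t 0 = 0 := if_pos rfl

theorem extend_succ {q : ℕ} (t : Fin q → unitInterval) {n : ℕ} (h : n < q) :
    extend t (n + 1) = t ⟨n, h⟩ := by
  rw [extend, if_neg (by omega), dif_pos (by simpa using h)]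
  rfl

theorem extend_gt {q : ℕ} (t : Fin q → unitInterval) {n : ℕ} (h : q < n) : extend t n = 1 := by
  rw [extend, if_neg (by omega), dif_neg (by omega)]

theorem monotone_extend {q : ℕ} {t : Fin q → unitInterval} (ht : Monotone t) :
    Monotone (extend t) := by
  intro a b hab
  simp only [extend]
  split_ifs
  all_goals first
    | exact le_rfl
    | exact unitInterval.nonneg'
    | exact unitInterval.le_one'
    | exact ht (Fin.mk_le_mk.2 (by omega))
    | omega

theorem extend_mem_withEnds {q : ℕ} (t : Fin q → unitInterval) (n : ℕ) :
    extend t n ∈ withEnds t := by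
  simp only [extend]
  split_ifs
  · exact Or.inl (Or.inl rfl)
  · exact Or.inr ⟨_, rfl⟩
  · exact Or.inl (Or.inr rfl)

theorem finite_withEnds {q : ℕ} (t : Fin q → unitInterval) : (withEnds t).Finite :=
  (Set.toFinite _).union (Set.finite_range t)

namespace WBimod

/-- The family of labelled points obtained from `t` by an order preserving map. -/
noncomputable def IsLabel.pull {q k : ℕ} {L : ℕ → ℕ} (hL : IsLabel q k L)
    (t : {t : Fin q → unitInterval // Monotone t}) : {t : Fin k → unitInterval // Monotone t} :=
  ⟨fun j => extend t.1 (L (j.1 + 1)), fun _ _ h =>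
    monotone_extend t.2 (hL.mono (Nat.succ_le_succ h))⟩

theorem IsLabel.extend_pull {q k : ℕ} {L : ℕ → ℕ} (hL : IsLabel q k L)
    (t : {t : Fin q → unitInterval // Monotone t}) (n : ℕ) :
    extend (hL.pull t).1 n = extend t.1 (L n) := by
  obtain rfl | ⟨n, rfl⟩ : n = 0 ∨ ∃ m, n = m + 1 := by cases n <;> simp
  · rw [hL.zero, extend_zero, extend_zero]
  obtain h | h := lt_or_ge n k
  · exact extend_succ _ h
  · have := hL.tail (n - k)
    rw [show k + 1 + (n - k) = n + 1 by omega] at this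
    rw [this, extend_gt _ (by omega), extend_gt _ (by omega)]

/-! ### Labels of formal operations and their action on configurations -/

variable {N : ℕ∞} {q : Deg N}

theorem Reach.map {Z M : WBimod assocOperad N} (φ : Z ⟶ M) {x : Z.obj q} {k : Deg N} {z : Z.obj k}
    {l : ℕ} {L : ℕ → ℕ} (h : Reach x l k L z) : Reach (φ.app q x) l k L (φ.app k z) := by
  induction h with
  | nil => exact .nil
  | @face l k p L z h i hi hz ih =>
    convert! ih.face h i hi using 1
    simp only [coface]
    split_ifs
    · exact φ.map_lact ..
    · exact φ.map_ract ..
    · exact φ.map_lact ..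
  | @degen l k p L z h i hi hz ih =>
    convert! ih.degen h i hi using 1
    exact φ.map_ract ..

theorem exists_reach_word {k : Deg N} (w : Words assocOperad N q k) :
    ∃ l L, Reach (Z := freeObj assocOperad N q (TopCat.of Unit)) (q := q) (Quot.mk _ .nil, ())
      l k L (w, ()) := by
  revert w
  refine Quot.ind fun w => ?_
  induction w with
  | nil => exact ⟨_, _, .nil⟩
  | left h i hi o w ih =>
    obtain ⟨l, L, hL⟩ := ih
    exact hL.exists_lact h i hi
  | right h i hi o w ih =>
    obtain ⟨l, L, hL⟩ := ih
    exact hL.exists_ract h i hi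

/-- The order preserving map of an operation. -/
noncomputable def Words.label {k : Deg N} (w : Words assocOperad N q k) : ℕ → ℕ :=
  (exists_reach_word w).choose_spec.choose

theorem Words.reach_label {k : Deg N} (w : Words assocOperad N q k) :
    ∃ l, Reach (Z := freeObj assocOperad N q (TopCat.of Unit)) (q := q) (Quot.mk _ .nil, ())
      l k w.label (w, ()) :=
  ⟨_, (exists_reach_word w).choose_spec.choose_spec⟩

theorem Words.isLabel_label {k : Deg N} (w : Words assocOperad N q k) :
    IsLabel q.1 k.1 w.label := w.reach_label.choose_spec.isLabel

/-- In the free weak bimodule on one point, an operation is recovered from its value at the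
generator, so `Reach.unique` there compares operations. -/
theorem Words.label_injective {k : Deg N} :
    Function.Injective (Words.label (N := N) (q := q) (k := k)) := by
  intro w w' h
  obtain ⟨l, hl⟩ := w.reach_label
  obtain ⟨l', hl'⟩ := w'.reach_label
  rw [h] at hl
  exact congrArg Prod.fst (hl.unique hl')

theorem Words.reach_act {k : Deg N} (w : Words assocOperad N q k) (M : WBimod assocOperad N)
    (x : M.obj q) : ∃ l, Reach x l k w.label (Words.act M w x) := by
  obtain ⟨l, hl⟩ := w.reach_label
  exact ⟨l, hl.map (((freeAdj assocOperad N q).homEquiv (TopCat.of Unit) M).symm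
    (TopCat.ofHom ⟨fun _ => x, continuous_const⟩))⟩

variable {S : hairy.Sub}

theorem pt_coface {k p : Deg N} (h : p.1 = k.1 + 1) {i : ℕ} (hi : i ≤ k.1 + 1)
    (z : ((truncate N).obj S.toWBimod).obj k) (j : Fin p.1) :
    HairyConf.pt (Subtype.val (((truncate N).obj S.toWBimod).coface h i z)) j =
      extend (HairyConf.pt (Subtype.val z)) (dupl i (j.1 + 1)) := by
  have hj := j.2
  rcases i with - | i
  · rw [coface_zero]
    change (if j.1 < 1 then 0 else if h : j.1 - 1 < k.1 then _ else 1) = _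
    rw [show dupl 0 (j.1 + 1) = j.1 by simp [dupl]]
    simp only [extend, Nat.lt_one_iff]
    rfl
  obtain hi | hi : i < k.1 ∨ i = k.1 := by omega
  · rw [coface_succ _ hi]
    change HairyConf.pt (Subtype.val z) ⟨if j.1 < i then j.1 else if j.1 < i + 2 then i else j.1 + 1 - 2, _⟩ = _
    obtain h | h | h : j.1 ≤ i ∨ j.1 = i + 1 ∨ i + 1 < j.1 := by omega
    · rw [show dupl (i + 1) (j.1 + 1) = j.1 + 1 by simp [dupl, h], extend_succ _ (show _ < k.1 by omega)]
      congr 2; split_ifs <;> omega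
    · rw [show dupl (i + 1) (j.1 + 1) = i + 1 by simp [dupl, h], extend_succ _ (show _ < k.1 by omega)]
      congr 2; split_ifs <;> omega
    · rw [show dupl (i + 1) (j.1 + 1) = j.1 - 1 + 1 by simp only [dupl]; rw [if_neg] <;> omega,
        extend_succ _ (show _ < k.1 by omega)]
      congr 2; split_ifs <;> omega
  · rw [coface_last _ (by omega)]
    change (if j.1 < 0 then 0 else if h : j.1 - 0 < k.1 then _ else 1) = _
    rw [show dupl (i + 1) (j.1 + 1) = j.1 + 1 by simp only [dupl]; rw [if_pos]; omega]
    simp only [extend, Nat.not_lt_zero, if_false, Nat.succ_ne_zero]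
    rfl

theorem pt_codegen {k p : Deg N} (h : k.1 = p.1 + 1) {i : ℕ} (hi : i < k.1)
    (z : ((truncate N).obj S.toWBimod).obj k) (j : Fin p.1) :
    HairyConf.pt (Subtype.val (((truncate N).obj S.toWBimod).codegen h i hi z)) j =
      extend (HairyConf.pt (Subtype.val z)) (skip (i + 1) (j.1 + 1)) := by
  have hj := j.2
  change HairyConf.pt (Subtype.val z) ⟨if j.1 < i then j.1 else if j.1 < i + 0 then i else j.1 + 1 - 0, _⟩ = _
  obtain h | h : j.1 < i ∨ i ≤ j.1 := by omega
  · rw [show skip (i + 1) (j.1 + 1) = j.1 + 1 by simp [skip, h], extend_succ _ (show _ < k.1 by omega)]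
    congr 2; split_ifs; omega
  · rw [show skip (i + 1) (j.1 + 1) = j.1 + 1 + 1 by simp only [skip]; rw [if_neg]; omega,
      extend_succ _ (show _ < k.1 by omega)]
    congr 2; split_ifs <;> omega

theorem Reach.pt_eq {x : ((truncate N).obj S.toWBimod).obj q} {k : Deg N}
    {z : ((truncate N).obj S.toWBimod).obj k} {l : ℕ} {L : ℕ → ℕ} (h : Reach x l k L z) :
    HairyConf.pt (Subtype.val z) = (h.isLabel.pull (HairyConf.pts (Subtype.val x))).1 := by
  induction h with
  | nil =>
    funext j
    exact (extend_succ _ j.2).symm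
  | @face l k p L z h i hi hz ih =>
    funext j
    rw [pt_coface h hi, ih, IsLabel.extend_pull]
    rfl
  | @degen l k p L z h i hi hz ih =>
    funext j
    rw [pt_codegen h hi, ih, IsLabel.extend_pull]
    rfl

/-- Relabelling is transitive as long as no new positions occur, so a whole word acts by a single
relabelling. Which one it is follows afterwards from the labelled points of the result. -/
theorem Words.exists_act_eq_relabel {k : Deg N} (w : Words assocOperad N q k)
    (x : ((truncate N).obj S.toWBimod).obj q) : ∃ t : {t : Fin k.1 → unitInterval // Monotone t},
      withEnds t.1 ⊆ withEnds (HairyConf.pt (Subtype.val x)) ∧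
      Subtype.val (Words.act ((truncate N).obj S.toWBimod) w x) =
        HairyConf.relabel (Subtype.val x) t := by
  revert w
  refine Quot.ind fun w => ?_
  induction w with
  | nil =>
    exact ⟨HairyConf.pts (Subtype.val x), subset_rfl, (HairyConf.relabel_self _ _ rfl).symm⟩
  | @left n k p h i hi o w ih =>
    obtain ⟨t, ht, h'⟩ := ih
    have key : ∀ c : HairyConf k.1, c = HairyConf.relabel (Subtype.val x) t →
        c.relabel (HairyConf.addEnds (p := p.1) i c.pts) = HairyConf.relabel (Subtype.val x) (HairyConf.addEnds i t) := by
      rintro _ rfl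
      exact HairyConf.relabel_relabel _ t _ ht
    exact ⟨HairyConf.addEnds i t, (HairyConf.withEnds_addEnds i t).trans ht, key _ h'⟩
  | @right n k p h i hi o w ih =>
    obtain ⟨t, ht, h'⟩ := ih
    have key : ∀ c : HairyConf k.1, c = HairyConf.relabel (Subtype.val x) t →
        c.relabel (HairyConf.multiply h i hi c.pts) = HairyConf.relabel (Subtype.val x) (HairyConf.multiply h i hi t) := by
      rintro _ rfl
      exact HairyConf.relabel_relabel _ t _ ht
    exact ⟨HairyConf.multiply h i hi t, (HairyConf.withEnds_multiply h i hi t).trans ht, key _ h'⟩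

theorem Words.act_eq_relabel {k : Deg N} (w : Words assocOperad N q k)
    (x : ((truncate N).obj S.toWBimod).obj q) :
    Subtype.val (Words.act ((truncate N).obj S.toWBimod) w x) =
      HairyConf.relabel (Subtype.val x) (w.isLabel_label.pull (HairyConf.pts (Subtype.val x))) := by
  obtain ⟨t, -, ht⟩ := w.exists_act_eq_relabel x
  obtain ⟨l, hl⟩ := w.reach_act _ x
  rw [ht]
  congr 1
  have := hl.pt_eq
  rw [ht] at this
  exact Subtype.ext this

theorem strictMonoOn_extend {q : ℕ} {t : Fin q → unitInterval} (ht : StrictMono t)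
    (ht' : ∀ j, t j ∉ ({0, 1} : Set unitInterval)) : StrictMonoOn (extend t) (Set.Iic (q + 1)) := by
  refine strictMonoOn_Iic_of_lt_succ fun m hm => ?_
  have hm' : m < q + 1 := hm
  obtain rfl | ⟨m, rfl⟩ : m = 0 ∨ ∃ m', m = m' + 1 := by cases m <;> simp
  · rw [extend_zero, unitInterval.pos_iff_ne_zero]
    obtain hq | hq := Nat.eq_zero_or_pos q
    · rw [extend_gt _ (by simp [hq])]
      exact one_ne_zero
    · exact (extend_succ t hq).trans_ne fun h => ht' _ (Or.inl h)
  · rw [extend_succ _ (by omega), Nat.succ_eq_succ]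
    obtain hq | hq : m + 1 < q ∨ q = m + 1 := by omega
    · rw [Nat.succ_eq_add_one, extend_succ _ hq]
      exact ht (Fin.mk_lt_mk.2 (by omega))
    · rw [extend_gt _ (by omega), unitInterval.lt_one_iff_ne_one]
      exact fun h => ht' _ (Or.inr h)

/-- For distinct points inside the interval the extended sequence is injective on `{0, …, q+1}`, so
the pulled back points determine the indices. -/
theorem IsLabel.eq_of_pull_eq {q k : ℕ} {L L' : ℕ → ℕ} (hL : IsLabel q k L)
    (hL' : IsLabel q k L') {t : {t : Fin q → unitInterval // Monotone t}} (ht : StrictMono t.1)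
    (ht' : ∀ j, t.1 j ∉ ({0, 1} : Set unitInterval)) (h : hL.pull t = hL'.pull t) : L = L' := by
  have hinj : Set.InjOn (extend t.1) (Set.Iic (q + 1)) := (strictMonoOn_extend ht ht').injOn
  have hle : ∀ {L}, IsLabel q k L → ∀ n ≤ k + 1, L n ∈ Set.Iic (q + 1) := fun hL n hn =>
    (hL.mono hn).trans_eq hL.last
  funext n
  obtain rfl | ⟨n, rfl⟩ : n = 0 ∨ ∃ m, n = m + 1 := by cases n <;> simp
  · rw [hL.zero, hL'.zero]
  obtain hn | hn := lt_or_ge n k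
  · exact hinj (hle hL _ (by omega)) (hle hL' _ (by omega))
      (congrFun (congrArg Subtype.val h) ⟨n, hn⟩)
  · have h1 := hL.tail (n - k)
    have h2 := hL'.tail (n - k)
    rw [show k + 1 + (n - k) = n + 1 by omega] at h1 h2
    rw [h1, h2]

theorem exists_generic_points (q : ℕ) : ∃ t : {t : Fin q → unitInterval // Monotone t},
    StrictMono t.1 ∧ ∀ j, t.1 j ∉ ({0, 1} : Set unitInterval) := by
  have hq : (0 : ℝ) < q + 1 := by positivity
  have hs : StrictMono fun j : Fin q => (⟨(j.1 + 1) / (q + 1), by positivity, by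
      rw [div_le_one hq]
      have : (j.1 : ℝ) + 1 ≤ q := by exact_mod_cast j.2
      linarith⟩ : unitInterval) := by
    intro a b hab
    refine Subtype.mk_lt_mk.2 ?_
    have : (a.1 : ℝ) < b.1 := by exact_mod_cast hab
    gcongr
  refine ⟨⟨_, hs.monotone⟩, hs, fun j => ?_⟩
  have hj : (j.1 : ℝ) + 1 ≤ q := by exact_mod_cast j.2
  rintro (h | h)
  · have := congrArg Subtype.val h
    simp only [Set.Icc.coe_zero] at this
    have h' : (0 : ℝ) < (j.1 + 1) / (q + 1) := by positivity
    exact h'.ne' this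
  · have := congrArg Subtype.val (Set.mem_singleton_iff.1 h)
    simp only [Set.Icc.coe_one, div_eq_one_iff_eq hq.ne'] at this
    linarith

/-- A path realising `L` yields a word `w`, but `w.label` was chosen independently. Both maps
describe the action of `w` on a generic configuration, and this forces them to agree. -/
theorem Words.exists_label_eq {k : Deg N} {L : ℕ → ℕ} (hL : IsLabel q.1 k.1 L) :
    ∃ w : Words assocOperad N q k, w.label = L := by
  obtain ⟨l, ⟨w, ⟨⟩⟩, hz⟩ := exists_reach (Z := freeObj assocOperad N q (TopCat.of Unit))
    (q := q) (Quot.mk _ .nil, ()) hL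
  refine ⟨w, ?_⟩
  obtain ⟨t, ht, ht'⟩ := exists_generic_points q.1
  -- The whole bimodule, as a sub-bimodule of itself.
  let S : hairy.Sub := ⟨fun _ => Set.univ, fun _ _ _ _ _ _ => trivial, fun _ _ _ _ _ _ => trivial⟩
  let x : ((truncate N).obj S.toWBimod).obj q := ⟨HairyConf.place t Fin.elim0, trivial⟩
  obtain ⟨l', hl'⟩ := w.reach_act ((truncate N).obj S.toWBimod) x
  have hl := hz.map (((freeAdj assocOperad N q).homEquiv (TopCat.of Unit)
    ((truncate N).obj S.toWBimod)).symm (TopCat.ofHom ⟨fun _ => x, continuous_const⟩))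
  refine IsLabel.eq_of_pull_eq w.isLabel_label hL ht ht' (Subtype.ext ?_)
  exact hl'.pt_eq.symm.trans hl.pt_eq

/-- An operation is determined by its effect on one generic family of points, and only finitely many
positions are available to the new points. -/
instance finite_words {k : Deg N} : Finite (Words assocOperad N q k) := by
  obtain ⟨t, ht, ht'⟩ := exists_generic_points q.1
  have : Finite (withEnds t.1) := finite_withEnds t.1
  refine Finite.of_injective (fun (w : Words assocOperad N q k) (j : Fin k.1) =>
    (⟨(w.isLabel_label.pull t).1 j, extend_mem_withEnds _ _⟩ : withEnds t.1)) fun w w' h => ?_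
  refine Words.label_injective (w.isLabel_label.eq_of_pull_eq w'.isLabel_label ht ht' ?_)
  exact Subtype.ext (funext fun j => congrArg Subtype.val (congrFun h j))

end WBimod

/-! ### A criterion for attachments of cells -/

namespace WBimod

variable {O : NSOperad} {N : ℕ∞}

open Limits in
/-- A commutative square of weak bimodules is a pushout if it is one in every degree, in the sense
that it has the universal property of a pushout of sets and induces a quotient map. -/
theorem isPushout_of_isQuotientMap {X A Y B : WBimod O N} {g : X ⟶ A} {m : X ⟶ Y} {f : A ⟶ B}
    {g' : Y ⟶ B} (w : g ≫ f = m ≫ g')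
    (hq : ∀ k, Topology.IsQuotientMap (Sum.elim (f.app k) (g'.app k)))
    (hs : ∀ (k) (W : Type) (h : A.obj k → W) (e : Y.obj k → W),
      (∀ x, h (g.app k x) = e (m.app k x)) → ∀ a b, Sum.elim (f.app k) (g'.app k) a =
        Sum.elim (f.app k) (g'.app k) b → Sum.elim h e a = Sum.elim h e b) :
    IsPushout g m f g' := by
  have key : ∀ (s : PushoutCocone g m), ∃ ψ : B ⟶ s.pt, f ≫ ψ = s.inl ∧ g' ≫ ψ = s.inr := by
    intro s
    have hc : ∀ k (x : X.obj k), s.inl.app k (g.app k x) = s.inr.app k (m.app k x) := fun k x =>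
      congrArg (fun φ : X ⟶ s.pt => φ.app k x) s.condition
    let F (k : Deg N) : C(A.obj k ⊕ Y.obj k, s.pt.obj k) :=
      ⟨Sum.elim (s.inl.app k) (s.inr.app k), by fun_prop⟩
    let π (k : Deg N) : C(A.obj k ⊕ Y.obj k, B.obj k) :=
      ⟨Sum.elim (f.app k) (g'.app k), (hq k).continuous⟩
    have hπ (k : Deg N) : Topology.IsQuotientMap (π k) := hq k
    have hF : ∀ k, Function.FactorsThrough (F k) (π k) := fun k a b hab =>
      hs k _ _ _ (hc k) a b hab
    let ψ (k : Deg N) : C(B.obj k, s.pt.obj k) := (hπ k).lift (F k) (hF k)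
    have hψ₁ : ∀ k a, ψ k (f.app k a) = s.inl.app k a := fun k a =>
      congrArg (fun φ : C(A.obj k ⊕ Y.obj k, s.pt.obj k) => φ (Sum.inl a))
        ((hπ k).lift_comp (F k) (hF k))
    have hψ₂ : ∀ k a, ψ k (g'.app k a) = s.inr.app k a := fun k a =>
      congrArg (fun φ : C(A.obj k ⊕ Y.obj k, s.pt.obj k) => φ (Sum.inr a))
        ((hπ k).lift_comp (F k) (hF k))
    refine ⟨{ app := fun k => TopCat.ofHom (ψ k), map_lact := ?_, map_ract := ?_ }, ?_, ?_⟩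
    · intro n k p h i hi o b
      obtain ⟨a | a, rfl⟩ := (hq k).surjective b
      · change ψ p (B.lact h i hi o (f.app k a)) = s.pt.lact h i hi o (ψ k (f.app k a))
        rw [← f.map_lact, hψ₁, hψ₁, s.inl.map_lact]
      · change ψ p (B.lact h i hi o (g'.app k a)) = s.pt.lact h i hi o (ψ k (g'.app k a))
        rw [← g'.map_lact, hψ₂, hψ₂, s.inr.map_lact]
    · intro n k p h i hi o b
      obtain ⟨a | a, rfl⟩ := (hq k).surjective b
      · change ψ p (B.ract h i hi o (f.app k a)) = s.pt.ract h i hi o (ψ k (f.app k a))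
        rw [← f.map_ract, hψ₁, hψ₁, s.inl.map_ract]
      · change ψ p (B.ract h i hi o (g'.app k a)) = s.pt.ract h i hi o (ψ k (g'.app k a))
        rw [← g'.map_ract, hψ₂, hψ₂, s.inr.map_ract]
    · ext k a
      exact hψ₁ k a
    · ext k a
      exact hψ₂ k a
  choose ψ hψ₁ hψ₂ using key
  refine ⟨⟨w⟩, ⟨PushoutCocone.IsColimit.mk w ψ hψ₁ hψ₂ fun s φ h₁ h₂ => ?_⟩⟩
  ext k b
  obtain ⟨a | a, rfl⟩ := (hq k).surjective b
  · exact congrArg (fun φ : A ⟶ s.pt => φ.app k a) (h₁.trans (hψ₁ s).symm)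
  · exact congrArg (fun φ : Y ⟶ s.pt => φ.app k a) (h₂.trans (hψ₂ s).symm)

/-- The map from a free weak bimodule determined by a continuous map. -/
def freeDesc {q : Deg N} {T : TopCat.{0}} {M : WBimod O N} (g : T ⟶ M.obj q) :
    (free O N q).obj T ⟶ M where
  app k := TopCat.ofHom ⟨fun x => Words.act M x.1 (g x.2), by
    refine continuous_prod_of_discrete_left.2 fun w => ?_
    exact (Words.act M w).hom.continuous.comp g.hom.continuous⟩
  map_lact := by rintro n k p h i hi o ⟨⟨w⟩, x⟩; rfl
  map_ract := by rintro n k p h i hi o ⟨⟨w⟩, x⟩; rfl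

theorem Words.map_act {q k : Deg N} {M M' : WBimod O N} (f : M ⟶ M') (w : Words O N q k)
    (x : M.obj q) : f.app k (Words.act M w x) = Words.act M' w (f.app q x) := by
  obtain ⟨w⟩ := w
  exact Word.map_act f w x

open Limits in
-- The open cells, acted on by all operations, partition the complement of `A` in `B`, which is the
-- set-theoretic pushout property. Compactness of `A` and of the finitely many discs, with `B`
-- Hausdorff, makes the gluing map closed and hence a quotient map.
theorem isAttachment_of_cells {A B : WBimod O N} (f : A ⟶ B) (q : Deg N) (d : ℕ) (ι : Type)
    [Finite ι] [∀ k, Finite (Words O N q k)] (χ : ι → (TopCat.disk.{0} d ⟶ B.obj q))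
    [∀ k, CompactSpace (A.obj k)] [∀ k, T2Space (B.obj k)]
    (hf : ∀ k, Function.Injective (f.app k))
    (hχ : ∀ a x, χ a (TopCat.diskBoundaryInclusion d x) ∈ Set.range (f.app q))
    (hsurj : ∀ k b, b ∉ Set.range (f.app k) → ∃ (w : Words O N q k) (a : ι) (x : TopCat.disk d),
      Words.act B w (χ a x) = b)
    (hinj : ∀ k (w w' : Words O N q k) (a a' : ι) (x x' : TopCat.disk d),
      x ∉ Set.range (TopCat.diskBoundaryInclusion d) →
      x' ∉ Set.range (TopCat.diskBoundaryInclusion d) →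
      Words.act B w (χ a x) = Words.act B w' (χ a' x') → w = w' ∧ a = a' ∧ x = x')
    (hint : ∀ k (w : Words O N q k) (a : ι) (x : TopCat.disk d),
      x ∉ Set.range (TopCat.diskBoundaryInclusion d) →
      Words.act B w (χ a x) ∉ Set.range (f.app k)) :
    IsAttachment f q d (Nat.card ι) := by
  have hemb : ∀ k, Topology.IsClosedEmbedding (f.app k) := fun k =>
    (f.app k).hom.continuous.isClosedEmbedding (hf k)
  choose φ hφ using hχ
  let T₁ : TopCat.{0} := TopCat.of (Σ _ : ι, TopCat.diskBoundary.{0} d)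
  let T₂ : TopCat.{0} := TopCat.of (Σ _ : ι, TopCat.disk.{0} d)
  let bd : T₁ ⟶ T₂ := TopCat.ofHom ⟨fun x => ⟨x.1, TopCat.diskBoundaryInclusion d x.2⟩, by
    refine continuous_sigma fun a => ?_
    exact continuous_sigmaMk.comp (TopCat.diskBoundaryInclusion d).hom.continuous⟩
  let c₁ : T₁ ⟶ A.obj q := TopCat.ofHom ⟨fun x => φ x.1 x.2, by
    refine (hemb q).isInducing.continuous_iff.2 (continuous_sigma fun a => ?_)
    refine Continuous.congr ((χ a).hom.continuous.comp
      (TopCat.diskBoundaryInclusion d).hom.continuous) fun x => ?_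
    exact (hφ a x).symm⟩
  let c₂ : T₂ ⟶ B.obj q := TopCat.ofHom ⟨fun x => χ x.1 x.2,
    continuous_sigma fun a => (χ a).hom.continuous⟩
  let g : (free O N q).obj T₁ ⟶ A := freeDesc c₁
  let m : (free O N q).obj T₁ ⟶ (free O N q).obj T₂ := (free O N q).map bd
  let g' : (free O N q).obj T₂ ⟶ B := freeDesc c₂
  have hw : g ≫ f = m ≫ g' := by
    ext k ⟨w, a, x⟩
    refine (Words.map_act f w _).trans ?_
    exact congrArg (Words.act B w) (hφ a x)
  have hpush : IsPushout g m f g' := by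
    refine isPushout_of_isQuotientMap hw (fun k => ?_) (fun k W h e hhe => ?_)
    · have hc : Continuous (Sum.elim (f.app k) (g'.app k)) := by fun_prop
      have : CompactSpace (((free O N q).obj T₂).obj k) :=
        inferInstanceAs (CompactSpace (Words O N q k × Σ _ : ι, TopCat.disk.{0} d))
      refine hc.isClosedMap.isQuotientMap hc fun b => ?_
      by_cases hb : b ∈ Set.range (f.app k)
      · obtain ⟨a, rfl⟩ := hb
        exact ⟨Sum.inl a, rfl⟩
      · obtain ⟨w, a, x, rfl⟩ := hsurj k b hb
        exact ⟨Sum.inr (w, ⟨a, x⟩), rfl⟩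
    · have hbd : ∀ (w : Words O N q k) (a : ι) (x : TopCat.diskBoundary d),
          e (w, ⟨a, TopCat.diskBoundaryInclusion d x⟩) = h (Words.act A w (φ a x)) :=
        fun w a x => (hhe (w, ⟨a, x⟩)).symm
      have hbd' : ∀ (w : Words O N q k) (a : ι) (x : TopCat.diskBoundary d),
          Words.act B w (χ a (TopCat.diskBoundaryInclusion d x)) =
            f.app k (Words.act A w (φ a x)) := by
        intro w a x
        rw [Words.map_act, hφ]
      -- A point of a cell that meets the image of `A` lies on the boundary, where the compatibility
      -- of `h` and `e` is given.
      have key : ∀ y z, f.app k y = g'.app k z → h y = e z := by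
        rintro y ⟨w, a, x⟩ hyz
        by_cases hx : x ∈ Set.range (TopCat.diskBoundaryInclusion d)
        · obtain ⟨x, rfl⟩ := hx
          rw [hbd]
          exact congrArg h (hf k (hyz.trans (hbd' w a x)))
        · exact absurd ⟨y, hyz⟩ (hint k w a x hx)
      have key' : ∀ y z, g'.app k y = g'.app k z → e y = e z := by
        rintro ⟨w, a, x⟩ z hyz
        by_cases hx : x ∈ Set.range (TopCat.diskBoundaryInclusion d)
        · obtain ⟨x, rfl⟩ := hx
          rw [hbd]
          exact key _ _ ((hbd' w a x).symm.trans hyz)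
        · obtain ⟨w', a', x'⟩ := z
          by_cases hx' : x' ∈ Set.range (TopCat.diskBoundaryInclusion d)
          · obtain ⟨x', rfl⟩ := hx'
            rw [hbd]
            exact (key _ _ ((hbd' w' a' x').symm.trans hyz.symm)).symm
          · obtain ⟨rfl, rfl, rfl⟩ := hinj k w w' a a' x x' hx hx' hyz
            rfl
      rintro (a | a) (b | b) hab
      · exact congrArg h (hf k hab)
      · exact key a b hab
      · exact (key b a hab.symm).symm
      · exact key' a b hab
  -- The free functor takes disjoint unions of discs to coproducts of basic cells.
  have : PreservesColimitsOfSize.{0, 0} (free O N q) :=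
      (freeAdj O N q).leftAdjoint_preservesColimits
  refine ⟨{
    ι := ι
    π := fun _ => ()
    cofan₁ := Cofan.mk ((free O N q).obj T₁) fun a => (free O N q).map
      ((TopCat.sigmaCofan fun _ : ι => TopCat.diskBoundary.{0} d).inj a)
    cofan₂ := Cofan.mk ((free O N q).obj T₂) fun a => (free O N q).map
      ((TopCat.sigmaCofan fun _ : ι => TopCat.disk.{0} d).inj a)
    isColimit₁ := isColimitCofanMkObjOfIsColimit _ _ _ (TopCat.sigmaCofanIsColimit _)
    isColimit₂ := isColimitCofanMkObjOfIsColimit _ _ _ (TopCat.sigmaCofanIsColimit _)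
    m := m
    hm := fun a => rfl
    g₁ := g
    g₂ := g'
    isPushout := hpush }, inferInstanceAs (Finite ι), rfl⟩

/-- An isomorphism is obtained by attaching no cells. -/
theorem isAttachment_of_isIso {A B : WBimod O N} (f : A ⟶ B) [IsIso f] (q : Deg N) (d : ℕ) :
    IsAttachment f q d 0 := by
  refine ⟨{
    ι := PEmpty
    π := PEmpty.elim
    cofan₁ := Limits.Cofan.mk (empty O N) fun a => a.elim
    cofan₂ := Limits.Cofan.mk (empty O N) fun a => a.elim
    isColimit₁ := Limits.Cofan.IsColimit.mk _ (fun s => fromEmpty _) (fun s a => a.elim)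
      fun s φ _ => isInitialEmpty.hom_ext _ _
    isColimit₂ := Limits.Cofan.IsColimit.mk _ (fun s => fromEmpty _) (fun s a => a.elim)
      fun s φ _ => isInitialEmpty.hom_ext _ _
    m := 𝟙 _
    hm := fun a => a.elim
    g₁ := fromEmpty A
    g₂ := fromEmpty B
    isPushout := IsPushout.of_vert_isIso ⟨isInitialEmpty.hom_ext _ _⟩ },
    inferInstanceAs (Finite PEmpty), Nat.card_of_isEmpty (α := PEmpty)⟩

end WBimod

/-! ### Sequences of attachments of cells -/

namespace WBimod

variable {O : NSOperad} {N : ℕ∞}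

theorem IsAttachment.nonempty_attachCells {A B : WBimod O N} {f : A ⟶ B} {q : Deg N} {d r : ℕ}
    (h : IsAttachment f q d r) : Nonempty (AttachCells.{0} (basicCell O N) f) := by
  obtain ⟨a, -⟩ := h
  exact ⟨{
    ι := a.ι
    π := fun _ => (q, d)
    cofan₁ := a.cofan₁
    cofan₂ := a.cofan₂
    isColimit₁ := a.isColimit₁
    isColimit₂ := a.isColimit₂
    m := a.m
    hm := a.hm
    g₁ := a.g₁
    g₂ := a.g₂
    isPushout := a.isPushout }⟩

theorem isIso_fromEmpty {M : WBimod O N} (h : ∀ k, IsEmpty (M.obj k)) : IsIso (fromEmpty M) := by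
  let φ : M ⟶ empty O N :=
    { app := fun k => TopCat.ofHom ⟨fun x => (h k).elim x,
        continuous_of_const fun x => (h k).elim x⟩
      map_lact := fun {_ k _} _ _ _ _ m => (h k).elim m
      map_ract := fun {_ k _} _ _ _ _ m => (h k).elim m }
  refine ⟨φ, isInitialEmpty.hom_ext _ _, ?_⟩
  ext k x
  exact (h k).elim x

open Limits in
-- A union of an increasing sequence, with the colimit topology in each degree, is a colimit of weak
-- bimodules: a compatible family of morphisms glues to maps that are continuous and respect the
-- actions. Since `ℕ` has no limit stages, the attachments at successors suffice.
theorem isCofibrant_of_sequence {M : WBimod O N} (X : ℕ → WBimod O N) (f : ∀ j, X j ⟶ X (j + 1))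
    (g : ∀ j, X j ⟶ M) (hg : ∀ j, f j ≫ g (j + 1) = g j) (h0 : ∀ k, IsEmpty ((X 0).obj k))
    (hf : ∀ j, ∃ q d r, IsAttachment (f j) q d r)
    (hinj : ∀ j k, Function.Injective ((g j).app k))
    (hsurj : ∀ k b, ∃ j a, (g j).app k a = b)
    (hopen : ∀ k (s : Set (M.obj k)), (∀ j, IsOpen ((g j).app k ⁻¹' s)) → IsOpen s) :
    IsCofibrant M := by
  let F : ℕ ⥤ WBimod O N := Functor.ofSequence f
  let incl : F ⟶ (Functor.const ℕ).obj M := NatTrans.ofSequence g fun j => by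
    rw [Functor.ofSequence_map_homOfLE_succ]
    exact (hg j).trans (Category.comp_id _).symm
  have key : ∀ s : Cocone F, ∃ ψ : M ⟶ s.pt, ∀ j, g j ≫ ψ = s.ι.app j := by
    intro s
    have hs : ∀ k i j (h : i ≤ j) (a : (X i).obj k) (b : (X j).obj k),
        (g i).app k a = (g j).app k b → (s.ι.app i).app k a = (s.ι.app j).app k b := by
      intro k i j h a b hab
      have h1 : (F.map (homOfLE h) ≫ g j : F.obj i ⟶ M) = g i :=
        (incl.naturality (homOfLE h)).trans (Category.comp_id _)
      have h2 : F.map (homOfLE h) ≫ s.ι.app j = s.ι.app i := s.w (homOfLE h)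
      have h3 : (F.map (homOfLE h)).app k a = b := by
        refine hinj j k (Eq.trans ?_ hab)
        exact congrArg (fun φ : X i ⟶ M => φ.app k a) h1
      rw [← h3]
      exact congrArg (fun φ : X i ⟶ s.pt => φ.app k a) h2.symm
    have hs' : ∀ k i j (a : (X i).obj k) (b : (X j).obj k),
        (g i).app k a = (g j).app k b → (s.ι.app i).app k a = (s.ι.app j).app k b := by
      intro k i j a b hab
      obtain h | h := le_total i j
      · exact hs k i j h a b hab
      · exact (hs k j i h b a hab.symm).symm
    choose J a ha using hsurj
    let ψ (k : Deg N) (b : M.obj k) : s.pt.obj k := (s.ι.app (J k b)).app k (a k b)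
    have hψ : ∀ k j (x : (X j).obj k), ψ k ((g j).app k x) = (s.ι.app j).app k x :=
      fun k j x => hs' k _ _ _ _ (ha k _)
    have hψc : ∀ k, Continuous (ψ k) := by
      intro k
      refine continuous_def.2 fun U hU => hopen k _ fun j => ?_
      have : (g j).app k ⁻¹' (ψ k ⁻¹' U) = (s.ι.app j).app k ⁻¹' U := by
        ext x
        simp only [Set.mem_preimage, hψ]
        rfl
      rw [this]
      exact hU.preimage ((s.ι.app j).app k).hom.continuous
    refine ⟨{ app := fun k => TopCat.ofHom ⟨ψ k, hψc k⟩, map_lact := ?_, map_ract := ?_ }, ?_⟩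
    · intro n k p h i hi o b
      rw [← ha k b]
      change ψ p (M.lact h i hi o ((g _).app k _)) = s.pt.lact h i hi o (ψ k ((g _).app k _))
      rw [← (g _).map_lact, hψ, hψ]
      exact (s.ι.app _).map_lact ..
    · intro n k p h i hi o b
      rw [← ha k b]
      change ψ p (M.ract h i hi o ((g _).app k _)) = s.pt.ract h i hi o (ψ k ((g _).app k _))
      rw [← (g _).map_ract, hψ, hψ]
      exact (s.ι.app _).map_ract ..
    · intro j
      ext k x
      exact hψ k j x
  choose ψ hψ using key
  have := isIso_fromEmpty h0
  choose q d r hf using hf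
  refine ⟨ℕ, inferInstance, inferInstance, inferInstance, inferInstance, ⟨{
    F := F
    isoBot := (asIso (fromEmpty (X 0))).symm
    incl := incl
    isColimit := {
      desc := ψ
      fac := hψ
      uniq := fun s φ hφ => ?_ }
    fac := isInitialEmpty.hom_ext _ _
    attachCells := fun j _ => ?_ }⟩⟩
  · ext k b
    obtain ⟨j, a, rfl⟩ := hsurj k b
    exact congrArg (fun φ : X j ⟶ s.pt => φ.app k a) ((hφ j).trans (hψ s j).symm)
  · have e : F.map (homOfLE (Order.le_succ j)) = f j := Functor.ofSequence_map_homOfLE_succ f j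
    rw [e]
    exact (hf j).nonempty_attachCells.some

end WBimod

/-! ### Homotopy groups of contractible spaces -/

section Contractible

variable {X : Type} [TopologicalSpace X]

/-- A map of the unit interval that stretches the middle half of the interval (for `s = 1`). -/
noncomputable def stretch (s x : unitInterval) : unitInterval :=
  Set.projIcc 0 1 zero_le_one ((1 + s.1) * x.1 - s.1 / 2)

/-- Four times the distance to the end points of the interval, cut off at `1`. -/
noncomputable def endDist (x : unitInterval) : unitInterval :=
  Set.projIcc 0 1 zero_le_one (4 * min x.1 (1 - x.1))

theorem stretch_zero_left (x : unitInterval) : stretch 0 x = x := by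
  simp [stretch]

theorem stretch_zero_right (s : unitInterval) : stretch s 0 = 0 := by
  have := s.2.1
  exact Set.projIcc_of_le_left _ (by simp only [Set.Icc.coe_zero]; linarith)

theorem stretch_one_right (s : unitInterval) : stretch s 1 = 1 := by
  have := s.2.1
  exact Set.projIcc_of_right_le _ (by simp only [Set.Icc.coe_one]; linarith)

theorem endDist_zero : endDist 0 = 0 := Set.projIcc_of_le_left _ (by simp)

theorem endDist_one : endDist 1 = 0 := Set.projIcc_of_le_left _ (by simp)

/-- Outside `[1/4, 3/4]` the fully stretched coordinate is constantly `0` or `1`; inside, the cut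
off distance has reached `1`. -/
theorem endDist_eq_one_or (x : unitInterval) :
    endDist x = 1 ∨ stretch 1 x = 0 ∨ stretch 1 x = 1 := by
  obtain h | h := lt_or_ge x.1 (1 / 4)
  · exact Or.inr (Or.inl (Set.projIcc_of_le_left _ (by simp only [Set.Icc.coe_one]; linarith)))
  obtain h' | h' := lt_or_ge (3 / 4) x.1
  · exact Or.inr (Or.inr (Set.projIcc_of_right_le _ (by simp only [Set.Icc.coe_one]; linarith)))
  refine Or.inl (Set.projIcc_of_right_le _ ?_)
  have : 1 / 4 ≤ min x.1 (1 - x.1) := le_min h (by linarith)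
  linarith

theorem continuous_stretch : Continuous fun p : unitInterval × unitInterval => stretch p.1 p.2 :=
  continuous_projIcc.comp (by fun_prop)

theorem continuous_endDist : Continuous endDist :=
  continuous_projIcc.comp (by fun_prop)

/-- A contraction may move the base point, so it cannot be applied directly relative to the
boundary. The loop is first made constant on a collar of the cube, and there the contraction is
slowed down to a stop. The final map no longer depends on `g`: it traces the track of the base point
on the collar and is `p` in the middle. -/
theorem GenLoop.homotopic_of_contraction {n : ℕ} {x p : X} (H : C(unitInterval × X, X))
    (H0 : ∀ y, H (0, y) = y) (H1 : ∀ y, H (1, y) = p) (g : GenLoop (Fin n) X x) :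
    g.1.HomotopicRel ⟨fun y : Fin n → unitInterval => H (Finset.univ.inf fun i => endDist (y i),
        x), by
      have := continuous_endDist
      have : Continuous fun y : Fin n → unitInterval => Finset.univ.inf fun i => endDist (y i) :=
        Continuous.finset_inf_apply fun i _ => by fun_prop
      fun_prop⟩ (Cube.boundary (Fin n)) := by
  have hend : Continuous fun y : Fin n → unitInterval => Finset.univ.inf fun i => endDist (y i) := by
    have := continuous_endDist
    exact Continuous.finset_inf_apply fun i _ => by fun_prop
  have hst : Continuous fun q : unitInterval × (Fin n → unitInterval) =>
      fun i => stretch q.1 (q.2 i) := by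
    refine continuous_pi fun i => ?_
    exact continuous_stretch.comp (continuous_fst.prodMk ((continuous_apply i).comp continuous_snd))
  have hst1 : Continuous fun y : Fin n → unitInterval => fun i => stretch 1 (y i) :=
    hst.comp (by fun_prop : Continuous fun y : Fin n → unitInterval => ((1 : unitInterval), y))
  have hbd : ∀ s, ∀ y ∈ Cube.boundary (Fin n),
      (fun i => stretch s (y i)) ∈ Cube.boundary (Fin n) := by
    rintro s y ⟨i, hi | hi⟩
    · exact ⟨i, Or.inl (by simp [hi, stretch_zero_right])⟩
    · exact ⟨i, Or.inr (by simp [hi, stretch_one_right])⟩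
  have hed : ∀ y ∈ Cube.boundary (Fin n), (Finset.univ.inf fun i => endDist (y i)) = 0 := by
    rintro y ⟨i, hi⟩
    refine le_antisymm ((Finset.inf_le (Finset.mem_univ i)).trans_eq ?_) unitInterval.nonneg'
    obtain hi | hi := hi
    · rw [hi, endDist_zero]
    · rw [hi, endDist_one]
  have hg : Continuous g.1 := g.1.continuous
  refine ContinuousMap.HomotopicRel.trans
    (g := ⟨fun y => g.1 fun i => stretch 1 (y i), hg.comp hst1⟩) ⟨?_⟩ ⟨?_⟩
  -- First homotopy: stretch every coordinate about the middle, keeping the boundary of the cube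
  -- inside itself.
  · exact
    { toFun := fun q => g.1 fun i => stretch q.1 (q.2 i)
      continuous_toFun := hg.comp hst
      map_zero_left := fun y => by simp only [stretch_zero_left]
      map_one_left := fun y => rfl
      prop' := fun s y hy => (g.2 _ (hbd s y hy)).trans (g.2 y hy).symm }
  -- Second homotopy: contract up to a time bounded by the distance to the boundary.
  · exact
    { toFun := fun q => H (min q.1 (Finset.univ.inf fun i => endDist (q.2 i)),
        g.1 fun i => stretch 1 (q.2 i))
      continuous_toFun := by
        refine H.continuous.comp (Continuous.prodMk ?_ ?_)
        · exact continuous_fst.min (hend.comp continuous_snd)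
        · exact (hg.comp hst1).comp continuous_snd
      map_zero_left := fun y => by
        rw [min_eq_left unitInterval.nonneg']
        exact H0 _
      map_one_left := fun y => by
        rw [min_eq_right unitInterval.le_one']
        change H (_, _) = H (_, _)
        -- On the collar the stretched loop is at `x`; elsewhere the contraction has run to its end,
        -- so the value is `p` in both maps.
        by_cases h : ∃ i, endDist (y i) ≠ 1
        · obtain ⟨i, hi⟩ := h
          exact congrArg (fun z => H (_, z)) (g.2 _ ⟨i, (endDist_eq_one_or (y i)).resolve_left hi⟩)
        · simp only [not_exists, not_not] at h
          have : (Finset.univ.inf fun i => endDist (y i)) = 1 :=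
            le_antisymm unitInterval.le_one' (Finset.le_inf fun i _ => (h i).ge)
          simp only [this, H1]
      prop' := fun s y hy => by
        change H (min s _, _) = _
        rw [hed y hy, min_eq_right unitInterval.nonneg']
        exact H0 _ }

theorem subsingleton_homotopyGroup [ContractibleSpace X] (n : ℕ) (x : X) :
    Subsingleton (HomotopyGroup (Fin n) X x) := by
  obtain ⟨p, ⟨H⟩⟩ := (contractible_iff_id_nullhomotopic X).1 inferInstance
  refine ⟨fun a b => ?_⟩
  obtain ⟨a⟩ := a
  obtain ⟨b⟩ := b
  refine Quotient.sound ?_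
  exact (GenLoop.homotopic_of_contraction H.toContinuousMap H.apply_zero H.apply_one a).trans
    (GenLoop.homotopic_of_contraction H.toContinuousMap H.apply_zero H.apply_one b).symm

theorem isWeakEquiv_of_contractibleSpace {Y : Type} [TopologicalSpace Y] [ContractibleSpace X]
    [ContractibleSpace Y] (f : C(X, Y)) : IsWeakEquiv f := by
  have h0 : ∀ (Z : Type) [TopologicalSpace Z] [ContractibleSpace Z],
      Subsingleton (ZerothHomotopy Z) := by
    intro Z _ _
    refine ⟨fun a b => ?_⟩
    obtain ⟨a⟩ := a
    obtain ⟨b⟩ := b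
    exact Quotient.sound (PathConnectedSpace.joined a b)
  have := h0 X
  have := h0 Y
  obtain ⟨p⟩ : Nonempty X := inferInstance
  refine ⟨⟨Function.injective_of_subsingleton _, fun b => ⟨Quotient.mk _ p, Subsingleton.elim _ _⟩⟩,
    fun n x => ?_⟩
  have := subsingleton_homotopyGroup (n + 1) x
  have := subsingleton_homotopyGroup (n + 1) (f x)
  exact ⟨Function.injective_of_subsingleton _, fun b => ⟨default, Subsingleton.elim _ _⟩⟩

end Contractible

/-! ### The topology of the spaces of hairy configurations -/

namespace HairyConf

theorem place_surjective {k : ℕ} (c : HairyConf k) :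
    ∃ (m : ℕ) (hs : Fin m → unitInterval × unitInterval), place c.pts hs = c := by
  obtain ⟨m, e, he⟩ := c.finite_hair.fin_embedding
  refine ⟨m, fun j => (e j, c.hair (e j)), HairyConf.ext rfl (funext fun x => ?_)⟩
  by_cases hx : x ∈ withEnds c.pt
  · refine (if_pos hx).trans ?_
    rcases hx with (rfl | rfl) | ⟨j, rfl⟩
    · exact c.hair_zero.symm
    · exact c.hair_one.symm
    · exact (c.hair_pt j).symm
  · refine (if_neg hx).trans (le_antisymm (Finset.sup_le fun j _ => ?_) ?_)
    · dsimp only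
      split_ifs with h
      · rw [h]
      · exact unitInterval.nonneg'
    · by_cases h : c.hair x = 0
      · rw [h]
        exact unitInterval.nonneg'
      · obtain ⟨j, hj⟩ : x ∈ Set.range e := he ▸ h
        refine le_trans ?_ (Finset.le_sup (Finset.mem_univ j))
        exact (hj ▸ le_rfl : c.hair x ≤ c.hair (e j)).trans_eq (if_pos hj).symm

theorem isQuotientMap_place (k : ℕ) : Topology.IsQuotientMap
    (fun c : Σ m : ℕ, {t : Fin k → unitInterval // Monotone t} ×
      (Fin m → unitInterval × unitInterval) => place c.2.1 c.2.2) := by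
  refine ⟨⟨rfl⟩, fun c => ?_⟩
  obtain ⟨m, hs, h⟩ := c.place_surjective
  exact ⟨⟨m, c.pts, hs⟩, h⟩

theorem continuous_place {k m : ℕ} :
    Continuous fun a : {t : Fin k → unitInterval // Monotone t} ×
      (Fin m → unitInterval × unitInterval) => place a.1 a.2 :=
  (isQuotientMap_place k).continuous.comp continuous_sigmaMk

theorem continuous_pts {k : ℕ} : Continuous (pts (k := k)) :=
  (isQuotientMap_place k).continuous_iff.2 (continuous_sigma fun _ => continuous_fst)

theorem hair_of_mem_withEnds {k : ℕ} (c : HairyConf k) {x : unitInterval}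
    (hx : x ∈ withEnds c.pt) : c.hair x = 0 := by
  rcases hx with (rfl | rfl) | ⟨j, rfl⟩
  · exact c.hair_zero
  · exact c.hair_one
  · exact c.hair_pt j

/-- The height of a truncated cone at a point of the strip above the interval. -/
noncomputable def cone (y : unitInterval) (K : ℝ) (p : unitInterval × unitInterval) : ENNReal :=
  ENNReal.ofReal (p.2.1 - K * |p.1.1 - y.1|)

theorem continuous_cone (y : unitInterval) (K : ℝ) : Continuous (cone y K) :=
  ENNReal.continuous_ofReal.comp (by fun_prop)

theorem cone_mono {y : unitInterval} {K : ℝ} {x h h' : unitInterval} (hh : h ≤ h') :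
    cone y K (x, h) ≤ cone y K (x, h') :=
  ENNReal.ofReal_le_ofReal (sub_le_sub_right (α := ℝ) hh _)

theorem cone_zero {y : unitInterval} {K : ℝ} (hK : 0 ≤ K) (x : unitInterval) :
    cone y K (x, 0) = 0 := by
  refine ENNReal.ofReal_of_nonpos ?_
  have := mul_nonneg hK (abs_nonneg (x.1 - y.1))
  simpa only [Set.Icc.coe_zero, zero_sub, neg_nonpos] using this

open Classical in
/-- The length of the hair at a point, where labelled points and end points count as hairs of
length `1`. -/
noncomputable def height {k : ℕ} (c : HairyConf k) (x : unitInterval) : unitInterval :=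
  if x ∈ withEnds c.pt then 1 else c.hair x

/-- The supremum of the function `cone y K` over the hairs. -/
noncomputable def supCone {k : ℕ} (y : unitInterval) (K : ℝ) (c : HairyConf k) : ENNReal :=
  ⨆ x, cone y K (x, c.height x)

/-- The supremum is taken over the parameters themselves, before any identification: hairs of length
`0` contribute nothing, of several hairs at one point the longest dominates, and hairs at labelled
or end points are dominated by height `1`. This is what makes `supCone` continuous on the quotient.
-/
theorem supCone_place {k m : ℕ} {y : unitInterval} {K : ℝ} (hK : 0 ≤ K)
    (t : {t : Fin k → unitInterval // Monotone t}) (hs : Fin m → unitInterval × unitInterval) :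
    supCone y K (place t hs) = (cone y K (0, 1) ⊔ cone y K (1, 1)) ⊔
      ((Finset.univ.sup fun j => cone y K (t.1 j,
          1)) ⊔ Finset.univ.sup fun j => cone y K (hs j)) := by
  classical
  have hh : ∀ x ∈ withEnds t.1, (place t hs).height x = 1 := fun x hx => if_pos hx
  have hle : ∀ x, cone y K (x, (place t hs).height x) ≤ supCone y K (place t hs) :=
    le_iSup fun x => cone y K (x, (place t hs).height x)
  refine le_antisymm (iSup_le fun x => ?_) (sup_le (sup_le ?_ ?_) (sup_le ?_ ?_))
  · by_cases hx : x ∈ withEnds t.1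
    · rw [hh x hx]
      obtain (rfl | rfl) | ⟨j, rfl⟩ := hx
      · exact le_sup_of_le_left le_sup_left
      · exact le_sup_of_le_left le_sup_right
      · exact le_sup_of_le_right (le_sup_of_le_left
          (Finset.le_sup (f := fun j => cone y K (t.1 j, 1)) (Finset.mem_univ j)))
    · refine le_sup_of_le_right (le_sup_of_le_right ?_)
      have e : (place t hs).height x =
          Finset.univ.sup fun j => if (hs j).1 = x then (hs j).2 else ⊥ :=
        (if_neg hx).trans (if_neg hx)
      rw [e, Finset.apply_sup_eq_sup_comp_of_linearOrder (fun h => cone y K (x, h))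
        (fun _ _ h => cone_mono h) (cone_zero hK x)]
      refine Finset.sup_mono_fun fun j _ => ?_
      dsimp only [Function.comp]
      split_ifs with h
      · rw [← h]
      · exact (cone_zero hK x).trans_le zero_le
  · have := hle 0
    rwa [hh 0 (Or.inl (Or.inl rfl))] at this
  · have := hle 1
    rwa [hh 1 (Or.inl (Or.inr rfl))] at this
  · refine Finset.sup_le fun j _ => ?_
    have := hle (t.1 j)
    rwa [hh _ (Or.inr ⟨j, rfl⟩)] at this
  · refine Finset.sup_le fun j _ => le_trans ?_ (hle (hs j).1)
    by_cases hx : (hs j).1 ∈ withEnds t.1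
    · rw [hh _ hx]
      exact cone_mono unitInterval.le_one'
    · have e : (place t hs).height (hs j).1 =
          Finset.univ.sup fun i => if (hs i).1 = (hs j).1 then (hs i).2 else ⊥ :=
        (if_neg hx).trans (if_neg hx)
      rw [e]
      refine cone_mono (le_trans ?_ (Finset.le_sup (Finset.mem_univ j)))
      rw [if_pos rfl]

theorem continuous_supCone {k : ℕ} {y : unitInterval} {K : ℝ} (hK : 0 ≤ K) :
    Continuous (supCone (k := k) y K) := by
  refine (isQuotientMap_place k).continuous_iff.2 (continuous_sigma fun m => ?_)
  refine Continuous.congr ?_ fun a => (supCone_place hK a.1 a.2).symm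
  have hc := continuous_cone y K
  refine Continuous.sup continuous_const (Continuous.sup ?_ ?_)
  · refine Continuous.finset_sup_apply fun j _ => hc.comp (Continuous.prodMk ?_ continuous_const)
    exact (continuous_apply j).comp (continuous_subtype_val.comp continuous_fst)
  · refine Continuous.finset_sup_apply fun j _ => hc.comp ?_
    exact (continuous_apply j).comp continuous_snd

/-- For a steep cone all other feet, labelled points and ends are too far from `y` to contribute. -/
theorem supCone_eq {k : ℕ} {y : unitInterval} {K : ℝ} {c : HairyConf k} (hK : 0 ≤ K)
    (hy : y ∉ withEnds c.pt)
    (h : ∀ x ≠ y, x ∈ withEnds c.pt ∪ {x | c.hair x ≠ 0} → 1 ≤ K * |x.1 - y.1|) :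
    supCone y K c = ENNReal.ofReal (c.hair y).1 := by
  have hy' : c.height y = c.hair y := if_neg hy
  refine le_antisymm (iSup_le fun x => ?_) ?_
  · by_cases hxy : x = y
    · subst hxy
      simp [cone, hy']
    · by_cases hx : x ∈ withEnds c.pt ∪ {x | c.hair x ≠ 0}
      · have h1 := h x hxy hx
        have h2 := (c.height x).2.2
        exact (ENNReal.ofReal_of_nonpos (by dsimp only; linarith)).trans_le zero_le
      · simp only [Set.mem_union, Set.mem_ofPred_eq, not_or, not_not] at hx
        have : c.height x = 0 := (if_neg hx.1).trans hx.2
        rw [this, cone_zero hK]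
        exact zero_le
  · refine le_trans ?_ (le_iSup _ y)
    simp [cone, hy']

/-- Different labelled points are separated by `pts`. With equal labelled points some hair length
differs at a point `y`, and `supCone y` of sufficient slope detects it. -/
instance (k : ℕ) : T2Space (HairyConf k) := by
  refine ⟨fun c c' hcc => ?_⟩
  by_cases hp : c.pts = c'.pts
  · have hp' : c.pt = c'.pt := congrArg Subtype.val hp
    obtain ⟨y, hy⟩ : ∃ y, c.hair y ≠ c'.hair y := by
      by_contra! h
      exact hcc (HairyConf.ext hp' (funext h))
    have hyc : y ∉ withEnds c.pt := fun h => hy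
      ((c.hair_of_mem_withEnds h).trans (c'.hair_of_mem_withEnds (hp' ▸ h)).symm)
    have hfin : ((withEnds c.pt ∪ {x | c.hair x ≠ 0}) ∪
        (withEnds c'.pt ∪ {x | c'.hair x ≠ 0})).Finite :=
      ((finite_withEnds _).union c.finite_hair).union ((finite_withEnds _).union c'.finite_hair)
    -- The slope exceeds the inverse distances from `y` to all other relevant points of both
    -- configurations; the default value `0⁻¹ = 0` at `y` itself is harmless.
    obtain ⟨K, hK⟩ := (hfin.image fun x => |x.1 - y.1|⁻¹).bddAbove
    have hK' : ∀ x ≠ y, x ∈ (withEnds c.pt ∪ {x | c.hair x ≠ 0}) ∪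
        (withEnds c'.pt ∪ {x | c'.hair x ≠ 0}) → 1 ≤ max K 0 * |x.1 - y.1| := by
      intro x hxy hx
      have h1 : |x.1 - y.1|⁻¹ ≤ max K 0 := (hK ⟨x, hx, rfl⟩).trans (le_max_left _ _)
      have h2 : 0 < |x.1 - y.1| := abs_pos.2 (sub_ne_zero.2 fun h => hxy (Subtype.ext h))
      rwa [inv_le_iff_one_le_mul₀ h2] at h1
    refine separated_by_continuous (continuous_supCone (y := y) (le_max_right K 0)) ?_
    rw [supCone_eq (le_max_right K 0) hyc fun x hx hx' => hK' x hx (Or.inl hx'),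
      supCone_eq (le_max_right K 0) (hp' ▸ hyc) fun x hx hx' => hK' x hx (Or.inr hx')]
    intro h
    rw [ENNReal.ofReal_eq_ofReal_iff (c.hair y).2.1 (c'.hair y).2.1] at h
    exact hy (Subtype.ext h)
  · exact separated_by_continuous continuous_pts hp

/-- Multiply the lengths of all hairs by a number. -/
noncomputable def scale {k : ℕ} (s : unitInterval) (c : HairyConf k) : HairyConf k where
  pt := c.pt
  monotone_pt := c.monotone_pt
  hair x := s * c.hair x
  finite_hair := c.finite_hair.subset fun x hx h => hx (by rw [h, mul_zero])
  hair_zero := by rw [c.hair_zero, mul_zero]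
  hair_one := by rw [c.hair_one, mul_zero]
  hair_pt j := by rw [c.hair_pt, mul_zero]

theorem scale_place {k m : ℕ} (s : unitInterval) (t : {t : Fin k → unitInterval // Monotone t})
    (hs : Fin m → unitInterval × unitInterval) :
    scale s (place t hs) = place t fun j => ((hs j).1, s * (hs j).2) := by
  classical
  refine HairyConf.ext rfl (funext fun x => ?_)
  change s * (if x ∈ withEnds t.1 then 0 else _) = if x ∈ withEnds t.1 then 0 else _
  split_ifs
  · exact mul_zero _
  · rw [Finset.apply_sup_eq_sup_comp_of_linearOrder (fun h => s * h)
      (fun _ _ h => mul_le_mul_of_nonneg_left (α := ℝ) h s.2.1) (mul_zero s)]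
    refine Finset.sup_congr rfl fun j _ => ?_
    dsimp only [Function.comp]
    split_ifs
    · rfl
    · exact mul_zero s

/-- The product of the quotient map `place` with the locally compact unit interval still permits
continuity to be checked upstairs, where scaling is visibly continuous. -/
theorem continuous_scale {k : ℕ} :
    Continuous fun p : unitInterval × HairyConf k => scale p.1 p.2 := by
  refine (isQuotientMap_place k).continuous_lift_prod_right ?_
  have h : ∀ m, Continuous fun p : unitInterval × ({t : Fin k → unitInterval // Monotone t} ×
      (Fin m → unitInterval × unitInterval)) => scale p.1 (place p.2.1 p.2.2) := by
    intro m
    refine Continuous.congr (continuous_place.comp (f := fun p : unitInterval ×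
      ({t : Fin k → unitInterval // Monotone t} × (Fin m → unitInterval × unitInterval)) =>
        (p.2.1, fun j => ((p.2.2 j).1, p.1 * (p.2.2 j).2))) (by fun_prop))
      fun p => (scale_place p.1 p.2.1 p.2.2).symm
  have e := (Homeomorph.sigmaProdDistrib (Y := unitInterval)
    (X := fun m : ℕ => {t : Fin k → unitInterval // Monotone t} ×
      (Fin m → unitInterval × unitInterval)))
  have h' : Continuous fun q : Σ m : ℕ, (({t : Fin k → unitInterval // Monotone t} ×
      (Fin m → unitInterval × unitInterval)) × unitInterval) =>
      scale q.2.2 (place q.2.1.1 q.2.1.2) :=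
    continuous_sigma fun m => (h m).comp continuous_swap
  exact (h'.comp Homeomorph.sigmaProdDistrib.continuous).comp continuous_swap

/-- Multiply the positions of labelled points by a number. -/
noncomputable def scalePoints {k : ℕ} (s : unitInterval)
    (t : {t : Fin k → unitInterval // Monotone t}) : {t : Fin k → unitInterval // Monotone t} :=
  ⟨fun j => s * t.1 j, fun _ _ h => mul_le_mul_of_nonneg_left (α := ℝ) (t.2 h) s.2.1⟩

/-- Shrinking the hairs deforms the space to the configurations without hairs; scaling the positions
then moves all labelled points to `0`. -/
theorem contractibleSpace_of_scale {k : ℕ} {S : Set (HairyConf k)}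
    (h : ∀ c ∈ S, ∀ s, scale s c ∈ S) (h' : ∀ t, place t Fin.elim0 ∈ S) :
    ContractibleSpace S := by
  rw [contractible_iff_id_nullhomotopic]
  have hsp : Continuous fun p : unitInterval × {t : Fin k → unitInterval // Monotone t} =>
      scalePoints p.1 p.2 := by
    refine Continuous.subtype_mk (continuous_pi fun j => ?_) _
    exact continuous_fst.mul
      ((continuous_apply j).comp (continuous_subtype_val.comp continuous_snd))
  have hpl : Continuous fun t : {t : Fin k → unitInterval // Monotone t} =>
      place (m := 0) t Fin.elim0 := continuous_place.comp (by fun_prop : Continuous fun t =>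
        ((t, Fin.elim0) : _ × (Fin 0 → unitInterval × unitInterval)))
  have hpts : Continuous fun c : S => c.1.pts := continuous_pts.comp continuous_subtype_val
  refine ⟨⟨place ⟨fun _ => 0, monotone_const⟩ Fin.elim0, h' _⟩, ContinuousMap.Homotopic.trans
    (g := ⟨fun c => ⟨place c.1.pts Fin.elim0, h' _⟩, ?_⟩) ⟨?_⟩ ⟨?_⟩⟩
  · exact Continuous.subtype_mk (hpl.comp hpts) _
  · exact
    { toFun := fun q => ⟨scale (unitInterval.symm q.1) q.2.1, h _ q.2.2 _⟩
      continuous_toFun := Continuous.subtype_mk (continuous_scale.comp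
        (f := fun q : unitInterval × S => (unitInterval.symm q.1, q.2.1)) (by fun_prop)) _
      map_zero_left := fun c => Subtype.ext (HairyConf.ext rfl (funext fun x => by
        simp [scale]))
      map_one_left := fun c => Subtype.ext (HairyConf.ext rfl (funext fun x => by
        simp only [scale, unitInterval.symm_one, zero_mul, place, Finset.univ_eq_empty,
            Finset.sup_empty]
        exact (ite_self _).symm)) }
  · exact
    { toFun := fun q => ⟨place (scalePoints (unitInterval.symm q.1) q.2.1.pts) Fin.elim0, h' _⟩
      continuous_toFun := Continuous.subtype_mk (hpl.comp (hsp.comp (Continuous.prodMk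
        (by fun_prop) (hpts.comp continuous_snd)))) _
      map_zero_left := fun c => by
        refine Subtype.ext (congrArg (fun t => place t Fin.elim0) (Subtype.ext (funext fun x => ?_)))
        simp [scalePoints]
      map_one_left := fun c => by
        refine Subtype.ext (congrArg (fun t => place t Fin.elim0) (Subtype.ext (funext fun x => ?_)))
        simp [scalePoints] }

/-! ### Counting the points inside the interval -/

theorem innerPoints_place {k m : ℕ} (t : {t : Fin k → unitInterval // Monotone t})
    (hs : Fin m → unitInterval × unitInterval) :
    (place t hs).innerPoints ⊆ Set.range t.1 ∪ Set.range fun j => (hs j).1 := by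
  rintro x ⟨hx | hx, -⟩
  · exact Or.inl hx
  · refine Or.inr ?_
    by_contra h
    refine hx ?_
    have h' : ∀ j, (hs j).1 ≠ x := fun j hj => h ⟨j, hj⟩
    simp only [place, h', if_false, Finset.sup_bot]
    exact ite_self _

theorem ncard_innerPoints_place_le {k m : ℕ} (t : {t : Fin k → unitInterval // Monotone t})
    (hs : Fin m → unitInterval × unitInterval) : (place t hs).innerPoints.ncard ≤ k + m := by
  have h : ∀ {n : ℕ} (f : Fin n → unitInterval), (Set.range f).ncard ≤ n := by
    intro n f
    rw [← Set.image_univ]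
    exact (Set.ncard_image_le Set.finite_univ).trans (by simp [Set.ncard_univ])
  calc _ ≤ (Set.range t.1 ∪ Set.range fun j => (hs j).1).ncard :=
        Set.ncard_le_ncard (innerPoints_place t hs)
          ((Set.finite_range _).union (Set.finite_range _))
    _ ≤ _ := (Set.ncard_union_le _ _).trans (add_le_add (h _) (h _))

theorem ncard_innerPoints_scale_le {k : ℕ} (s : unitInterval) (c : HairyConf k) :
    (scale s c).innerPoints.ncard ≤ c.innerPoints.ncard := by
  refine Set.ncard_le_ncard ?_ (finite_innerPoints c)
  rintro x ⟨hx | hx, hx'⟩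
  · exact ⟨Or.inl hx, hx'⟩
  · refine ⟨Or.inr fun h => hx ?_, hx'⟩
    exact (congrArg (s * ·) h).trans (mul_zero s)

instance (k : ℕ) : ContractibleSpace (HairyConf k) := by
  have := contractibleSpace_of_scale (k := k) (S :=
      Set.univ) (fun _ _ _ => trivial) fun _ => trivial
  exact (Homeomorph.Set.univ (HairyConf k)).symm.contractibleSpace

end HairyConf

/-! ### Contractibility, exhaustion and colimit topology of the filtration -/

open HairyConf

/-- The bound on the degree ensures that all configurations without hairs, through which the
contraction passes, belong to the filtration term. -/
theorem contractibleSpace_hairyFil {n : ℕ} {k : Deg ⊤} (h : k.1 ≤ n) :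
    ContractibleSpace ((hairyFil n).carrier k) :=
  contractibleSpace_of_scale (S := {c : HairyConf k.1 | c.innerPoints.ncard ≤ n})
    (fun c hc s => (ncard_innerPoints_scale_le s c).trans hc)
    fun t => (ncard_innerPoints_place_le t _).trans (by simpa using h)

theorem iUnion_hairyFil (k : Deg ⊤) : ⋃ n, (hairyFil n).carrier k = Set.univ :=
  Set.eq_univ_of_forall fun c => Set.mem_iUnion.2
    ⟨(innerPoints c).ncard, le_refl (innerPoints c).ncard⟩

/-- The parameter space with `m` hairs maps into the filtration term `k + m`, so openness in all
terms implies openness of the preimage under `place`. -/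
theorem isOpen_iff_hairyFil (k : Deg ⊤) (s : Set (hairy.obj k)) : IsOpen s ↔
    ∀ n, IsOpen (Subtype.val ⁻¹' s : Set ((hairyFil n).carrier k)) := by
  refine ⟨fun h n => h.preimage continuous_subtype_val, fun h => ?_⟩
  refine (isQuotientMap_place k.1).isOpen_preimage.1 (isOpen_sigma_iff.2 fun m => ?_)
  have hc : Continuous fun a : {t : Fin k.1 → unitInterval // Monotone t} ×
      (Fin m → unitInterval × unitInterval) => (place a.1 a.2 : hairy.obj k) := continuous_place
  have hF : Continuous fun a : {t : Fin k.1 → unitInterval // Monotone t} ×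
      (Fin m → unitInterval × unitInterval) =>
      (⟨place a.1 a.2, ncard_innerPoints_place_le a.1 a.2⟩ : (hairyFil (k.1 + m)).carrier k) :=
    Topology.IsInducing.subtypeVal.continuous_iff.2 hc
  exact (h (k.1 + m)).preimage hF

/-- The map from a weak bimodule to the associative operad. -/
def WBimod.toRegular {N : ℕ∞} (M : WBimod assocOperad N) : M ⟶ WBimod.regular assocOperad N where
  app k :=
    let _ : TopologicalSpace (assocOperad.Op k.1) := ⊥
    TopCat.ofHom ⟨fun _ => (), continuous_const⟩
  map_lact _ _ _ _ _ := rfl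
  map_ract _ _ _ _ _ := rfl

theorem WBimod.isWeakEquiv_toRegular {N : ℕ∞} (M : WBimod assocOperad N) (k : Deg N)
    [ContractibleSpace (M.obj k)] : IsWeakEquiv (M.toRegular.app k).hom := by
  have : ContractibleSpace ((WBimod.regular assocOperad N).obj k) := by
    let _ : Unique ((WBimod.regular assocOperad N).obj k) := inferInstanceAs (Unique Unit)
    infer_instance
  exact isWeakEquiv_of_contractibleSpace _

/-! ### Convex bodies given by affine inequalities -/

section ConvexBody

variable {E : Type*} [NormedAddCommGroup E] [NormedSpace ℝ E]

/-- The strict inequalities define a bounded open convex set whose closure is given by the weak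
ones, and such a pair is homeomorphic to an open ball and its closure. -/
theorem exists_homeomorph_closedBall_of_affine {P : Type*} [Finite P] (l : P → E → ℝ)
    (hl : ∀ p, Continuous (l p))
    (hl' : ∀ p v w a b, a + b = 1 → l p (a • v + b • w) = a * l p v + b * l p w)
    {y : E} (hy : ∀ p, 0 < l p y) (hb : Bornology.IsBounded {v | ∀ p, 0 ≤ l p v}) :
    ∃ h : E ≃ₜ E, h '' {v | ∀ p, 0 < l p v} = Metric.ball 0 1 ∧
      h '' {v | ∀ p, 0 ≤ l p v} = Metric.closedBall 0 1 := by
  have hopen : IsOpen {v | ∀ p, 0 < l p v} := by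
    simp only [Set.ofPred_forall]
    exact isOpen_iInter_of_finite fun p => isOpen_lt continuous_const (hl p)
  have hclosed : IsClosed {v | ∀ p, 0 ≤ l p v} := by
    simp only [Set.ofPred_forall]
    exact isClosed_iInter fun p => isClosed_le continuous_const (hl p)
  have hsub : {v | ∀ p, 0 < l p v} ⊆ {v | ∀ p, 0 ≤ l p v} := fun v hv p => (hv p).le
  have hcl : closure {v | ∀ p, 0 < l p v} = {v | ∀ p, 0 ≤ l p v} := by
    refine subset_antisymm (hclosed.closure_subset_iff.2 hsub) fun v hv => ?_
    -- Moving a point slightly towards the strictly interior point `y` makes all inequalities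
    -- strict.
    have ht : Filter.Tendsto (fun t : ℝ => (1 - t) • v + t • y) (nhdsWithin 0 (Set.Ioi 0))
        (nhds v) := by
      have : Continuous fun t : ℝ => (1 - t) • v + t • y := by fun_prop
      simpa using (this.tendsto 0).mono_left nhdsWithin_le_nhds
    refine mem_closure_of_tendsto ht ?_
    filter_upwards [Ioo_mem_nhdsGT (zero_lt_one (α := ℝ))] with t ht p
    rw [hl' p _ _ _ _ (by ring)]
    have := mul_nonneg (sub_nonneg.2 ht.2.le) (hv p)
    have := mul_pos ht.1 (hy p)
    linarith
  have hconv : Convex ℝ {v | ∀ p, 0 < l p v} := by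
    refine convex_iff_forall_pos.2 fun v hv w hw a b ha hb hab p => ?_
    rw [hl' p v w a b hab]
    have := mul_pos ha (hv p)
    have := mul_pos hb (hw p)
    linarith
  obtain ⟨h, h1, h2, -⟩ := exists_homeomorph_image_interior_closure_frontier_eq_unitBall hconv
    (by rw [hopen.interior_eq]; exact ⟨y, hy⟩) (hb.subset hsub)
  rw [hopen.interior_eq] at h1
  rw [hcl] at h2
  exact ⟨h, h1, h2⟩

end ConvexBody

/-! ### The cells of the bimodule of hairy configurations -/

/-- The points of a closed cell: positions of `n` points and lengths of `i` hairs. -/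
abbrev CellParam (n i : ℕ) : Type :=
  {x : Fin n → unitInterval // Monotone x} × (Fin i → unitInterval)

/-- The points of an open cell. -/
structure CellParam.IsInterior {n i : ℕ} (p : CellParam n i) : Prop where
  strictMono : StrictMono p.1.1
  pos (a : Fin n) : p.1.1 a ∉ ({0, 1} : Set unitInterval)
  length (b : Fin i) : p.2 b ∉ ({0, 1} : Set unitInterval)

/-- The index type of the inequalities that define a cell. -/
abbrev CellIneq (n i : ℕ) : Type :=
  (Fin (n + i) ⊕ Fin (n + i)) ⊕ {p : Fin n × Fin n // p.1 < p.2}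

/-- The affine functions that define a cell. -/
def cellIneq {n i : ℕ} : CellIneq n i → EuclideanSpace ℝ (Fin (n + i)) → ℝ
  | .inl (.inl a), v => v a
  | .inl (.inr a), v => 1 - v a
  | .inr p, v => v (Fin.castAdd i p.1.2) - v (Fin.castAdd i p.1.1)

/-- Ordered positions and lengths form a simplex times a cube, a convex body whose interior is given
by the strict inequalities. A continuous bijection from the disc is all that the attachment
criterion needs. -/
theorem exists_cellParam_of_disk (n i : ℕ) : ∃ Φ : C(TopCat.disk.{0} (n + i), CellParam n i),
    Function.Bijective Φ ∧
    ∀ u, u ∈ Set.range (TopCat.diskBoundaryInclusion.{0} (n + i)) ↔ ¬ (Φ u).IsInterior := by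
  obtain ⟨h, h1, h2⟩ := exists_homeomorph_closedBall_of_affine (cellIneq (n := n) (i := i))
    (by rintro ((a | a) | p) <;> (unfold cellIneq; fun_prop))
    (by
      rintro ((c | c) | p) v w a b hab <;> simp only [cellIneq, PiLp.add_apply, PiLp.smul_apply,
        smul_eq_mul]
      · linear_combination (-1 : ℝ) * hab
      · ring)
    -- A strictly interior point: equally spaced positions and hairs of length `1 / 2`.
    (y := WithLp.toLp 2 (Fin.append (fun a => ((a.1 : ℝ) + 1) / (n + 1)) fun _ => 1 / 2))
    (by
      have hn : (0 : ℝ) < n + 1 := by positivity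
      have h1 : ∀ a : Fin n, ((a.1 : ℝ) + 1) / (n + 1) < 1 := fun a => by
        rw [div_lt_one hn]
        have : (a.1 : ℝ) < n := by exact_mod_cast a.2
        linarith
      rintro ((a | a) | ⟨⟨a, b⟩, hab⟩) <;> simp only [cellIneq]
      · refine Fin.addCases (fun a => ?_) (fun a => ?_) a
        · rw [Fin.append_left]; positivity
        · rw [Fin.append_right]; positivity
      · refine Fin.addCases (fun a => ?_) (fun a => ?_) a
        · rw [Fin.append_left]; exact sub_pos.2 (h1 a)
        · rw [Fin.append_right]; norm_num
      · rw [Fin.append_left, Fin.append_left, sub_pos]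
        have : (a.1 : ℝ) < b.1 := by exact_mod_cast hab
        gcongr)
    (by
      -- All coordinates lie in `[0,1]`, so the norm is at most the square root of their number.
      refine (Metric.isBounded_closedBall (x := (0 : EuclideanSpace ℝ (Fin (n + i))))
        (r := √(n + i))).subset fun v hv => ?_
      rw [mem_closedBall_zero_iff, EuclideanSpace.norm_eq]
      refine Real.sqrt_le_sqrt ?_
      calc ∑ a, ‖v a‖ ^ 2 ≤ ∑ a : Fin (n + i), 1 := by
            refine Finset.sum_le_sum fun a _ => ?_
            have h1 : 0 ≤ v a := hv (.inl (.inl a))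
            have h2 : 0 ≤ 1 - v a := hv (.inl (.inr a))
            rw [Real.norm_of_nonneg h1]
            nlinarith
        _ = _ := by simp)
  have hmem : ∀ u : Metric.closedBall (0 : EuclideanSpace ℝ (Fin (n + i))) 1,
      ∀ p, 0 ≤ cellIneq p (h.symm u.1) := by
    intro u
    obtain ⟨v, hv, hvu⟩ := h2.superset u.2
    rw [← hvu, h.symm_apply_apply]
    exact hv
  have hI : ∀ (u : Metric.closedBall (0 : EuclideanSpace ℝ (Fin (n + i))) 1) a,
      h.symm u.1 a ∈ Set.Icc (0 : ℝ) 1 := fun u a =>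
    ⟨hmem u (.inl (.inl a)), sub_nonneg.1 (hmem u (.inl (.inr a)))⟩
  have hcont : ∀ a, Continuous fun u : TopCat.disk.{0} (n + i) =>
      (⟨h.symm u.down.1 a, hI u.down a⟩ : unitInterval) := fun a => by
    refine Continuous.subtype_mk ?_ _
    have : Continuous fun u : TopCat.disk.{0} (n + i) => u.down.1 :=
      continuous_subtype_val.comp continuous_uliftDown
    fun_prop
  let Φ : C(TopCat.disk.{0} (n + i), CellParam n i) :=
    ⟨fun u => (⟨fun a => ⟨h.symm u.down.1 (Fin.castAdd i a), hI u.down _⟩, fun a b hab => by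
        obtain rfl | hab := hab.eq_or_lt
        · exact le_rfl
        · exact (sub_nonneg (α := ℝ)).1 (hmem u.down (.inr ⟨(a, b), hab⟩))⟩,
      fun b => ⟨h.symm u.down.1 (Fin.natAdd n b), hI u.down _⟩),
      Continuous.prodMk (Continuous.subtype_mk (continuous_pi fun a => hcont _) _)
        (continuous_pi fun b => hcont _)⟩
  have hΦ1 : ∀ u a, ((Φ u).1.1 a).1 = h.symm u.down.1 (Fin.castAdd i a) := fun _ _ => rfl
  have hΦ2 : ∀ u b, ((Φ u).2 b).1 = h.symm u.down.1 (Fin.natAdd n b) := fun _ _ => rfl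
  refine ⟨Φ, ⟨fun u u' huu => ?_, fun p => ?_⟩, fun u => ?_⟩
  · refine ULift.ext _ _ (Subtype.ext (h.symm.injective ?_))
    ext a
    refine Fin.addCases (fun a => ?_) (fun a => ?_) a
    · rw [← hΦ1, ← hΦ1, huu]
    · rw [← hΦ2, ← hΦ2, huu]
  · let v : EuclideanSpace ℝ (Fin (n + i)) :=
      WithLp.toLp 2 (Fin.append (fun a => (p.1.1 a).1) fun b => (p.2 b).1)
    have hv : ∀ c, 0 ≤ cellIneq c v := by
      rintro ((a | a) | ⟨⟨a, b⟩, hab⟩) <;> simp only [cellIneq, v]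
      · refine Fin.addCases (fun a => ?_) (fun a => ?_) a
        · rw [Fin.append_left]; exact (p.1.1 a).2.1
        · rw [Fin.append_right]; exact (p.2 a).2.1
      · refine Fin.addCases (fun a => ?_) (fun a => ?_) a
        · rw [Fin.append_left]; exact sub_nonneg.2 (p.1.1 a).2.2
        · rw [Fin.append_right]; exact sub_nonneg.2 (p.2 a).2.2
      · rw [Fin.append_left, Fin.append_left]
        exact sub_nonneg.2 (p.1.2 hab.le)
    have hu : h v ∈ Metric.closedBall (0 : EuclideanSpace ℝ (Fin (n + i))) 1 := by
      rw [← h2]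
      exact ⟨v, hv, rfl⟩
    refine ⟨ULift.up ⟨h v, hu⟩, Prod.ext (Subtype.ext (funext fun a => Subtype.ext ?_))
      (funext fun b => Subtype.ext ?_)⟩
    · exact (congrArg (fun w : EuclideanSpace ℝ (Fin (n + i)) => w (Fin.castAdd i a))
        (h.symm_apply_apply v)).trans (Fin.append_left (fun a => (p.1.1 a).1) (fun b => (p.2 b).1) a)
    · exact (congrArg (fun w : EuclideanSpace ℝ (Fin (n + i)) => w (Fin.natAdd n b))
        (h.symm_apply_apply v)).trans (Fin.append_right (fun a => (p.1.1 a).1) (fun b => (p.2 b).1) b)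
  · have hint : (Φ u).IsInterior ↔ ∀ p, 0 < cellIneq p (h.symm u.down.1) := by
      constructor
      · rintro ⟨hs, hp, hl⟩ ((a | a) | ⟨⟨a, b⟩, hab⟩)
        · refine Fin.addCases (fun a => ?_) (fun a => ?_) a
          · exact unitInterval.pos_iff_ne_zero.2 fun h => hp a (Or.inl h)
          · exact unitInterval.pos_iff_ne_zero.2 fun h => hl a (Or.inl h)
        · refine Fin.addCases (fun a => ?_) (fun a => ?_) a
          · exact sub_pos.2 (unitInterval.lt_one_iff_ne_one.2 fun h => hp a (Or.inr h))
          · exact sub_pos.2 (unitInterval.lt_one_iff_ne_one.2 fun h => hl a (Or.inr h))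
        · exact sub_pos.2 (hs hab)
      · intro hpos
        have h01 : ∀ (x : unitInterval), 0 < x.1 → 0 < 1 - x.1 →
            x ∉ ({0, 1} : Set unitInterval) := by
          rintro x hx hx' (rfl | rfl)
          · exact lt_irrefl _ hx
          · simp at hx'
        exact ⟨fun a b hab => (sub_pos (α := ℝ)).1 (hpos (.inr ⟨(a, b), hab⟩)),
          fun a => h01 _ (hpos (.inl (.inl _))) (hpos (.inl (.inr _))),
          fun a => h01 _ (hpos (.inl (.inl _))) (hpos (.inl (.inr _)))⟩
    have hball : u.down.1 ∈ Metric.ball (0 : EuclideanSpace ℝ (Fin (n + i))) 1 ↔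
        ∀ p, 0 < cellIneq p (h.symm u.down.1) := by
      rw [← h1, h.image_eq_preimage_symm]
      rfl
    rw [hint, ← hball, Metric.mem_ball, not_lt, dist_zero_right]
    constructor
    · rintro ⟨⟨x⟩, rfl⟩
      exact (mem_sphere_zero_iff_norm.1 x.2).ge
    · intro hu
      exact ⟨ULift.up ⟨u.down.1, mem_sphere_zero_iff_norm.2
        (le_antisymm (mem_closedBall_zero_iff.1 u.down.2) hu)⟩, rfl⟩

/-! ### Hairs of placed and relabelled configurations -/

namespace HairyConf

theorem le_hair_place {k m : ℕ} {t : {t : Fin k → unitInterval // Monotone t}}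
    {hs : Fin m → unitInterval × unitInterval} {j : Fin m} (h : (hs j).1 ∉ withEnds t.1) :
    (hs j).2 ≤ (place t hs).hair (hs j).1 := by
  refine le_trans ?_ (if_neg h).ge
  refine le_trans ?_ (Finset.le_sup (Finset.mem_univ j))
  rw [if_pos rfl]

theorem exists_of_hair_place_ne_zero {k m : ℕ} {t : {t : Fin k → unitInterval // Monotone t}}
    {hs : Fin m → unitInterval × unitInterval} {x : unitInterval} (h : (place t hs).hair x ≠ 0) :
    x ∉ withEnds t.1 ∧ ∃ j, (hs j).1 = x ∧ (hs j).2 = (place t hs).hair x := by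
  classical
  have hx : x ∉ withEnds t.1 := fun hx => h (if_pos hx)
  have e : (place t hs).hair x =
      Finset.univ.sup fun j => if (hs j).1 = x then (hs j).2 else ⊥ :=
    (if_neg hx).trans (by congr!)
  refine ⟨hx, ?_⟩
  rw [e] at h ⊢
  have hne : (Finset.univ : Finset (Fin m)).Nonempty := by
    by_contra h'
    rw [Finset.not_nonempty_iff_eq_empty] at h'
    exact h (by rw [h']; rfl)
  obtain ⟨j, -, hj⟩ := Finset.exists_mem_eq_sup Finset.univ hne
    fun j => if (hs j).1 = x then (hs j).2 else ⊥
  rw [hj] at h ⊢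
  have hjx : (hs j).1 = x := by
    by_contra h'
    exact h (if_neg h')
  exact ⟨j, hjx, (if_pos hjx).symm⟩

theorem hair_place_of_injective {k m : ℕ} {t : {t : Fin k → unitInterval // Monotone t}}
    {hs : Fin m → unitInterval × unitInterval} (hi : Function.Injective fun j => (hs j).1)
    {j : Fin m} (h : (hs j).1 ∉ withEnds t.1) : (place t hs).hair (hs j).1 = (hs j).2 := by
  by_cases h0 : (place t hs).hair (hs j).1 = 0
  · refine le_antisymm ?_ (le_hair_place h)
    rw [h0]
    exact unitInterval.nonneg'
  · obtain ⟨-, j', h1, h2⟩ := exists_of_hair_place_ne_zero h0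
    rw [← h2, hi h1]

/-- If no new positions are introduced, a labelled point inside the interval either stays labelled
or leaves a hair of length `1`; in both cases its position survives. The operations therefore act
within a layer of the filtration. -/
theorem innerPoints_relabel_eq {k p : ℕ} (c : HairyConf k)
    (t : {t : Fin p → unitInterval // Monotone t}) (ht : withEnds t.1 ⊆ withEnds c.pt) :
    (c.relabel t).innerPoints = c.innerPoints := by
  refine subset_antisymm (innerPoints_relabel c t ht) ?_
  rintro x ⟨hx, hx'⟩
  refine ⟨?_, hx'⟩
  by_cases h1 : x ∈ withEnds t.1
  · exact Or.inl (h1.resolve_left hx')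
  refine Or.inr (show _ ≠ _ from ?_)
  by_cases h2 : x ∈ Set.range c.pt
  · rw [relabel_hair_of_mem_range _ _ h1 h2]
    exact one_ne_zero
  · rw [relabel_hair_of_notMem _ _ h1 h2]
    exact hx.resolve_left h2

theorem relabel_hair_of_ne_zero {k p : ℕ} (c : HairyConf k)
    (t : {t : Fin p → unitInterval // Monotone t}) (ht : withEnds t.1 ⊆ withEnds c.pt)
    {x : unitInterval} (hx : c.hair x ≠ 0) : (c.relabel t).hair x = c.hair x := by
  have h1 : x ∉ withEnds c.pt := fun h => hx (c.hair_of_mem_withEnds h)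
  exact relabel_hair_of_notMem _ _ (fun h => h1 (ht h)) fun h => h1 (Or.inr h)

theorem shortHairs_relabel_eq {k p : ℕ} (c : HairyConf k)
    (t : {t : Fin p → unitInterval // Monotone t}) (ht : withEnds t.1 ⊆ withEnds c.pt) :
    (c.relabel t).shortHairs = c.shortHairs := by
  refine subset_antisymm (shortHairs_relabel c t) ?_
  rintro x ⟨hx, hx'⟩
  have := relabel_hair_of_ne_zero c t ht hx
  exact ⟨this ▸ hx, this ▸ hx'⟩

theorem shortHairs_subset_innerPoints {k : ℕ} (c : HairyConf k) :
    c.shortHairs ⊆ c.innerPoints := by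
  rintro x ⟨hx, -⟩
  exact ⟨Or.inr hx, fun h => hx (c.hair_of_mem_withEnds (Or.inl h))⟩

end HairyConf

/-- The index set of the cells of given type: the sets of positions of hairs among all points. -/
abbrev CellIndex (n i : ℕ) : Type := {I : Finset (Fin n) // I.card = i}

namespace CellIndex

variable {n i : ℕ} (I : CellIndex n i)

/-- The positions of the hairs. -/
def hairEmb : Fin i ↪o Fin n := I.1.orderEmbOfFin I.2

/-- The positions of the labelled points. -/
def pointEmb : Fin (n - i) ↪o Fin n :=
  I.1ᶜ.orderEmbOfFin (by rw [Finset.card_compl, I.2, Fintype.card_fin])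

theorem range_hairEmb : Set.range I.hairEmb = I.1 := Finset.range_orderEmbOfFin _ _

theorem range_pointEmb : Set.range I.pointEmb = (I.1 : Set (Fin n))ᶜ :=
  (Finset.range_orderEmbOfFin _ _).trans (Finset.coe_compl _)

theorem exists_eq (a : Fin n) : (∃ b, I.hairEmb b = a) ∨ ∃ b, I.pointEmb b = a := by
  by_cases h : a ∈ (I.1 : Set (Fin n))
  · exact Or.inl (by rwa [← range_hairEmb] at h)
  · exact Or.inr (by rwa [← Set.mem_compl_iff, ← range_pointEmb] at h)

theorem hairEmb_ne_pointEmb (a : Fin i) (b : Fin (n - i)) : I.hairEmb a ≠ I.pointEmb b := by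
  intro h
  have h1 : I.hairEmb a ∈ (I.1 : Set (Fin n)) := I.range_hairEmb ▸ ⟨a, rfl⟩
  have h2 : I.pointEmb b ∈ (I.1 : Set (Fin n))ᶜ := I.range_pointEmb ▸ ⟨b, rfl⟩
  exact h2 (h ▸ h1)

/-- The hairy configuration given by a point of a cell. -/
noncomputable def conf (p : CellParam n i) : HairyConf (n - i) :=
  HairyConf.place ⟨fun j => p.1.1 (I.pointEmb j), p.1.2.comp I.pointEmb.monotone⟩
    fun b => (p.1.1 (I.hairEmb b), p.2 b)

theorem continuous_conf : Continuous I.conf := by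
  have hc : ∀ a, Continuous fun p : CellParam n i => p.1.1 a := fun a =>
    (continuous_apply a).comp (continuous_subtype_val.comp continuous_fst)
  refine HairyConf.continuous_place.comp (Continuous.prodMk (Continuous.subtype_mk
    (continuous_pi fun j => hc _) _) (continuous_pi fun b => Continuous.prodMk (hc _) ?_))
  exact (continuous_apply b).comp continuous_snd

variable {I} {p : CellParam n i}

theorem innerPoints_conf_subset : (I.conf p).innerPoints ⊆ Set.range p.1.1 := by
  refine (HairyConf.innerPoints_place _ _).trans (Set.union_subset ?_ ?_)
  · rintro _ ⟨j, rfl⟩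
    exact ⟨_, rfl⟩
  · rintro _ ⟨j, rfl⟩
    exact ⟨_, rfl⟩

theorem ncard_innerPoints_conf_le : (I.conf p).innerPoints.ncard ≤ n := by
  refine (Set.ncard_le_ncard innerPoints_conf_subset (Set.finite_range _)).trans ?_
  rw [← Set.image_univ]
  exact (Set.ncard_image_le Set.finite_univ).trans (by simp [Set.ncard_univ])

theorem shortHairs_conf_subset : (I.conf p).shortHairs ⊆
    (fun b => p.1.1 (I.hairEmb b)) '' {b | p.2 b ≠ 1} := by
  rintro x ⟨hx, hx'⟩
  obtain ⟨-, b, hb, hb'⟩ := HairyConf.exists_of_hair_place_ne_zero hx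
  exact ⟨b, fun h => hx' (hb'.symm.trans h), hb⟩

theorem conf_mem_hairyStage : I.conf p ∈ (hairyStage n (i + 1)).carrier ⟨n - i, le_top⟩ := by
  refine ncard_innerPoints_conf_le.lt_or_eq.imp id fun h => ⟨h, Nat.lt_succ_of_le ?_⟩
  refine (Set.ncard_le_ncard shortHairs_conf_subset (Set.toFinite _)).trans
    ((Set.ncard_image_le (Set.toFinite _)).trans ?_)
  exact (Set.ncard_le_card _).trans (by simp)

/-- If points collide, reach an end, or a hair shrinks to `0`, a point inside the interval is lost;
if a hair grows to length `1`, a short hair is lost. -/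
theorem conf_mem_hairyStage_of_not_isInterior (hp : ¬ p.IsInterior) :
    I.conf p ∈ (hairyStage n i).carrier ⟨n - i, le_top⟩ := by
  refine (ncard_innerPoints_conf_le (I := I) (p := p)).lt_or_eq.imp id fun h => ⟨h, ?_⟩
  have hr : (Set.range p.1.1).ncard ≤ (Set.univ : Set (Fin n)).ncard := by
    rw [← Set.image_univ]
    exact Set.ncard_image_le Set.finite_univ
  have hn : (Set.univ : Set (Fin n)).ncard = n := by simp [Set.ncard_univ]
  have he : (I.conf p).innerPoints = Set.range p.1.1 :=
    Set.eq_of_subset_of_ncard_le innerPoints_conf_subset (by omega) (Set.finite_range _)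
  have hinj : Function.Injective p.1.1 := by
    rw [← Set.injOn_univ]
    refine Set.injOn_of_ncard_image_eq ?_ Set.finite_univ
    rw [Set.image_univ, ← he, h, hn]
  have h01 : ∀ a, p.1.1 a ∉ ({0, 1} : Set unitInterval) := fun a =>
    (he.superset ⟨a, rfl⟩ : p.1.1 a ∈ (I.conf p).innerPoints).2
  -- As no point inside was lost, the positions are still generic, so it is some length that is
  -- degenerate.
  obtain ⟨b, hb⟩ : ∃ b, p.2 b ∈ ({0, 1} : Set unitInterval) := by
    by_contra! h'
    exact hp ⟨p.1.2.strictMono_of_injective hinj, h01, h'⟩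
  obtain hb | hb := hb
  -- Length `0` is impossible here: the foot would no longer be a point of the configuration.
  · obtain h' | h' := (he.superset ⟨I.hairEmb b, rfl⟩ : _ ∈ (I.conf p).innerPoints).1
    · obtain ⟨j, hj⟩ := h'
      exact absurd (hinj hj).symm (I.hairEmb_ne_pointEmb b j)
    · obtain ⟨-, b', h1, h2⟩ := HairyConf.exists_of_hair_place_ne_zero h'
      rw [I.hairEmb.injective (hinj h1)] at h2
      exact absurd (h2.symm.trans hb) h'
  · refine lt_of_le_of_lt (Set.ncard_le_ncard shortHairs_conf_subset (Set.toFinite _))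
      (lt_of_le_of_lt (Set.ncard_image_le (Set.toFinite _)) ?_)
    have : {b | p.2 b ≠ 1} ⊂ (Set.univ : Set (Fin i)) :=
      (Set.ssubset_univ_iff).2 fun h => (h.superset (Set.mem_univ b) : p.2 b ≠ 1) hb
    exact (Set.ncard_lt_ncard this Set.finite_univ).trans_eq (by simp [Set.ncard_univ])

theorem hairEmb_notMem_withEnds (hp : p.IsInterior) (b : Fin i) :
    p.1.1 (I.hairEmb b) ∉ withEnds (I.conf p).pt := by
  rintro (h | ⟨j, h⟩)
  · exact hp.pos _ h
  · exact I.hairEmb_ne_pointEmb b j (hp.strictMono.injective h).symm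

theorem hair_conf (hp : p.IsInterior) (b : Fin i) :
    (I.conf p).hair (p.1.1 (I.hairEmb b)) = p.2 b :=
  HairyConf.hair_place_of_injective (j := b)
    (fun _ _ h => I.hairEmb.injective (hp.strictMono.injective h)) (hairEmb_notMem_withEnds hp b)

theorem innerPoints_conf (hp : p.IsInterior) : (I.conf p).innerPoints = Set.range p.1.1 := by
  refine subset_antisymm innerPoints_conf_subset ?_
  rintro _ ⟨a, rfl⟩
  refine ⟨?_, hp.pos a⟩
  obtain ⟨b, rfl⟩ | ⟨j, rfl⟩ := I.exists_eq a
  · refine Or.inr (show _ ≠ _ from ?_)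
    rw [hair_conf hp b]
    exact fun h => hp.length b (Or.inl h)
  · exact Or.inl ⟨j, rfl⟩

theorem shortHairs_conf (hp : p.IsInterior) : (I.conf p).shortHairs = p.1.1 '' I.1 := by
  refine subset_antisymm (shortHairs_conf_subset.trans ?_) ?_
  · rintro _ ⟨b, -, rfl⟩
    exact ⟨_, I.range_hairEmb ▸ ⟨b, rfl⟩, rfl⟩
  · rintro _ ⟨a, ha, rfl⟩
    rw [← I.range_hairEmb] at ha
    obtain ⟨b, rfl⟩ := ha
    constructor <;> rw [hair_conf hp b]
    · exact fun h => hp.length b (Or.inl h)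
    · exact fun h => hp.length b (Or.inr h)

theorem strictMono_pt_conf (hp : p.IsInterior) : StrictMono (I.conf p).pt := fun _ _ h =>
  hp.strictMono (I.pointEmb.strictMono h)

theorem pt_conf_notMem (hp : p.IsInterior) (j : Fin (n - i)) :
    (I.conf p).pt j ∉ ({0, 1} : Set unitInterval) := hp.pos _

/-- The cell parameters survive every operation: the points inside the interval give the positions,
the feet of short hairs give `I`, and the lengths of these hairs are unchanged. -/
theorem eq_of_relabel_conf_eq {k : ℕ} {I' : CellIndex n i} {p' : CellParam n i}
    (hp : p.IsInterior) (hp' : p'.IsInterior) {t t' : {t : Fin k → unitInterval // Monotone t}}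
    (ht : withEnds t.1 ⊆ withEnds (I.conf p).pt) (ht' : withEnds t'.1 ⊆ withEnds (I'.conf p').pt)
    (h : (I.conf p).relabel t = (I'.conf p').relabel t') : I = I' ∧ p = p' := by
  have h1 := congrArg HairyConf.innerPoints h
  rw [HairyConf.innerPoints_relabel_eq _ _ ht, HairyConf.innerPoints_relabel_eq _ _ ht',
    innerPoints_conf hp, innerPoints_conf hp'] at h1
  have hx : p.1 = p'.1 := Subtype.ext ((hp.strictMono.range_inj hp'.strictMono).1 h1)
  have h2 := congrArg HairyConf.shortHairs h
  rw [HairyConf.shortHairs_relabel_eq _ _ ht, HairyConf.shortHairs_relabel_eq _ _ ht',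
    shortHairs_conf hp, shortHairs_conf hp', hx] at h2
  obtain rfl : I = I' :=
    Subtype.ext (Finset.coe_injective (hp'.strictMono.injective.image_injective h2))
  refine ⟨rfl, Prod.ext hx (funext fun b => ?_)⟩
  have e1 := hair_conf (I := I) hp b
  have e2 := hair_conf (I := I) hp' b
  have h3 := congrFun (congrArg HairyConf.hair h) (p.1.1 (I.hairEmb b))
  have n1 : (I.conf p).hair (p.1.1 (I.hairEmb b)) ≠ 0 :=
    fun h => hp.length b (Or.inl (e1.symm.trans h))
  rw [← hx] at e2
  have n2 : (I.conf p').hair (p.1.1 (I.hairEmb b)) ≠ 0 :=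
    fun h => hp'.length b (Or.inl (e2.symm.trans h))
  rwa [HairyConf.relabel_hair_of_ne_zero _ _ ht n1, HairyConf.relabel_hair_of_ne_zero _ _ ht' n2,
    e1, e2] at h3

end CellIndex

/-! ### The normal form of a configuration -/

open WBimod in
theorem exists_isLabel_of_mem_withEnds {q k : ℕ} {t : {t : Fin q → unitInterval // Monotone t}}
    (ht : StrictMono t.1) (ht' : ∀ j, t.1 j ∉ ({0, 1} : Set unitInterval))
    (u : {t : Fin k → unitInterval // Monotone t}) (hu : ∀ j, u.1 j ∈ withEnds t.1) :
    ∃ (L : ℕ → ℕ) (hL : IsLabel q k L), hL.pull t = u := by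
  have hs := strictMonoOn_extend ht ht'
  have hsurj : ∀ x ∈ withEnds t.1, ∃ m ≤ q + 1, extend t.1 m = x := by
    rintro x ((rfl | rfl) | ⟨j, rfl⟩)
    · exact ⟨0, Nat.zero_le _, extend_zero _⟩
    · exact ⟨q + 1, le_rfl, extend_gt _ (Nat.lt_succ_self q)⟩
    · exact ⟨j.1 + 1, Nat.succ_le_succ j.2.le, extend_succ _ j.2⟩
  have hu' : ∀ m, extend u.1 m ∈ withEnds t.1 := fun m => by
    obtain h | ⟨j, hj⟩ := extend_mem_withEnds u.1 m
    · exact Or.inl h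
    · exact hj ▸ hu j
  choose M hM hM' using fun m => hsurj _ (hu' m)
  have hM0 : M 0 = 0 := hs.injOn (hM 0) (Nat.zero_le _) (by rw [hM', extend_zero, extend_zero])
  -- The chosen indices `M` are used up to `k`; beyond, a label has to be a translation.
  let L : ℕ → ℕ := fun m => if m ≤ k then M m else q + 1 + (m - (k + 1))
  have hL : IsLabel q k L := by
    refine ⟨fun m m' h => ?_, ?_, fun a => ?_⟩
    · simp only [L]
      split_ifs with h1 h2 h2
      · rw [← hs.le_iff_le (hM m) (hM m'), hM', hM']
        exact monotone_extend u.2 h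
      · exact (hM m).trans (Nat.le_add_right _ _)
      · omega
      · omega
    · simp [L, hM0]
    · simp only [L]
      rw [if_neg (by omega)]
      omega
  refine ⟨L, hL, Subtype.ext (funext fun j => ?_)⟩
  have e : L (j.1 + 1) = M (j.1 + 1) := if_pos j.2
  change extend t.1 (L (j.1 + 1)) = _
  rw [e, hM', extend_succ _ j.2]

/-- The normal form: short hairs are kept, and every other point inside the interval, whether
labelled or the foot of a hair of length `1`, becomes a simple labelled point. Relabelling by the
points of `c` turns the superfluous ones back into hairs of length `1`. -/
theorem HairyConf.exists_eq_relabel_conf {k n i : ℕ} (c : HairyConf k)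
    (hn : c.innerPoints.ncard = n) (hi : c.shortHairs.ncard = i) :
    ∃ (I : CellIndex n i) (p : CellParam n i), p.IsInterior ∧
      (∀ j, c.pt j ∈ withEnds (I.conf p).pt) ∧ c = (I.conf p).relabel c.pts := by
  classical
  let e : Fin n ↪o unitInterval := c.finite_innerPoints.toFinset.orderEmbOfFin
    (by rw [← hn, Set.ncard_eq_toFinset_card _ c.finite_innerPoints])
  have he : Set.range e = c.innerPoints :=
    (Finset.range_orderEmbOfFin _ _).trans (Set.Finite.coe_toFinset _)
  let J : Finset (Fin n) := Finset.univ.filter fun a => e a ∈ c.shortHairs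
  have hJ : e '' J = c.shortHairs := by
    ext x
    constructor
    · rintro ⟨a, ha, rfl⟩
      exact (Finset.mem_filter.1 ha).2
    · intro hx
      obtain ⟨a, rfl⟩ := he.superset (c.shortHairs_subset_innerPoints hx)
      exact ⟨a, Finset.mem_coe.2 (Finset.mem_filter.2 ⟨Finset.mem_univ _, hx⟩), rfl⟩
  let I : CellIndex n i := ⟨J, by
    rw [← hi, ← hJ, Set.ncard_image_of_injective _ e.injective, Set.ncard_coe_finset]⟩
  have hshort : ∀ b, e (I.hairEmb b) ∈ c.shortHairs := fun b =>
    hJ ▸ ⟨_, I.range_hairEmb.subset ⟨b, rfl⟩, rfl⟩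
  let p : CellParam n i := (⟨e, e.monotone⟩, fun b => c.hair (e (I.hairEmb b)))
  have hp : p.IsInterior := by
    refine ⟨e.strictMono, fun a => (he.subset ⟨a, rfl⟩).2, fun b => ?_⟩
    rintro (h | h)
    · exact (hshort b).1 h
    · exact (hshort b).2 h
  have hcases : ∀ x ∈ c.innerPoints, x ∉ c.shortHairs → x ∈ Set.range (I.conf p).pt := by
    intro x hx hx'
    obtain ⟨a, rfl⟩ := he.superset hx
    obtain ⟨b, rfl⟩ | ⟨j, rfl⟩ := I.exists_eq a
    · exact absurd (hshort b) hx'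
    · exact ⟨j, rfl⟩
  refine ⟨I, p, hp, fun j => ?_, HairyConf.ext rfl (funext fun x => ?_)⟩
  · by_cases h : c.pt j ∈ ({0, 1} : Set unitInterval)
    · exact Or.inl h
    · exact Or.inr (hcases _ ⟨Or.inl ⟨j, rfl⟩, h⟩ fun h' => h'.1 (c.hair_pt j))
  · by_cases h1 : x ∈ withEnds c.pt
    · exact (c.hair_of_mem_withEnds h1).trans (relabel_hair_of_mem_withEnds _ c.pts h1).symm
    by_cases h2 : x ∈ Set.range (I.conf p).pt
    · rw [relabel_hair_of_mem_range _ c.pts h1 h2]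
      obtain ⟨j, rfl⟩ := h2
      have h3 : (I.conf p).pt j ∈ c.innerPoints := he.subset ⟨I.pointEmb j, rfl⟩
      have h4 : c.hair ((I.conf p).pt j) ≠ 0 := h3.1.resolve_left fun h => h1 (Or.inr h)
      -- A hair at `pointEmb j` of length different from `1` would be short, but the feet of short
      -- hairs are indexed by `hairEmb`.
      by_contra h5
      have h6 : e (I.pointEmb j) ∈ e '' J := hJ ▸ ⟨h4, h5⟩
      obtain ⟨a, ha, ha'⟩ := h6
      obtain ⟨b, rfl⟩ := I.range_hairEmb.superset ha
      exact I.hairEmb_ne_pointEmb b j (e.injective ha')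
    · rw [relabel_hair_of_notMem _ c.pts h1 h2]
      by_cases h3 : c.hair x = 0
      · rw [h3]
        by_contra h4
        obtain ⟨-, b, rfl, -⟩ := exists_of_hair_place_ne_zero (Ne.symm h4)
        exact (hshort b).1 h3
      · have h4 : x ∈ c.innerPoints := ⟨Or.inr h3, fun h => h1 (Or.inl h)⟩
        by_cases h5 : x ∈ c.shortHairs
        · rw [← hJ] at h5
          obtain ⟨a, ha, rfl⟩ := h5
          obtain ⟨b, rfl⟩ := I.range_hairEmb.superset ha
          exact (CellIndex.hair_conf hp b).symm
        · exact absurd (hcases x h4 h5) h2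

/-! ### The filtration by attachments of cells -/

theorem hairyStage_zero_zero (k : Deg ⊤) : (hairyStage 0 0).carrier k = ∅ :=
  Set.eq_empty_of_forall_notMem fun _ h =>
    h.elim (fun h => Nat.not_lt_zero _ h) fun h => Nat.not_lt_zero _ h.2

theorem hairyStage_succ_zero (n : ℕ) : hairyStage (n + 1) 0 = hairyFil n :=
  WBimod.Sub.ext (funext fun _ => Set.ext fun _ =>
    ⟨fun h => h.elim Nat.le_of_lt_succ fun h => absurd h.2 (Nat.not_lt_zero _),
      fun h => Or.inl (Nat.lt_succ_of_le h)⟩)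

/-- Feet of short hairs are points inside the interval, so with `n` such points there are always
fewer than `n + 1` short hairs. -/
theorem hairyStage_self_succ (n : ℕ) : hairyStage n (n + 1) = hairyFil n := by
  refine WBimod.Sub.ext (funext fun k => Set.ext fun c => ⟨fun h => h.elim le_of_lt fun h => h.1.le,
    fun h => Or.imp id (fun h => ⟨h, Nat.lt_succ_of_le ?_⟩) (lt_or_eq_of_le (show _ ≤ n from h))⟩)
  exact (Set.ncard_le_ncard (HairyConf.shortHairs_subset_innerPoints _)
    (HairyConf.finite_innerPoints _)).trans_eq h

/-! ### Characteristic maps, compactness and the attachment of cells -/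

namespace WBimod

variable {n i : ℕ} {N : ℕ∞} (hN : ((n - i : ℕ) : ℕ∞) ≤ N)

/-- The characteristic map of a cell. -/
noncomputable def cellMap (I : CellIndex n i) :
    C(CellParam n i, ((truncate N).obj (hairyStage n (i + 1)).toWBimod).obj ⟨n - i, hN⟩) where
  toFun p := ⟨I.conf p, CellIndex.conf_mem_hairyStage⟩
  continuous_toFun := Topology.IsInducing.subtypeVal.continuous_iff.2 I.continuous_conf

variable {hN} {k : Deg N}

theorem withEnds_pull {q k : ℕ} {L : ℕ → ℕ} (hL : IsLabel q k L)
    (t : {t : Fin q → unitInterval // Monotone t}) : withEnds (hL.pull t).1 ⊆ withEnds t.1 := by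
  rintro x (h | ⟨j, rfl⟩)
  · exact Or.inl h
  · exact extend_mem_withEnds _ _

theorem val_act_cellMap (w : Words assocOperad N ⟨n - i, hN⟩ k) (I : CellIndex n i)
    (p : CellParam n i) :
    (Subtype.val (Words.act ((truncate N).obj (hairyStage n (i + 1)).toWBimod) w
      (cellMap hN I p)) : HairyConf k.1) =
      (I.conf p).relabel (w.isLabel_label.pull (I.conf p).pts) :=
  Words.act_eq_relabel w _

/-- A configuration new in stage `i + 1` has exactly `n` points inside and exactly `i` short hairs,
so its normal form lies in an open cell of this type. -/
theorem exists_act_cellMap_eq (c : ((truncate N).obj (hairyStage n (i + 1)).toWBimod).obj k)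
    (hc : Subtype.val c ∉ (hairyStage n i).carrier ⟨k.1, le_top⟩) :
    ∃ (w : Words assocOperad N ⟨n - i, hN⟩ k) (I : CellIndex n i) (p : CellParam n i),
      p.IsInterior ∧ Words.act _ w (cellMap hN I p) = c := by
  obtain ⟨hn, hi⟩ := (c.2 : _ ∨ _).resolve_left fun h => hc (Or.inl h)
  have hi' : (HairyConf.shortHairs (Subtype.val c)).ncard = i :=
    le_antisymm (Nat.le_of_lt_succ hi) (not_lt.1 fun h => hc (Or.inr ⟨hn, h⟩))
  obtain ⟨I, p, hp, h1, h2⟩ := HairyConf.exists_eq_relabel_conf (Subtype.val c) hn hi'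
  obtain ⟨L, hL, hu⟩ := exists_isLabel_of_mem_withEnds (t := (I.conf p).pts)
    (CellIndex.strictMono_pt_conf hp) (CellIndex.pt_conf_notMem hp) (HairyConf.pts (Subtype.val c)) h1
  obtain ⟨w, rfl⟩ := Words.exists_label_eq (N := N) (q := ⟨n - i, hN⟩) (k := k) hL
  refine ⟨w, I, p, hp, Subtype.ext ?_⟩
  exact (val_act_cellMap w I p).trans <| (congrArg (I.conf p).relabel hu).trans h2.symm

/-- The image determines the cell and its parameter; then the labelled points, pulled back from a
generic family, determine the operation. -/
theorem act_cellMap_injective {w w' : Words assocOperad N ⟨n - i, hN⟩ k} {I I' : CellIndex n i}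
    {p p' : CellParam n i} (hp : p.IsInterior) (hp' : p'.IsInterior)
    (h : Words.act ((truncate N).obj (hairyStage n (i + 1)).toWBimod) w (cellMap hN I p) =
      Words.act _ w' (cellMap hN I' p')) : w = w' ∧ I = I' ∧ p = p' := by
  have h' := (val_act_cellMap w I p).symm.trans
    ((congrArg Subtype.val h).trans (val_act_cellMap w' I' p'))
  obtain ⟨rfl, rfl⟩ := CellIndex.eq_of_relabel_conf_eq (I := I) (I' := I') hp hp'
    (withEnds_pull _ _) (withEnds_pull _ _) h'
  refine ⟨Words.label_injective ?_, rfl, rfl⟩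
  exact w.isLabel_label.eq_of_pull_eq w'.isLabel_label (t := (I.conf p).pts)
    (CellIndex.strictMono_pt_conf hp) (CellIndex.pt_conf_notMem hp)
    (Subtype.ext (congrArg HairyConf.pt h'))

theorem act_cellMap_notMem (w : Words assocOperad N ⟨n - i, hN⟩ k) {I : CellIndex n i}
    {p : CellParam n i} (hp : p.IsInterior) :
    Subtype.val (Words.act ((truncate N).obj (hairyStage n (i + 1)).toWBimod) w (cellMap hN I p)) ∉
      (hairyStage n i).carrier ⟨k.1, le_top⟩ := by
  have e := val_act_cellMap w I p
  have e1 := (congrArg HairyConf.innerPoints e).trans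
    ((HairyConf.innerPoints_relabel_eq (I.conf p) _ (withEnds_pull _ _)).trans
      (CellIndex.innerPoints_conf hp))
  have e2 := (congrArg HairyConf.shortHairs e).trans
    ((HairyConf.shortHairs_relabel_eq (I.conf p) _ (withEnds_pull _ _)).trans
      (CellIndex.shortHairs_conf hp))
  have hinj := hp.strictMono.injective
  have c1 : (Set.range p.1.1).ncard = n := by
    rw [← Set.image_univ, Set.ncard_image_of_injective _ hinj]
    simp [Set.ncard_univ]
  have c2 : (p.1.1 '' (I.1 : Set (Fin n))).ncard = i := by
    rw [Set.ncard_image_of_injective _ hinj, Set.ncard_coe_finset, I.2]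
  rintro (h | h)
  · exact h.ne ((congrArg Set.ncard e1).trans c1)
  · exact h.2.ne ((congrArg Set.ncard e2).trans c2)

instance (n i : ℕ) : CompactSpace (CellParam n i) := by
  have : CompactSpace {x : Fin n → unitInterval // Monotone x} := by
    refine isCompact_iff_compactSpace.1 (IsClosed.isCompact ?_)
    exact isClosed_monotone
  infer_instance

/-- The new stage is the union of the old one and of finitely many images of compact cells: finitely
many operations, finitely many choices of feet. -/
theorem isCompact_hairyStage_succ {k : Deg ⊤} (h : IsCompact ((hairyStage n i).carrier k)) :
    IsCompact ((hairyStage n (i + 1)).carrier k) := by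
  have key : (hairyStage n (i + 1)).carrier k = (hairyStage n i).carrier k ∪
      ⋃ a : Words assocOperad ⊤ ⟨n - i, le_top⟩ k × CellIndex n i, Set.range fun p =>
        (Subtype.val (Words.act ((truncate ⊤).obj (hairyStage n (i + 1)).toWBimod) a.1
          (cellMap le_top a.2 p)) : HairyConf k.1) := by
    refine subset_antisymm (fun c hc => ?_) (Set.union_subset (hairyStage_le n i k) ?_)
    · by_cases hc' : c ∈ (hairyStage n i).carrier k
      · exact Or.inl hc'
      · obtain ⟨w, I, p, -, h⟩ := exists_act_cellMap_eq (N := ⊤) (hN := le_top) (k := k) ⟨c, hc⟩ hc'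
        exact Or.inr (Set.mem_iUnion.2 ⟨(w, I), p, congrArg Subtype.val h⟩)
    · refine Set.iUnion_subset fun a => ?_
      rintro _ ⟨p, rfl⟩
      exact Subtype.mem _
  rw [key]
  have : Finite (Words assocOperad ⊤ ⟨n - i, le_top⟩ k) := finite_words
  refine h.union (isCompact_iUnion fun a => isCompact_range ?_)
  have hval : Continuous (Subtype.val : {c : HairyConf k.1 //
      c ∈ ((hairyStage n (i + 1)).carrier k : Set (HairyConf k.1))} → HairyConf k.1) :=
    continuous_subtype_val
  exact hval.comp ((Words.act _ a.1).hom.continuous.comp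
    (cellMap le_top a.2).continuous)

theorem isCompact_hairyStage (n i : ℕ) (k : Deg ⊤) : IsCompact ((hairyStage n i).carrier k) := by
  induction n generalizing i with
  | zero =>
    induction i with
    | zero => rw [hairyStage_zero_zero]; exact isCompact_empty
    | succ i ih => exact isCompact_hairyStage_succ ih
  | succ n ihn =>
    induction i with
    | zero => rw [hairyStage_succ_zero, ← hairyStage_self_succ]; exact ihn _
    | succ i ih => exact isCompact_hairyStage_succ ih

/-- Since `hairyStage n (i + 1)` allows at most `i` short hairs, the cells attached at this step are
those with exactly `i` hairs. Normal forms in their interiors exist, are unique and avoid the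
preceding stage, as the criterion requires. -/
theorem isAttachment_hairyStage (hN : ((n - i : ℕ) : ℕ∞) ≤ N) :
    IsAttachment ((truncate N).map (Sub.incl (hairyStage_le n i))) ⟨n - i, hN⟩ (n + i)
      (n.choose i) := by
  obtain ⟨Φ, ⟨hinj, hsurj⟩, hΦ⟩ := exists_cellParam_of_disk n i
  have hcard : Nat.card (CellIndex n i) = n.choose i := by
    rw [Nat.card_eq_fintype_card, Fintype.card_finset_len, Fintype.card_fin]
  have hmem : ∀ (k : Deg N) (b : ((truncate N).obj (hairyStage n (i + 1)).toWBimod).obj k),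
      b ∈ Set.range (((truncate N).map (Sub.incl (hairyStage_le n i))).app k) ↔
        Subtype.val b ∈ (hairyStage n i).carrier ⟨k.1, le_top⟩ := by
    intro k b
    constructor
    · rintro ⟨a, rfl⟩
      exact a.2
    · exact fun h => ⟨⟨Subtype.val b, h⟩, rfl⟩
  rw [← hcard]
  have (k : Deg N) : Finite (Words assocOperad N ⟨n - i, hN⟩ k) := finite_words
  have : ∀ k, CompactSpace (((truncate N).obj (hairyStage n i).toWBimod).obj k) := fun k =>
    isCompact_iff_compactSpace.1 (isCompact_hairyStage n i ⟨k.1, le_top⟩)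
  have : ∀ k, T2Space (((truncate N).obj (hairyStage n (i + 1)).toWBimod).obj k) := fun k =>
    inferInstanceAs (T2Space {c : HairyConf k.1 // _ ∨ _})
  refine isAttachment_of_cells _ _ _ (CellIndex n i)
    (fun I => TopCat.ofHom ((cellMap hN I).comp Φ)) ?_ ?_ ?_ ?_ ?_
  · intro k a b h
    have h' := congrArg Subtype.val h
    exact Subtype.ext h'
  · intro I x
    refine (hmem _ _).2 ?_
    exact CellIndex.conf_mem_hairyStage_of_not_isInterior ((hΦ _).1 ⟨x, rfl⟩)
  · intro k b hb
    rw [hmem] at hb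
    obtain ⟨w, I, p, -, h⟩ := exists_act_cellMap_eq (hN := hN) b hb
    obtain ⟨x, rfl⟩ := hsurj p
    exact ⟨w, I, x, h⟩
  · intro k w w' I I' x x' hx hx' h
    rw [hΦ, not_not] at hx hx'
    obtain ⟨hw, hI, hp⟩ := act_cellMap_injective hx hx' h
    exact ⟨hw, hI, hinj hp⟩
  · intro k w I x hx
    rw [hΦ, not_not] at hx
    rw [hmem]
    exact act_cellMap_notMem w hx

end WBimod

/-! ### Cofibrancy -/

/-- The inclusion of a sub-bimodule. -/
def WBimod.Sub.subtype {O : NSOperad} {N : ℕ∞} {M : WBimod O N} (S : M.Sub) : S.toWBimod ⟶ M where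
  app _ := TopCat.ofHom ⟨Subtype.val, continuous_subtype_val⟩
  map_lact _ _ _ _ _ := rfl
  map_ract _ _ _ _ _ := rfl

/-- The enumeration of the pairs `(n, i)` with `i ≤ n + 1` in lexicographic order. -/
def stageIndex : ℕ → ℕ × ℕ
  | 0 => (0, 0)
  | j + 1 => if (stageIndex j).2 ≤ (stageIndex j).1 then
      ((stageIndex j).1, (stageIndex j).2 + 1) else ((stageIndex j).1 + 1, 0)

theorem stageIndex_succ (j : ℕ) : stageIndex (j + 1) =
    if (stageIndex j).2 ≤ (stageIndex j).1 then
      ((stageIndex j).1, (stageIndex j).2 + 1) else ((stageIndex j).1 + 1, 0) := rfl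

theorem stageIndex_snd_le (j : ℕ) : (stageIndex j).2 ≤ (stageIndex j).1 + 1 := by
  induction j with
  | zero => exact Nat.zero_le _
  | succ j ih =>
    rw [stageIndex_succ]
    split_ifs with h
    · exact Nat.succ_le_succ h
    · exact Nat.zero_le _

theorem monotone_stageIndex_fst : Monotone fun j => (stageIndex j).1 := by
  refine monotone_nat_of_le_succ fun j => ?_
  rw [stageIndex_succ]
  split_ifs
  · exact le_rfl
  · exact Nat.le_succ _

theorem exists_stageIndex_eq (n i : ℕ) (h : i ≤ n + 1) : ∃ j, stageIndex j = (n, i) := by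
  have succ : ∀ n i, i ≤ n + 1 → (∃ j, stageIndex j = (n, 0)) → ∃ j, stageIndex j = (n, i) := by
    intro n i hi h0
    induction i with
    | zero => exact h0
    | succ i ih =>
      obtain ⟨j, hj⟩ := ih (by omega)
      refine ⟨j + 1, ?_⟩
      rw [stageIndex_succ, hj, if_pos (Nat.le_of_succ_le_succ hi)]
  have zero : ∀ n, ∃ j, stageIndex j = (n, 0) := by
    intro n
    induction n with
    | zero => exact ⟨0, rfl⟩
    | succ n ih =>
      obtain ⟨j, hj⟩ := succ n (n + 1) le_rfl ih
      refine ⟨j + 1, ?_⟩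
      rw [stageIndex_succ, hj, if_neg (Nat.not_succ_le_self n)]
  exact succ n i h (zero n)

/-- The filtration of the bimodule of hairy configurations by attachments of cells, as a
sequence. -/
noncomputable def hairySeq (j : ℕ) : hairy.Sub := hairyStage (stageIndex j).1 (stageIndex j).2

/-- At the passage from `(n, n + 1)` to `(n + 1, 0)` the sub-bimodule does not change; every other
step is a genuine attachment. -/
theorem hairySeq_succ (j : ℕ) : hairySeq j = hairySeq (j + 1) ∨
    hairySeq (j + 1) = hairyStage (stageIndex j).1 ((stageIndex j).2 + 1) := by
  by_cases h : (stageIndex j).2 ≤ (stageIndex j).1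
  · right
    rw [hairySeq, stageIndex_succ, if_pos h]
  · left
    have h' : (stageIndex j).2 = (stageIndex j).1 + 1 :=
        le_antisymm (stageIndex_snd_le j) (by omega)
    rw [hairySeq, hairySeq, stageIndex_succ, if_neg h, h', hairyStage_self_succ,
      hairyStage_succ_zero]

theorem hairySeq_le_succ (j : ℕ) : hairySeq j ≤ hairySeq (j + 1) := by
  obtain h | h := hairySeq_succ j
  · rw [← h]
    exact fun _ => subset_rfl
  · rw [h]
    exact hairyStage_le _ _

theorem hairySeq_mono {j j' : ℕ} (h : j ≤ j') : hairySeq j ≤ hairySeq j' := by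
  induction j', h using Nat.le_induction with
  | base => exact fun _ => subset_rfl
  | succ j' _ ih => exact fun k => (ih k).trans (hairySeq_le_succ j' k)

theorem exists_hairySeq_eq (n : ℕ) : ∃ j, (stageIndex j).1 = n ∧ hairySeq j = hairyFil n := by
  obtain ⟨j, hj⟩ := exists_stageIndex_eq n (n + 1) le_rfl
  exact ⟨j, by rw [hj], by rw [hairySeq, hj, hairyStage_self_succ]⟩

/-! ### Cofibrancy of the bimodule and of the truncated filtration terms -/

namespace WBimod

variable {N : ℕ∞}

theorem exists_isAttachment_of_eq {S T : hairy.Sub} (h : S ≤ T) (h' : S = T) :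
    ∃ q d r, IsAttachment ((truncate N).map (Sub.incl h)) q d r := by
  subst h'
  have : IsIso ((truncate N).map (Sub.incl h)) :=
    inferInstanceAs (IsIso (𝟙 ((truncate N).obj S.toWBimod)))
  -- No cells are attached, so degree and dimension are arbitrary; degree `0` exists in every
  -- truncation.
  exact ⟨⟨0, zero_le⟩, 0, 0, isAttachment_of_isIso _ _ _⟩

/-- Cells of the layer `n` have degrees `n - i ≤ n`, so they can be attached freely in the
truncation at any `N ≥ n`. -/
theorem exists_isAttachment_hairySeq (j : ℕ) (hj : ((stageIndex j).1 : ℕ∞) ≤ N)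
    {S : hairy.Sub} (hS : S = hairySeq (j + 1)) (h : hairySeq j ≤ S) :
    ∃ q d r, IsAttachment ((truncate N).map (Sub.incl h)) q d r := by
  obtain h' | h' := hairySeq_succ j
  · exact exists_isAttachment_of_eq h (h'.trans hS.symm)
  · obtain rfl := hS.trans h'
    exact ⟨_, _, _, isAttachment_hairyStage (le_trans (by exact_mod_cast Nat.sub_le _ _) hj)⟩

theorem isCofibrant_hairy : IsCofibrant hairy := by
  -- Truncation at `⊤` changes nothing, by definition, and puts all stages in the form used for the
  -- attachments.
  refine isCofibrant_of_sequence (M := (truncate ⊤).obj hairy)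
    (fun j => (truncate ⊤).obj (hairySeq j).toWBimod)
    (fun j => (truncate ⊤).map (Sub.incl (hairySeq_le_succ j)))
    (fun j => (truncate ⊤).map (hairySeq j).subtype) (fun _ => rfl) (fun k => ?_)
    (fun j => exists_isAttachment_hairySeq j le_top rfl _) (fun j k a b h => Subtype.ext h)
    (fun k b => ?_) fun k s h => ?_
  · exact ⟨fun c => (hairyStage_zero_zero k).subset c.2⟩
  · obtain ⟨n, hn⟩ := Set.mem_iUnion.1 ((iUnion_hairyFil k).superset (Set.mem_univ b))
    obtain ⟨j, -, hj⟩ := exists_hairySeq_eq n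
    exact ⟨j, ⟨b, by rw [hj]; exact hn⟩, rfl⟩
  · refine (isOpen_iff_hairyFil k s).2 fun n => ?_
    obtain ⟨j, -, hj⟩ := exists_hairySeq_eq n
    rw [← hj]
    exact h j

/-- The sequence of attachments is stopped at the index `J` where it reaches `hairyFil n`, and
continued by identities. All layers used are at most `n`, so their cells have degrees inside the
truncation. -/
theorem isCofibrant_hairyFil (n : ℕ) :
    IsCofibrant ((truncate (n : ℕ∞)).obj (hairyFil n).toWBimod) := by
  obtain ⟨J, hJn, hJ⟩ := exists_hairySeq_eq n
  rw [← hJ]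
  have hle : ∀ j, hairySeq (min j J) ≤ hairySeq J := fun j => hairySeq_mono (min_le_right _ _)
  have hstep : ∀ j, hairySeq (min j J) ≤ hairySeq (min (j + 1) J) := fun j =>
    hairySeq_mono (min_le_min_right _ (Nat.le_succ j))
  refine isCofibrant_of_sequence (M := (truncate (n : ℕ∞)).obj (hairySeq J).toWBimod)
    (fun j => (truncate (n : ℕ∞)).obj (hairySeq (min j J)).toWBimod)
    (fun j => (truncate (n : ℕ∞)).map (Sub.incl (hstep j)))
    (fun j => (truncate (n : ℕ∞)).map (Sub.incl (hle j))) (fun _ => rfl) (fun k => ?_)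
    (fun j => ?_) (fun j k a b h => ?_) (fun k b => ?_) fun k s h => ?_
  · have key : ∀ m, m = 0 → (hairySeq m).carrier ⟨k.1, le_top⟩ ⊆ ∅ := by
      rintro _ rfl
      exact (hairyStage_zero_zero _).subset
    exact ⟨fun c => key _ (Nat.zero_min J) c.2⟩
  · obtain hj | hj := lt_or_ge j J
    · have e : min j J = j := min_eq_left hj.le
      have key : ∀ (m : ℕ) (hm : m = j) (h : hairySeq m ≤ hairySeq (min (j + 1) J)),
          ∃ q d r, IsAttachment ((truncate (n : ℕ∞)).map (Sub.incl h)) q d r := by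
        rintro m rfl h
        refine exists_isAttachment_hairySeq m ?_ (by rw [min_eq_left hj]) h
        exact_mod_cast (monotone_stageIndex_fst hj.le).trans_eq hJn
      exact key _ e _
    · exact exists_isAttachment_of_eq _ (by rw [min_eq_right hj, min_eq_right (by omega)])
  · have h' := congrArg Subtype.val h
    exact Subtype.ext h'
  · refine ⟨J, ⟨Subtype.val b, ?_⟩, rfl⟩
    rw [min_self]
    exact b.2
  · have key : ∀ (m : ℕ) (hm : m = J) (h : hairySeq m ≤ hairySeq J),
        IsOpen ((((truncate (n : ℕ∞)).map (Sub.incl h)).app k) ⁻¹' s) → IsOpen s := by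
      rintro _ rfl h hs
      exact hs
    exact key _ (min_self J) _ (h J)

end WBimod

open WBimod in
theorem propositionp :
    IsCofibrantModel hairy (regular assocOperad ⊤) ∧
    (∀ n : ℕ, IsCofibrantModel ((truncate (n : ℕ∞)).obj (hairyFil n).toWBimod)
      (regular assocOperad n)) ∧
    (∀ k, (hairyStage 0 0).carrier k = ∅) ∧
    (∀ n : ℕ, hairyStage (n + 1) 0 = hairyFil n ∧ hairyStage n (n + 1) = hairyFil n) ∧
    (∀ (n i : ℕ) (_ : i ≤ n) (N : ℕ∞) (hN : ((n - i : ℕ) : ℕ∞) ≤ N),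
      IsAttachment ((truncate N).map (Sub.incl (hairyStage_le n i))) ⟨n - i, hN⟩ (n + i)
        (n.choose i)) ∧
    (∀ k, ⋃ n, (hairyFil n).carrier k = Set.univ) ∧
    (∀ k (s : Set (hairy.obj k)), IsOpen s ↔
      ∀ n, IsOpen (Subtype.val ⁻¹' s : Set ((hairyFil n).carrier k))) := by
  refine ⟨⟨isCofibrant_hairy, toRegular _, fun k => ?_⟩,
    fun n => ⟨isCofibrant_hairyFil n, toRegular _, fun k => ?_⟩, hairyStage_zero_zero,
    fun n => ⟨hairyStage_succ_zero n, hairyStage_self_succ n⟩,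
    fun n i _ N hN => isAttachment_hairyStage hN, iUnion_hairyFil, isOpen_iff_hairyFil⟩
  · have : ContractibleSpace (hairy.obj k) := inferInstanceAs (ContractibleSpace (HairyConf k.1))
    exact isWeakEquiv_toRegular _ k
  · have : ContractibleSpace (((truncate (n : ℕ∞)).obj (hairyFil n).toWBimod).obj k) :=
      contractibleSpace_hairyFil (k := ⟨k.1, le_top⟩) (by exact_mod_cast k.2)
    exact isWeakEquiv_toRegular _ k
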